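/- Let $\mathcal C$ be a rigid C$^*$-tensor category, that is, a C$^*$-tensor category (with finite direct sums and subobjects) which is semisimple, has an irreducible tensor unit $\varepsilon$, and in which every object $\alpha$ has an object $\overline\alpha$ that is both a left and a right dual of $\alpha$. Let $\operatorname{Irr}(\mathcal C)$ be the set of isomorphism classes of irreducible objects and $d(\alpha)$ the categorical dimension of $\alpha$, i.e. $d(\alpha)=s^*s$ for a standard solution $s:\varepsilon\to\alpha\otimes\overline\alpha$, $t:\varepsilon\to\overline\alpha\otimes\alpha$ of the conjugate equations (one with $t^*(1\otimes X)t=s^*(X\otimes1)s$ for all $X\in\operatorname{End}(\alpha)$). A multiplier on $\mathcal C$ is a family of linear maps $\theta_{\alpha,\beta}:\operatorname{End}(\alpha\otimes\beta)\to\operatorname{End}(\alpha\otimes\beta)$ with $\theta_{\alpha_2,\beta_2}(UXV^*)=U\theta_{\alpha_1,\beta_1}(X)V^*$ and $\theta_{\alpha_2\otimes\alpha_1,\beta_1\otimes\beta_2}(1\otimes X\otimes1)=1\otimes\theta_{\alpha_1,\beta_1}(X)\otimes1$ for all $X\in\operatorname{End}(\alpha_1\otimes\beta_1)$ and all $U,V$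 in the span of the morphisms $u\otimes v$ with $u:\alpha_1\to\alpha_2$, $v:\beta_1\to\beta_2$. It has a unique extension, with the same compatibility with composition by such tensor products, to the spaces of morphisms $\gamma\otimes\delta\to\alpha\otimes\beta$; on morphisms $\varepsilon\otimes\varepsilon\to\alpha\otimes\overline\alpha$, $\alpha\in\operatorname{Irr}(\mathcal C)$, it is the multiplication by a scalar $\varphi(\alpha)$. This identifies multipliers with functions $\varphi:\operatorname{Irr}(\mathcal C)\to\mathbb C$. The function $\varphi$ is called a cp-multiplier if all $\theta_{\alpha,\beta}$ are completely positive. $\mathcal C$ has property (T) if every net of cp-multipliers $\varphi_n:\operatorname{Irr}(\mathcal C)\to\mathbb C$ that converges to $1$ pointwise converges to $1$ uniformly on $\operatorname{Irr}(\mathcal C)$. The fusion $*$-algebra $\mathbb C[\mathcal C]$ has vector space basis $\operatorname{Irr}(\mathcal C)$, product $\alpha\beta=\sum_\gamma\operatorname{mult}(\gamma,\alpha\otimes\beta)\,\gamma$ and involution $\alpha^*=\overline\alpha$; an object $\alpha\in\mathcal C$ is viewed as the element $\sum_\gamma\operatorname{mult}(\gamma,\alpha)\,\gamma$. A unital $*$-representation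 $\Theta:\mathbb C[\mathcal C]\to B(\mathcal K)$ is admissible if for every $\xi\in\mathcal K$ the function $\alpha\mapsto d(\alpha)^{-1}\langle\Theta(\alpha)\xi,\xi\rangle$ on $\operatorname{Irr}(\mathcal C)$ is a cp-multiplier. The universal C$^*$-algebra $C_u(\mathcal C)$ is the completion of $\mathbb C[\mathcal C]$ in a universal admissible representation. Then there is a unique unital $*$-homomorphism $\epsilon:C_u(\mathcal C)\to\mathbb C$ with $\epsilon(\alpha)=d(\alpha)$ for all $\alpha\in\mathcal C$ (the trivial representation), and the following conditions are equivalent. 1. $\mathcal C$ has property (T). 2. There exists a nonzero projection $p\in C_u(\mathcal C)$ such that $\alpha p=d(\alpha)p$ for all $\alpha\in\mathcal C$. 3. If $(\omega_n)$ is a net of states on $C_u(\mathcal C)$ and $\omega_n\to\epsilon$ in the weak$^*$ topology, then $\|\omega_n-\epsilon\|\to0$. Moreover, a nonzero projection $p$ as in 2 is unique and satisfies $\epsilon(p)=1$. -/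

import Mathlib

open CategoryTheory MonoidalCategory
open scoped CStarAlgebra

universe v u

/-- A C*-tensor category: a `ℂ`-linear monoidal category with an antilinear involutive
contravariant operation `dag` (the adjoint `f*`) and complete norms on the morphism spaces
satisfying the C*-identity and the positivity of `f* f`; the tensor product is compatible with
adjoints, the structure isomorphisms are unitary, and there are orthogonal direct sums and
subobjects. Composition is written in diagrammatic order, so `f ≫ dag f` is `f* f`. -/
class CStarTensorCategory (C : Type u) [Category.{v} C] [Preadditive C] [Linear ℂ C]
    [MonoidalCategory C] [MonoidalPreadditive C] [MonoidalLinear ℂ C] where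
  dag {X Y : C} : (X ⟶ Y) → (Y ⟶ X)
  dag_dag {X Y : C} (f : X ⟶ Y) : dag (dag f) = f
  dag_id (X : C) : dag (𝟙 X) = 𝟙 X
  dag_comp {X Y Z : C} (f : X ⟶ Y) (g : Y ⟶ Z) : dag (f ≫ g) = dag g ≫ dag f
  dag_add {X Y : C} (f g : X ⟶ Y) : dag (f + g) = dag f + dag g
  dag_smul {X Y : C} (c : ℂ) (f : X ⟶ Y) : dag (c • f) = star c • dag f
  homNorm (X Y : C) : Norm (X ⟶ Y)
  homCore (X Y : C) : NormedSpace.Core ℂ (X ⟶ Y)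
  hom_complete (X Y : C) :
    letI := NormedAddCommGroup.ofCore (homCore X Y)
    CompleteSpace (X ⟶ Y)
  norm_comp_le {X Y Z : C} (f : X ⟶ Y) (g : Y ⟶ Z) : ‖f ≫ g‖ ≤ ‖f‖ * ‖g‖
  norm_comp_dag {X Y : C} (f : X ⟶ Y) : ‖f ≫ dag f‖ = ‖f‖ * ‖f‖
  exists_comp_dag_eq {X Y : C} (f : X ⟶ Y) : ∃ g : X ⟶ X, f ≫ dag f = g ≫ dag g
  dag_tensor {X Y X' Y' : C} (f : X ⟶ Y) (g : X' ⟶ Y') : dag (f ⊗ₘ g) = dag f ⊗ₘ dag g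
  dag_associator (X Y Z : C) : dag (α_ X Y Z).hom = (α_ X Y Z).inv
  dag_leftUnitor (X : C) : dag (λ_ X).hom = (λ_ X).inv
  dag_rightUnitor (X : C) : dag (ρ_ X).hom = (ρ_ X).inv
  exists_directSum (X Y : C) : ∃ (Z : C) (a : X ⟶ Z) (b : Y ⟶ Z),
    a ≫ dag a = 𝟙 X ∧ b ≫ dag b = 𝟙 Y ∧ dag a ≫ a + dag b ≫ b = 𝟙 Z
  exists_subobject {X : C} (p : X ⟶ X) : p ≠ 0 → p ≫ p = p → dag p = p →
    ∃ (Y : C) (a : Y ⟶ X), a ≫ dag a = 𝟙 Y ∧ dag a ≫ a = p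

namespace CStarTensorCategory

section Basic

variable {C : Type u} [Category.{v} C] [Preadditive C] [Linear ℂ C]
  [MonoidalCategory C] [MonoidalPreadditive C] [MonoidalLinear ℂ C] [CStarTensorCategory C]

attribute [reducible, instance] homNorm

noncomputable instance (X : C) : NormedRing (End X) :=
  letI N : NormedAddCommGroup (X ⟶ X) := NormedAddCommGroup.ofCore (homCore (C := C) X X)
  { (inferInstance : Ring (End X)) with
    norm := (homNorm (C := C) X X).norm
    dist := N.dist
    dist_self := N.dist_self
    dist_comm := N.dist_comm
    dist_triangle := N.dist_triangle
    edist := N.edist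
    edist_dist := N.edist_dist
    toUniformSpace := N.toUniformSpace
    uniformity_dist := N.uniformity_dist
    toBornology := N.toBornology
    cobounded_sets := N.cobounded_sets
    eq_of_dist_eq_zero := N.eq_of_dist_eq_zero
    dist_eq := N.dist_eq
    norm_mul_le := fun a b => (norm_comp_le (C := C) b a).trans_eq (mul_comm _ _) }

instance (X : C) : CompleteSpace (End X) := hom_complete (C := C) X X

noncomputable instance (X : C) : NormedAlgebra ℂ (End X) where
  norm_smul_le c x := ((homCore (C := C) X X).norm_smul c x).le

instance (X : C) : StarRing (End X) where
  star a := dag (C := C) a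
  star_involutive a := dag_dag (C := C) a
  star_mul a b := dag_comp (C := C) b a
  star_add a b := dag_add (C := C) a b

/-- `End X` is a C*-algebra. -/
noncomputable instance (X : C) : CStarAlgebra (End X) where
  star_smul c a := dag_smul (C := C) c a
  norm_mul_self_le a := (norm_comp_dag (C := C) (show X ⟶ X from a)).ge

noncomputable instance (X : C) : PartialOrder (End X) := CStarAlgebra.spectralOrder (End X)

instance (X : C) : StarOrderedRing (End X) := CStarAlgebra.spectralOrderedRing (End X)

/-- The endomorphism `1 ⊗ x ⊗ 1` of `(X₂ ⊗ X₁) ⊗ (Y₁ ⊗ Y₂)`. -/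
def amplification (X₂ Y₂ : C) {X₁ Y₁ : C} (x : X₁ ⊗ Y₁ ⟶ X₁ ⊗ Y₁) :
    (X₂ ⊗ X₁) ⊗ (Y₁ ⊗ Y₂) ⟶ (X₂ ⊗ X₁) ⊗ (Y₁ ⊗ Y₂) :=
  (α_ X₂ X₁ (Y₁ ⊗ Y₂)).hom ≫
    X₂ ◁ ((α_ X₁ Y₁ Y₂).inv ≫ x ▷ Y₂ ≫ (α_ X₁ Y₁ Y₂).hom) ≫ (α_ X₂ X₁ (Y₁ ⊗ Y₂)).inv

theorem amplification_smul (X₂ Y₂ : C) {X₁ Y₁ : C} (c : ℂ) (x : X₁ ⊗ Y₁ ⟶ X₁ ⊗ Y₁) :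
    amplification X₂ Y₂ (c • x) = c • amplification X₂ Y₂ x := by
  simp [amplification]

/-- An object is irreducible if its endomorphisms are exactly the scalars. -/
def IsIrreducible (X : C) : Prop := 𝟙 X ≠ 0 ∧ ∀ f : X ⟶ X, ∃ c : ℂ, f = c • 𝟙 X

theorem dag_zero {X Y : C} : dag (0 : X ⟶ Y) = 0 := by
  simpa using dag_smul (C := C) 0 (0 : X ⟶ Y)

theorem dag_whiskerLeft (X : C) {Y Z : C} (f : Y ⟶ Z) : dag (X ◁ f) = X ◁ dag f := by
  rw [← id_tensorHom, dag_tensor, dag_id, id_tensorHom]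

theorem dag_whiskerRight {Y Z : C} (f : Y ⟶ Z) (X : C) : dag (f ▷ X) = dag f ▷ X := by
  rw [← tensorHom_id, dag_tensor, dag_id, tensorHom_id]

theorem eq_zero_of_comp_dag {X Y : C} {f : X ⟶ Y} (h : f ≫ dag f = 0) : f = 0 := by
  have h1 := norm_comp_dag f
  rw [h, (homCore X X).norm_eq_zero_iff 0 |>.2 rfl] at h1
  exact (homCore X Y).norm_eq_zero_iff f |>.1 (mul_self_eq_zero.1 h1.symm)

/-- Taking adjoints turns a right dual into a left dual. -/
@[reducible]
def dualPairing {X Y : C} (p : ExactPairing X Y) : ExactPairing Y X where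
  coevaluation' := dag (ε_ X Y)
  evaluation' := dag (η_ X Y)
  coevaluation_evaluation' := by
    have h := congrArg dag (ExactPairing.evaluation_coevaluation X Y)
    have e : dag (ρ_ X).inv = (ρ_ X).hom := by rw [← dag_rightUnitor, dag_dag]
    simpa only [dag_comp, dag_whiskerLeft, dag_whiskerRight, dag_associator, dag_leftUnitor, e,
      Category.assoc] using h
  evaluation_coevaluation' := by
    have h := congrArg dag (ExactPairing.coevaluation_evaluation X Y)
    have e : dag (λ_ Y).inv = (λ_ Y).hom := by rw [← dag_leftUnitor, dag_dag]
    have e' : dag (α_ Y X Y).inv = (α_ Y X Y).hom := by rw [← dag_associator, dag_dag]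
    simpa only [dag_comp, dag_whiskerLeft, dag_whiskerRight, e', dag_rightUnitor, e,
      Category.assoc] using h

theorem IsIrreducible.congr {X Y : C} (hX : IsIrreducible X) (e : X ≅ Y) : IsIrreducible Y := by
  refine ⟨fun h => hX.1 ?_, fun f => ?_⟩
  · rw [← e.hom_inv_id, ← Category.id_comp e.inv, h]; simp
  · obtain ⟨c, hc⟩ := hX.2 (e.hom ≫ f ≫ e.inv)
    refine ⟨c, ?_⟩
    have : f = e.inv ≫ (e.hom ≫ f ≫ e.inv) ≫ e.hom := by simp
    rw [this, hc]; simp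

theorem directSum_orthogonal {X Y Z : C} {a : X ⟶ Z} {b : Y ⟶ Z} (ha : a ≫ dag a = 𝟙 X)
    (hb : b ≫ dag b = 𝟙 Y) (h : dag a ≫ a + dag b ≫ b = 𝟙 Z) : a ≫ dag b = 0 := by
  have h1 : a ≫ dag b ≫ b = 0 := by
    have h2 := congrArg (a ≫ ·) h
    simp only [Preadditive.comp_add, Category.comp_id, ← Category.assoc] at h2
    rw [ha, Category.id_comp] at h2
    simpa using h2
  have h3 := congrArg (· ≫ dag b) h1
  simpa [hb] using h3

theorem IsIrreducible.isIso {X Y : C} (hX : IsIrreducible X) (hY : IsIrreducible Y) {f : X ⟶ Y}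
    (hf : f ≠ 0) : IsIso f := by
  obtain ⟨c, hc⟩ := hX.2 (f ≫ dag f)
  obtain ⟨d, hd⟩ := hY.2 (dag f ≫ f)
  have hc0 : c ≠ 0 := by
    rintro rfl
    exact hf (eq_zero_of_comp_dag (by simpa using hc))
  have hcd : c = d := by
    have h1 : c • f = d • f := by
      calc c • f = (f ≫ dag f) ≫ f := by simp [hc]
        _ = f ≫ (dag f ≫ f) := Category.assoc _ _ _
        _ = d • f := by simp [hd]
    by_contra hne
    have h2 : (c - d) • f = 0 := by rw [sub_smul, h1, sub_self]
    exact hf ((smul_eq_zero.1 h2).resolve_left (sub_ne_zero.2 hne))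
  refine ⟨c⁻¹ • dag f, ?_, ?_⟩
  · rw [Linear.comp_smul, hc, smul_smul, inv_mul_cancel₀ hc0, one_smul]
  · rw [Linear.smul_comp, hd, ← hcd, smul_smul, inv_mul_cancel₀ hc0, one_smul]

theorem IsIrreducible.finrank_self {X : C} (hX : IsIrreducible X) :
    Module.finrank ℂ (X ⟶ X) = 1 :=
  finrank_eq_one (𝟙 X) hX.1 fun f => (hX.2 f).imp fun _ h => h.symm

theorem IsIrreducible.finite_hom {X Y : C} (hX : IsIrreducible X) (hY : IsIrreducible Y) :
    Module.Finite ℂ (X ⟶ Y) := by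
  by_cases h : ∃ f : X ⟶ Y, f ≠ 0
  · obtain ⟨f, hf⟩ := h
    have := hX.isIso hY hf
    refine Module.Finite.of_surjective (LinearMap.toSpanSingleton ℂ (X ⟶ Y) f) fun g => ?_
    obtain ⟨c, hc⟩ := hY.2 (inv f ≫ g)
    refine ⟨c, ?_⟩
    have : g = f ≫ inv f ≫ g := by simp
    rw [this, hc]
    simp
  · push Not at h
    have : Subsingleton (X ⟶ Y) := ⟨fun f g => (h f).trans (h g).symm⟩
    infer_instance

/-- Post-composition with an isomorphism. -/
theorem finrank_hom_congr {X X' Y Y' : C} (e : X ≅ X') (e' : Y ≅ Y') :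
    Module.finrank ℂ (X ⟶ Y) = Module.finrank ℂ (X' ⟶ Y') :=
  LinearEquiv.finrank_eq (Linear.homCongr ℂ e e')

/-- `V`, with the morphisms `b i` and `b' i`, is a direct sum of the family `W`. -/
def IsDirectSum {n : ℕ} (V : C) (W : Fin n → C) (b : ∀ i, W i ⟶ V) (b' : ∀ i, V ⟶ W i) : Prop :=
  (∀ i, b i ≫ b' i = 𝟙 (W i)) ∧ (∀ i j, i ≠ j → b i ≫ b' j = 0) ∧ ∑ i, b' i ≫ b i = 𝟙 V

/-- Morphisms into a direct sum. -/
def IsDirectSum.homEquiv {n : ℕ} {V : C} {W : Fin n → C} {b : ∀ i, W i ⟶ V} {b' : ∀ i, V ⟶ W i}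
    (h : IsDirectSum V W b b') (Z : C) : (Z ⟶ V) ≃ₗ[ℂ] (∀ i, (Z ⟶ W i)) where
  toFun f i := f ≫ b' i
  map_add' f g := by ext; simp
  map_smul' c f := by ext; simp
  invFun g := ∑ i, g i ≫ b i
  left_inv f := by
    simp only [Category.assoc]
    rw [← Preadditive.comp_sum, h.2.2, Category.comp_id]
  right_inv g := by
    ext j
    simp only [Preadditive.sum_comp, Category.assoc]
    rw [Finset.sum_eq_single j]
    · simp [h.1]
    · intro i _ hij
      simp [h.2.1 i j hij]
    · simp

theorem IsDirectSum.whiskerLeft {n : ℕ} {V : C} {W : Fin n → C} {b : ∀ i, W i ⟶ V}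
    {b' : ∀ i, V ⟶ W i} (h : IsDirectSum V W b b') (Z : C) :
    IsDirectSum (Z ⊗ V) (fun i => Z ⊗ W i) (fun i => Z ◁ b i) (fun i => Z ◁ b' i) := by
  refine ⟨fun i => ?_, fun i j hij => ?_, ?_⟩
  · simp [← MonoidalCategory.whiskerLeft_comp, h.1]
  · simp [← MonoidalCategory.whiskerLeft_comp, h.2.1 i j hij]
  · simp only [← MonoidalCategory.whiskerLeft_comp]
    rw [← whiskerLeft_sum, h.2.2, MonoidalCategory.whiskerLeft_id]

theorem IsDirectSum.whiskerRight {n : ℕ} {V : C} {W : Fin n → C} {b : ∀ i, W i ⟶ V}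
    {b' : ∀ i, V ⟶ W i} (h : IsDirectSum V W b b') (Z : C) :
    IsDirectSum (V ⊗ Z) (fun i => W i ⊗ Z) (fun i => b i ▷ Z) (fun i => b' i ▷ Z) := by
  refine ⟨fun i => ?_, fun i j hij => ?_, ?_⟩
  · simp [← comp_whiskerRight, h.1]
  · simp [← comp_whiskerRight, h.2.1 i j hij]
  · simp only [← comp_whiskerRight]
    rw [← sum_whiskerRight, h.2.2, id_whiskerRight]

end Basic

end CStarTensorCategory

open CStarTensorCategory

/-- A rigid C*-tensor category: the tensor unit is irreducible, every object is an orthogonal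
direct sum of finitely many irreducible objects, and (through `RightRigidCategory`) every object
`X` has a dual `Xᘁ`, with `s = η_ X Xᘁ : 𝟙_ C ⟶ X ⊗ Xᘁ` and
`t = dag (ε_ X Xᘁ) : 𝟙_ C ⟶ Xᘁ ⊗ X` solving the conjugate equations. By taking adjoints, `Xᘁ` is
both a left and a right dual of `X`. -/
class RigidCStarTensorCategory (C : Type u) [Category.{v} C] [Preadditive C] [Linear ℂ C]
    [MonoidalCategory C] [MonoidalPreadditive C] [MonoidalLinear ℂ C] [RightRigidCategory C]
    [CStarTensorCategory C] : Prop where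
  irreducible_unit : IsIrreducible (𝟙_ C)
  semisimple (X : C) : ∃ (n : ℕ) (Y : Fin n → C) (a : ∀ i, Y i ⟶ X),
    (∀ i, IsIrreducible (Y i)) ∧ (∀ i, a i ≫ dag (a i) = 𝟙 (Y i)) ∧
    (∀ i j, i ≠ j → a i ≫ dag (a j) = 0) ∧ ∑ i, dag (a i) ≫ a i = 𝟙 X

namespace RigidCStarTensorCategory

section Fusion

variable {C : Type u} [Category.{v} C] [Preadditive C] [Linear ℂ C]
  [MonoidalCategory C] [MonoidalPreadditive C] [MonoidalLinear ℂ C] [RightRigidCategory C]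
  [CStarTensorCategory C] [RigidCStarTensorCategory C]

variable (C) in
/-- Isomorphism of irreducible objects. -/
instance irrSetoid : Setoid {X : C // IsIrreducible X} where
  r X Y := Nonempty (X.1 ≅ Y.1)
  iseqv := ⟨fun X => ⟨Iso.refl X.1⟩, fun ⟨e⟩ => ⟨e.symm⟩, fun ⟨e⟩ ⟨e'⟩ => ⟨e.trans e'⟩⟩

variable (C) in
/-- `Irr C`, the set of isomorphism classes of irreducible objects. -/
def Irr : Type u := Quotient (irrSetoid C)

/-- The class of an irreducible object. -/
def Irr.mk (X : C) (hX : IsIrreducible X) : Irr C := Quotient.mk _ ⟨X, hX⟩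

/-- A representative of a class in `Irr C`. -/
noncomputable def Irr.rep (π : Irr C) : C := (Quotient.out π).1

theorem Irr.irreducible_rep (π : Irr C) : IsIrreducible π.rep := (Quotient.out π).2

theorem Irr.mk_rep (π : Irr C) : Irr.mk π.rep π.irreducible_rep = π := Quotient.out_eq π

theorem Irr.mk_eq_iff {X Y : C} {hX : IsIrreducible X} {hY : IsIrreducible Y} :
    Irr.mk X hX = Irr.mk Y hY ↔ Nonempty (X ≅ Y) := Quotient.eq

theorem Irr.rep_mk {X : C} (hX : IsIrreducible X) : Nonempty ((Irr.mk X hX).rep ≅ X) :=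
  Irr.mk_eq_iff.1 (Irr.mk_rep _)

/-- `mult π X`, the multiplicity of `π` in `X`, is the dimension of the space of morphisms from
`π` to `X`. -/
noncomputable def mult (π : Irr C) (X : C) : ℕ := Module.finrank ℂ (π.rep ⟶ X)

theorem mult_congr (π : Irr C) {X Y : C} (e : X ≅ Y) : mult π X = mult π Y :=
  finrank_hom_congr (Iso.refl _) e

open scoped Classical in
theorem mult_irreducible (π : Irr C) {X : C} (hX : IsIrreducible X) :
    mult π X = if π = Irr.mk X hX then 1 else 0 := by
  split_ifs with h
  · subst h
    obtain ⟨e⟩ := Irr.rep_mk hX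
    exact (finrank_hom_congr e (Iso.refl X)).trans hX.finrank_self
  · have : Subsingleton (π.rep ⟶ X) := by
      refine ⟨fun f g => ?_⟩
      by_contra hne
      have := π.irreducible_rep.isIso hX (sub_ne_zero.2 hne)
      exact h (by rw [← π.mk_rep]; exact Irr.mk_eq_iff.2 ⟨asIso (f - g)⟩)
    exact Module.finrank_zero_of_subsingleton

theorem exists_isDirectSum (X : C) : ∃ (n : ℕ) (Y : Fin n → C) (b : ∀ i, Y i ⟶ X)
    (b' : ∀ i, X ⟶ Y i), (∀ i, IsIrreducible (Y i)) ∧ IsDirectSum X Y b b' := by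
  obtain ⟨n, Y, a, h1, h2, h3, h4⟩ := semisimple X
  exact ⟨n, Y, a, fun i => dag (a i), h1, h2, h3, h4⟩

theorem finite_hom {X : C} (hX : IsIrreducible X) (Y : C) : Module.Finite ℂ (X ⟶ Y) := by
  obtain ⟨n, Z, b, b', hZ, h⟩ := exists_isDirectSum Y
  have : ∀ i, Module.Finite ℂ (X ⟶ Z i) := fun i => hX.finite_hom (hZ i)
  exact Module.Finite.equiv (h.homEquiv X).symm

theorem mult_isDirectSum (π : Irr C) {n : ℕ} {V : C} {W : Fin n → C} {b : ∀ i, W i ⟶ V}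
    {b' : ∀ i, V ⟶ W i} (h : IsDirectSum V W b b') : mult π V = ∑ i, mult π (W i) := by
  have : ∀ i, Module.Finite ℂ (π.rep ⟶ W i) := fun i => finite_hom π.irreducible_rep _
  rw [mult, (h.homEquiv π.rep).finrank_eq, Module.finrank_pi_fintype]
  rfl

theorem finite_support_mult (X : C) : (Function.support fun π : Irr C => (mult π X : ℂ)).Finite := by
  classical
  obtain ⟨n, Z, b, b', hZ, h⟩ := exists_isDirectSum X
  refine (Set.finite_range fun i => Irr.mk (Z i) (hZ i)).subset fun π hπ => ?_
  by_contra hne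
  apply hπ
  have : mult π X = 0 := by
    rw [mult_isDirectSum π h]
    refine Finset.sum_eq_zero fun i _ => ?_
    rw [mult_irreducible π (hZ i), if_neg]
    exact fun hi => hne ⟨i, hi.symm⟩
  simp [this]

/-- The dual of an irreducible object is irreducible. -/
theorem irreducible_dual {X : C} (hX : IsIrreducible X) : IsIrreducible (Xᘁ) := by
  constructor
  · intro h
    apply hX.1
    have h1 : η_ X (Xᘁ) = 0 := by
      rw [← Category.comp_id (η_ X (Xᘁ)), ← MonoidalCategory.whiskerLeft_id, h]
      simp
    have h2 := ExactPairing.evaluation_coevaluation X (Xᘁ)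
    rw [h1] at h2
    have h3 : (λ_ X).inv ≫ ((λ_ X).hom ≫ (ρ_ X).inv) ≫ (ρ_ X).hom = 0 := by
      rw [← h2]; simp
    simpa using h3
  · intro f
    let h := tensorRightHomEquiv (𝟙_ C) X (Xᘁ) X
    obtain ⟨c, hc⟩ := hX.2 ((λ_ X).inv ≫ h.symm (η_ X (Xᘁ) ≫ X ◁ f))
    refine ⟨c, ?_⟩
    have h1 : h.symm (η_ X (Xᘁ) ≫ X ◁ f) = h.symm (η_ X (Xᘁ) ≫ X ◁ (c • 𝟙 (Xᘁ))) := by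
      have h2 : η_ X (Xᘁ) ≫ X ◁ (c • 𝟙 (Xᘁ)) = η_ X (Xᘁ) ≫ (c • 𝟙 X) ▷ (Xᘁ) := by simp
      rw [h2, tensorRightHomEquiv_symm_coevaluation_comp_whiskerRight, ← hc]
      simp
    have h2 := congrArg (tensorLeftHomEquiv (𝟙_ C) X (Xᘁ) (Xᘁ)).symm (h.symm.injective h1)
    rw [tensorLeftHomEquiv_symm_coevaluation_comp_whiskerLeft,
      tensorLeftHomEquiv_symm_coevaluation_comp_whiskerLeft] at h2
    exact (cancel_epi _).1 h2

/-- An isomorphism of objects gives an isomorphism of the duals. -/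
def dualCongr {X Y : C} (e : X ≅ Y) : Xᘁ ≅ Yᘁ where
  hom := e.invᘁ
  inv := e.homᘁ
  hom_inv_id := by rw [← comp_rightAdjointMate, e.hom_inv_id, rightAdjointMate_id]
  inv_hom_id := by rw [← comp_rightAdjointMate, e.inv_hom_id, rightAdjointMate_id]

/-- `conj π` is the class of the dual of `π`. -/
noncomputable def Irr.conj (π : Irr C) : Irr C := Irr.mk (π.repᘁ) (irreducible_dual π.irreducible_rep)

theorem Irr.conj_mk {X : C} (hX : IsIrreducible X) :
    (Irr.mk X hX).conj = Irr.mk (Xᘁ) (irreducible_dual hX) :=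
  Irr.mk_eq_iff.2 ⟨dualCongr (Irr.rep_mk hX).some⟩

theorem Irr.conj_conj (π : Irr C) : π.conj.conj = π := by
  conv_rhs => rw [← π.mk_rep]
  rw [Irr.conj, Irr.mk_eq_iff]
  obtain ⟨e⟩ := Irr.rep_mk (irreducible_dual π.irreducible_rep)
  exact ⟨(dualCongr e).trans (rightDualIso HasRightDual.exact (dualPairing HasRightDual.exact))⟩

theorem IsDirectSum.dual {n : ℕ} {V : C} {W : Fin n → C} {b : ∀ i, W i ⟶ V}
    {b' : ∀ i, V ⟶ W i} (h : IsDirectSum V W b b') :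
    IsDirectSum (Vᘁ) (fun i => (W i)ᘁ) (fun i => (b' i)ᘁ) (fun i => (b i)ᘁ) := by
  have hz : ∀ {X Y : C}, (0 : X ⟶ Y)ᘁ = 0 := by intros; simp [rightAdjointMate]
  have hs : ∀ {X Y : C} (f : Fin n → (X ⟶ Y)), (∑ i, f i)ᘁ = ∑ i, (f i)ᘁ := by
    intro X Y f
    simp only [rightAdjointMate, sum_whiskerRight, whiskerLeft_sum, Preadditive.sum_comp,
      Preadditive.comp_sum]
  refine ⟨fun i => ?_, fun i j hij => ?_, ?_⟩
  · rw [← comp_rightAdjointMate, h.1, rightAdjointMate_id]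
  · rw [← comp_rightAdjointMate, h.2.1 j i hij.symm, hz]
  · simp only [← comp_rightAdjointMate]
    rw [← hs, h.2.2, rightAdjointMate_id]

variable (C) in
/-- The fusion *-algebra `ℂ[C]`: the vector space with basis `Irr C`, with the product given by the
fusion rules and the involution given by duality. -/
def FusionAlgebra : Type u := Irr C →₀ ℂ

namespace FusionAlgebra

noncomputable instance : AddCommGroup (FusionAlgebra C) := inferInstanceAs (AddCommGroup (Irr C →₀ ℂ))

noncomputable instance : Module ℂ (FusionAlgebra C) := inferInstanceAs (Module ℂ (Irr C →₀ ℂ))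

/-- The basis element `π` of the fusion algebra. -/
noncomputable def basis (π : Irr C) : FusionAlgebra C := Finsupp.single π 1

/-- The element `∑ π, mult π X • π` of the fusion algebra defined by an object `X`. -/
noncomputable def of (X : C) : FusionAlgebra C :=
  Finsupp.ofSupportFinite (fun π => (mult π X : ℂ)) (finite_support_mult X)

/-- The product: `π * ρ = ∑ γ, mult γ (π ⊗ ρ) • γ`, extended bilinearly. -/
noncomputable def mulAux : (Irr C →₀ ℂ) →ₗ[ℂ] (Irr C →₀ ℂ) →ₗ[ℂ] FusionAlgebra C :=
  Finsupp.lift ((Irr C →₀ ℂ) →ₗ[ℂ] FusionAlgebra C) ℂ (Irr C) fun π =>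
    Finsupp.lift (FusionAlgebra C) ℂ (Irr C) fun ρ => of (π.rep ⊗ ρ.rep)

/-- The product as a bilinear map. -/
noncomputable def mulHom : FusionAlgebra C →ₗ[ℂ] FusionAlgebra C →ₗ[ℂ] FusionAlgebra C := mulAux

noncomputable instance : Mul (FusionAlgebra C) := ⟨fun x y => mulHom x y⟩

noncomputable instance : One (FusionAlgebra C) := ⟨basis (Irr.mk (𝟙_ C) irreducible_unit)⟩

/-- The involution: `star (∑ π, x π • π) = ∑ π, conj (x π) • π.conj`. -/
noncomputable instance : Star (FusionAlgebra C) :=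
  ⟨fun x => Finsupp.sum x fun π c => star c • basis π.conj⟩

theorem basis_mul_basis (π ρ : Irr C) : basis π * basis ρ = of (π.rep ⊗ ρ.rep) := by
  change mulAux (Finsupp.single π 1) (Finsupp.single ρ 1) = _
  simp [mulAux]

theorem of_congr {X Y : C} (e : X ≅ Y) : of X = of Y :=
  Finsupp.ext fun π => congrArg Nat.cast (mult_congr π e)

theorem of_irreducible {X : C} (hX : IsIrreducible X) : of X = basis (Irr.mk X hX) := by
  classical
  refine Finsupp.ext fun π => ?_
  change (mult π X : ℂ) = Finsupp.single (Irr.mk X hX) (1 : ℂ) π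
  rw [mult_irreducible π hX, Finsupp.single_apply]
  simp [eq_comm]

theorem of_rep (π : Irr C) : of π.rep = basis π := by
  rw [of_irreducible π.irreducible_rep, π.mk_rep]

theorem of_isDirectSum {n : ℕ} {V : C} {W : Fin n → C} {b : ∀ i, W i ⟶ V}
    {b' : ∀ i, V ⟶ W i} (h : IsDirectSum V W b b') : of V = ∑ i, of (W i) := by
  refine Finsupp.ext fun π => ?_
  have : (∑ i, of (W i) : Irr C →₀ ℂ) π = ∑ i, (mult π (W i) : ℂ) := Finsupp.finsetSum_apply _ _ _
  refine Eq.trans ?_ this.symm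
  change (mult π V : ℂ) = _
  rw [mult_isDirectSum π h]
  push_cast
  rfl

theorem of_mul_of (X Y : C) : of X * of Y = of (X ⊗ Y) := by
  obtain ⟨n, V, b, b', hV, h⟩ := exists_isDirectSum X
  obtain ⟨m, W, d, d', hW, k⟩ := exists_isDirectSum Y
  have hi : ∀ i j, of (V i) * of (W j) = of (V i ⊗ W j) := fun i j => by
    rw [of_irreducible (hV i), of_irreducible (hW j), basis_mul_basis]
    exact of_congr (tensorIso (Irr.rep_mk (hV i)).some (Irr.rep_mk (hW j)).some)
  change mulHom (of X) (of Y) = _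
  rw [of_isDirectSum h, of_isDirectSum k, of_isDirectSum (h.whiskerRight Y),
    map_sum mulHom (fun i => of (V i)) Finset.univ, LinearMap.sum_apply]
  refine Finset.sum_congr rfl fun i _ => ?_
  rw [map_sum, of_isDirectSum (k.whiskerLeft (V i))]
  exact Finset.sum_congr rfl fun j _ => hi i j

theorem induction_on {p : FusionAlgebra C → Prop} (x : FusionAlgebra C) (h0 : p 0)
    (hadd : ∀ x y, p x → p y → p (x + y)) (hb : ∀ (c : ℂ) (π : Irr C), p (c • basis π)) : p x := by
  refine Finsupp.induction_linear x h0 hadd fun π c => ?_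
  have h : c • basis π = (Finsupp.single π c : Irr C →₀ ℂ) :=
    (Finsupp.smul_single c π (1 : ℂ)).trans (by simp)
  exact h ▸ hb c π

noncomputable instance : NonUnitalNonAssocRing (FusionAlgebra C) where
  left_distrib x y z := map_add (mulHom x) y z
  right_distrib x y z := LinearMap.map_add₂ mulHom x y z
  zero_mul x := LinearMap.map_zero₂ mulHom x
  mul_zero x := map_zero (mulHom x)

theorem smul_mul (c : ℂ) (x y : FusionAlgebra C) : c • x * y = c • (x * y) :=
  LinearMap.map_smul₂ mulHom c x y

theorem mul_smul' (c : ℂ) (x y : FusionAlgebra C) : x * c • y = c • (x * y) :=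
  map_smul (mulHom x) c y

noncomputable instance : Ring (FusionAlgebra C) where
  mul_assoc x y z := by
    induction x using induction_on with
    | h0 => simp only [zero_mul]
    | hadd x x' h h' => simp only [add_mul, h, h']
    | hb c π =>
    induction y using induction_on with
    | h0 => simp only [zero_mul, mul_zero]
    | hadd x x' h h' => simp only [add_mul, mul_add, h, h']
    | hb d ρ =>
    induction z using induction_on with
    | h0 => simp only [mul_zero]
    | hadd x x' h h' => simp only [mul_add, h, h']
    | hb e σ =>
    simp only [smul_mul, mul_smul', ← of_rep, of_mul_of, of_congr (α_ π.rep ρ.rep σ.rep)]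
  one_mul x := by
    induction x using induction_on with
    | h0 => simp only [mul_zero]
    | hadd x x' h h' => simp only [mul_add, h, h']
    | hb c π =>
    change basis _ * _ = _
    rw [mul_smul', ← of_irreducible, ← of_rep, of_mul_of, of_congr (λ_ π.rep)]
  mul_one x := by
    induction x using induction_on with
    | h0 => simp only [zero_mul]
    | hadd x x' h h' => simp only [add_mul, h, h']
    | hb c π =>
    change _ * basis _ = _
    rw [smul_mul, ← of_irreducible, ← of_rep, of_mul_of, of_congr (ρ_ π.rep)]
  neg_add_cancel := neg_add_cancel
  zsmul := fun n x => n • x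
  zsmul_zero' := SubNegMonoid.zsmul_zero'
  zsmul_succ' := SubNegMonoid.zsmul_succ'
  zsmul_neg' := SubNegMonoid.zsmul_neg'
  sub_eq_add_neg := sub_eq_add_neg

noncomputable instance : Algebra ℂ (FusionAlgebra C) := Algebra.ofModule smul_mul mul_smul'

theorem star_basis (π : Irr C) : star (basis π) = basis π.conj := by
  change Finsupp.sum (Finsupp.single π 1) _ = _
  simp

theorem star_add' (x y : FusionAlgebra C) : star (x + y) = star x + star y :=
  Finsupp.sum_add_index' (by simp) (by simp [add_smul])

theorem star_smul' (c : ℂ) (x : FusionAlgebra C) : star (c • x) = star c • star x := by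
  refine (Finsupp.sum_smul_index (g := (x : Irr C →₀ ℂ)) (b := c) (by simp)).trans ?_
  refine Eq.trans ?_ Finsupp.smul_sum.symm
  refine Finsupp.sum_congr fun π _ => ?_
  rw [star_mul, smul_smul, mul_comm]

theorem star_of (X : C) : star (of X) = of (Xᘁ) := by
  obtain ⟨n, V, b, b', hV, h⟩ := exists_isDirectSum X
  have hs : ∀ f : Fin n → FusionAlgebra C, star (∑ i, f i) = ∑ i, star (f i) := fun f =>
    map_sum (AddMonoidHom.mk' (star : FusionAlgebra C → FusionAlgebra C) star_add') f Finset.univ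
  rw [of_isDirectSum h, hs, of_isDirectSum (IsDirectSum.dual h)]
  refine Finset.sum_congr rfl fun i _ => ?_
  rw [of_irreducible (hV i), star_basis, Irr.conj_mk, of_irreducible]

noncomputable instance : StarRing (FusionAlgebra C) where
  star_add := star_add'
  star_involutive x := by
    induction x using induction_on with
    | h0 =>
      have h0 : star (0 : FusionAlgebra C) = 0 := by simpa using star_smul' 0 (0 : FusionAlgebra C)
      rw [h0, h0]
    | hadd x x' h h' => rw [star_add', star_add', h, h']
    | hb c π => rw [star_smul', star_smul', star_star, star_basis, star_basis, Irr.conj_conj]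
  star_mul x y := by
    have h0 : star (0 : FusionAlgebra C) = 0 := by simpa using star_smul' 0 (0 : FusionAlgebra C)
    induction x using induction_on with
    | h0 => simp only [zero_mul, mul_zero, h0]
    | hadd x x' h h' => simp only [add_mul, mul_add, h, h', star_add']
    | hb c π =>
    induction y using induction_on with
    | h0 => simp only [zero_mul, mul_zero, h0]
    | hadd x x' h h' => simp only [add_mul, mul_add, h, h', star_add']
    | hb d ρ =>
    simp only [smul_mul, mul_smul', star_smul', ← of_rep, of_mul_of, star_of]
    rw [smul_comm, of_congr (rightDualTensorIso π.rep ρ.rep)]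

instance : StarModule ℂ (FusionAlgebra C) := ⟨star_smul'⟩

end FusionAlgebra

/-- A solution `s = η_ X Y`, `t = dag (ε_ X Y)` of the conjugate equations is standard if
`t* (1 ⊗ f) t = s* (f ⊗ 1) s` for all endomorphisms `f` of `X`. -/
def IsStandard {X Y : C} (p : ExactPairing X Y) : Prop :=
  ∀ f : X ⟶ X, dag (ε_ X Y) ≫ Y ◁ f ≫ ε_ X Y = η_ X Y ≫ f ▷ Y ≫ dag (η_ X Y)

/-- `d` is the trace `s* s` of the identity of `X` for a standard solution of the conjugate
equations. -/
def IsDimension (X : C) (d : ℝ) : Prop :=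
  ∃ (Y : C) (p : ExactPairing X Y), IsStandard p ∧ η_ X Y ≫ dag (η_ X Y) = (d : ℂ) • 𝟙 (𝟙_ C)

/-- The categorical dimension `d(X)`: the unique number `d` with `IsDimension X d`. -/
noncomputable def dim (X : C) : ℝ := Classical.epsilon (IsDimension X)

theorem exists_scalar {X Y : C} (hX : IsIrreducible X) (f : X ⟶ Y) :
    ∃ c : ℝ, 0 ≤ c ∧ f ≫ dag f = (c : ℂ) • 𝟙 X := by
  obtain ⟨g, hg⟩ := exists_comp_dag_eq f
  obtain ⟨z, rfl⟩ := hX.2 g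
  refine ⟨‖z‖ ^ 2, by positivity, ?_⟩
  rw [hg, dag_smul, dag_id, Linear.comp_smul, Linear.smul_comp, Category.id_comp, smul_smul]
  congr 1
  rw [mul_comm, Complex.star_def, Complex.mul_conj, Complex.normSq_eq_norm_sq]

theorem exists_scalar_pos {X Y : C} (hX : IsIrreducible X) {f : X ⟶ Y} (hf : f ≠ 0) :
    ∃ c : ℝ, 0 < c ∧ f ≫ dag f = (c : ℂ) • 𝟙 X := by
  obtain ⟨c, hc, h⟩ := exists_scalar hX f
  refine ⟨c, hc.lt_of_ne ?_, h⟩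
  rintro rfl
  exact hf (eq_zero_of_comp_dag (by simpa using h))

theorem coevaluation_ne_zero {X Y : C} (hX : IsIrreducible X) (p : ExactPairing X Y) :
    η_ X Y ≠ 0 := by
  intro h1
  apply hX.1
  have h2 := ExactPairing.evaluation_coevaluation X Y
  rw [h1] at h2
  have h3 : (λ_ X).inv ≫ ((λ_ X).hom ≫ (ρ_ X).inv) ≫ (ρ_ X).hom = 0 := by
    rw [← h2]; simp
  simpa using h3

theorem evaluation_ne_zero {X Y : C} (hX : IsIrreducible X) (p : ExactPairing X Y) :
    ε_ X Y ≠ 0 := by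
  intro h1
  apply hX.1
  have h2 := ExactPairing.evaluation_coevaluation X Y
  rw [h1] at h2
  have h3 : (λ_ X).inv ≫ ((λ_ X).hom ≫ (ρ_ X).inv) ≫ (ρ_ X).hom = 0 := by
    rw [← h2]; simp
  simpa using h3

/-- Rescaling a solution of the conjugate equations. -/
@[reducible]
noncomputable def scalePairing {X Y : C} (p : ExactPairing X Y) (r : ℂ) (hr : r ≠ 0) : ExactPairing X Y where
  coevaluation' := r • η_ X Y
  evaluation' := r⁻¹ • ε_ X Y
  coevaluation_evaluation' := by
    have := ExactPairing.coevaluation_evaluation X Y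
    simp [smul_smul, hr, this]
  evaluation_coevaluation' := by
    have := ExactPairing.evaluation_coevaluation X Y
    simp [smul_smul, hr, this]

theorem exists_isDimension {X : C} (hX : IsIrreducible X) : ∃ d, IsDimension X d := by
  obtain ⟨a, ha, hη⟩ := exists_scalar_pos irreducible_unit
    (coevaluation_ne_zero hX (HasRightDual.exact (X := X)))
  have hne : dag (ε_ X (Xᘁ)) ≠ 0 := fun h =>
    evaluation_ne_zero hX (HasRightDual.exact (X := X)) (by rw [← dag_dag (ε_ X (Xᘁ)), h, dag_zero])
  obtain ⟨b, hb, hε⟩ := exists_scalar_pos irreducible_unit hne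
  rw [dag_dag] at hε
  have hr : ((b / a) ^ (1 / 4 : ℝ) : ℝ) ≠ 0 := by positivity
  set r : ℝ := (b / a) ^ (1 / 4 : ℝ) with hrdef
  have hr4 : r ^ 4 = b / a := by
    rw [hrdef, ← Real.rpow_natCast, ← Real.rpow_mul (by positivity)]
    norm_num
  have hrC : (r : ℂ) ≠ 0 := by exact_mod_cast hr
  have e1 : (scalePairing HasRightDual.exact (r : ℂ) hrC).coevaluation' = (r : ℂ) • η_ X (Xᘁ) := rfl
  have e2 : (scalePairing HasRightDual.exact (r : ℂ) hrC).evaluation' =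
    (r : ℂ)⁻¹ • ε_ X (Xᘁ) := rfl
  generalize scalePairing (HasRightDual.exact (X := X)) (r : ℂ) hrC = p at e1 e2
  refine ⟨r ^ 2 * a, Xᘁ, p, fun f => ?_, ?_⟩
  · obtain ⟨c, rfl⟩ := hX.2 f
    change dag p.evaluation' ≫ _ ≫ p.evaluation' = p.coevaluation' ≫ _ ≫ dag p.coevaluation'
    rw [e1, e2]
    simp only [dag_smul, MonoidalLinear.whiskerLeft_smul, MonoidalLinear.smul_whiskerRight,
      MonoidalCategory.whiskerLeft_id, id_whiskerRight, Linear.smul_comp, Linear.comp_smul,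
      Category.id_comp, hη, hε, smul_smul]
    congr 1
    have : r⁻¹ * r⁻¹ * b = r * r * a := by
      have : b = r ^ 4 * a := by rw [hr4]; field_simp
      rw [this]; field_simp
    have h := congrArg (fun t : ℝ => (t : ℂ)) this
    push_cast at h
    simp only [star_inv₀, Complex.star_def, Complex.conj_ofReal]
    linear_combination c * h
  · change p.coevaluation' ≫ dag p.coevaluation' = _
    rw [e1]
    simp only [dag_smul, Linear.smul_comp, Linear.comp_smul, hη, smul_smul]
    congr 1
    simp only [Complex.star_def, Complex.conj_ofReal]
    push_cast
    ring

theorem dim_ne_zero {X : C} (hX : IsIrreducible X) : dim X ≠ 0 := by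
  obtain ⟨Y, p, -, h⟩ := Classical.epsilon_spec (exists_isDimension hX)
  intro h0
  have h1 : Classical.epsilon (IsDimension X) = 0 := h0
  rw [h1] at h
  exact coevaluation_ne_zero hX p (eq_zero_of_comp_dag (by simpa using h))

variable (C) in
/-- A multiplier on `C`: a family of linear maps `θ X Y` on `End (X ⊗ Y)` with
`θ (U x V) = U θ(x) V` for `U = a ⊗ b` and `V = a' ⊗ b'`, and with
`θ (1 ⊗ x ⊗ 1) = 1 ⊗ θ(x) ⊗ 1` (up to the associativity isomorphisms). -/
structure Multiplier where
  /-- The maps `θ X Y`. -/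
  toFun (X Y : C) : End (X ⊗ Y) →ₗ[ℂ] End (X ⊗ Y)
  natural {X₁ Y₁ X₂ Y₂ : C} (x : X₁ ⊗ Y₁ ⟶ X₁ ⊗ Y₁) (a : X₁ ⟶ X₂) (b : Y₁ ⟶ Y₂)
    (a' : X₂ ⟶ X₁) (b' : Y₂ ⟶ Y₁) :
    toFun X₂ Y₂ ((a' ⊗ₘ b') ≫ x ≫ (a ⊗ₘ b)) = (a' ⊗ₘ b') ≫ toFun X₁ Y₁ x ≫ (a ⊗ₘ b)
  amplify (X₂ X₁ Y₁ Y₂ : C) (x : X₁ ⊗ Y₁ ⟶ X₁ ⊗ Y₁) :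
    toFun (X₂ ⊗ X₁) (Y₁ ⊗ Y₂) (amplification X₂ Y₂ x) = amplification X₂ Y₂ (toFun X₁ Y₁ x)

/-- A multiplier is of positive type if all its maps are completely positive. -/
def Multiplier.IsPositiveType (θ : Multiplier C) : Prop :=
  ∀ X Y : C, ∃ T : End (X ⊗ Y) →CP End (X ⊗ Y), T.toLinearMap = θ.toFun X Y

/-- The extension of a multiplier to the spaces of morphisms `Z ⊗ W ⟶ X ⊗ Y`, with the same
naturality. It exists and is unique. -/
structure Multiplier.Extension (θ : Multiplier C) where
  /-- The extended maps. -/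
  toFun (X Y Z W : C) : (Z ⊗ W ⟶ X ⊗ Y) →ₗ[ℂ] (Z ⊗ W ⟶ X ⊗ Y)
  natural {X₁ Y₁ Z₁ W₁ X₂ Y₂ Z₂ W₂ : C} (x : Z₁ ⊗ W₁ ⟶ X₁ ⊗ Y₁) (a : X₁ ⟶ X₂) (b : Y₁ ⟶ Y₂)
    (a' : Z₂ ⟶ Z₁) (b' : W₂ ⟶ W₁) :
    toFun X₂ Y₂ Z₂ W₂ ((a' ⊗ₘ b') ≫ x ≫ (a ⊗ₘ b)) =
      (a' ⊗ₘ b') ≫ toFun X₁ Y₁ Z₁ W₁ x ≫ (a ⊗ₘ b)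
  restrict (X Y : C) (x : X ⊗ Y ⟶ X ⊗ Y) : toFun X Y X Y x = θ.toFun X Y x

/-- The multiplier `θ` corresponds to the function `φ` on `Irr C`: its extension acts on the
morphisms from `𝟙 ⊗ 𝟙` to `π ⊗ πᘁ` as multiplication by `φ π`. -/
def Multiplier.HasSymbol (θ : Multiplier C) (φ : Irr C → ℂ) : Prop :=
  ∃ Θ : θ.Extension, ∀ (X : C) (hX : IsIrreducible X) (v : 𝟙_ C ⊗ 𝟙_ C ⟶ X ⊗ Xᘁ),
    Θ.toFun X (Xᘁ) (𝟙_ C) (𝟙_ C) v = φ (Irr.mk X hX) • v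

/-- A function on `Irr C` is a cp-multiplier if the multiplier corresponding to it is of positive
type. -/
def IsCPMultiplier (φ : Irr C → ℂ) : Prop :=
  ∃ θ : Multiplier C, θ.IsPositiveType ∧ θ.HasSymbol φ

variable (C) in
/-- The class of the tensor unit. -/
def Irr.unit : Irr C := Irr.mk (𝟙_ C) irreducible_unit

theorem Multiplier.toFun_id {θ : Multiplier C} {φ : Irr C → ℂ} (h : θ.HasSymbol φ) (X Y : C) :
    θ.toFun X Y (𝟙 (X ⊗ Y)) = φ (Irr.unit C) • 𝟙 (X ⊗ Y) := by
  obtain ⟨Θ, hΘ⟩ := h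
  have h1 : θ.toFun (𝟙_ C) (𝟙_ C) (𝟙 (𝟙_ C ⊗ 𝟙_ C)) = φ (Irr.unit C) • 𝟙 (𝟙_ C ⊗ 𝟙_ C) := by
    let D : C := @HasRightDual.rightDual C _ _ (𝟙_ C) (RightRigidCategory.rightDual (𝟙_ C))
    let w : 𝟙_ C ≅ D := rightDualIso (exactPairingUnit (C := C))
      (@HasRightDual.exact C _ _ (𝟙_ C) (RightRigidCategory.rightDual (𝟙_ C)))
    have h2 := hΘ (𝟙_ C) irreducible_unit (𝟙 (𝟙_ C) ⊗ₘ w.hom)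
    have h3 := Θ.natural (𝟙 (𝟙_ C ⊗ 𝟙_ C)) (𝟙 (𝟙_ C)) w.hom (𝟙 (𝟙_ C)) (𝟙 (𝟙_ C))
    simp only [id_tensorHom, MonoidalCategory.whiskerLeft_id, Category.id_comp] at h2 h3
    rw [Θ.restrict] at h3
    have h4 := h3.symm.trans h2
    have h5 := congrArg (· ≫ (𝟙_ C) ◁ w.inv) h4
    have h6 : θ.toFun (𝟙_ C) (𝟙_ C) (𝟙 (𝟙_ C ⊗ 𝟙_ C)) ≫ (𝟙_ C) ◁ w.hom ≫ (𝟙_ C) ◁ w.inv =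
        φ (Irr.unit C) • ((𝟙_ C) ◁ w.hom ≫ (𝟙_ C) ◁ w.inv) := by
      rw [← Category.assoc, ← Linear.smul_comp]
      exact h5
    rw [← MonoidalCategory.whiskerLeft_comp, w.hom_inv_id, MonoidalCategory.whiskerLeft_id] at h6
    exact (Category.comp_id _).symm.trans h6
  have h2 := θ.amplify X (𝟙_ C) (𝟙_ C) Y (𝟙 _)
  rw [h1] at h2
  have h3 := θ.natural (𝟙 ((X ⊗ 𝟙_ C) ⊗ (𝟙_ C ⊗ Y))) (ρ_ X).hom (λ_ Y).hom (ρ_ X).inv (λ_ Y).inv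
  have h4 : amplification X Y (𝟙 (𝟙_ C ⊗ 𝟙_ C)) = 𝟙 _ := by simp [amplification]
  rw [amplification_smul, h4] at h2
  rw [h2] at h3
  simpa using h3

/-- A cp-multiplier is bounded. -/
theorem IsCPMultiplier.norm_le {φ : Irr C → ℂ} (h : IsCPMultiplier φ) (π : Irr C) :
    ‖φ π‖ ≤ 2 * ‖φ (Irr.unit C)‖ := by
  obtain ⟨θ, hpos, hsym⟩ := h
  have hid := θ.toFun_id hsym
  obtain ⟨Θ, hΘ⟩ := hsym
  set X : C := π.rep
  have hX : IsIrreducible X := π.irreducible_rep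
  obtain ⟨Z, a, b, ha, hb, hab⟩ := exists_directSum X (𝟙_ C)
  obtain ⟨Z', a', b', ha', hb', hab'⟩ := exists_directSum (Xᘁ) (𝟙_ C)
  -- the unit object `I = 𝟙 ⊗ 𝟙` and an isometry `r` from it to `X ⊗ Xᘁ`
  have hI : IsIrreducible (𝟙_ C ⊗ 𝟙_ C) := irreducible_unit.congr (λ_ (𝟙_ C)).symm
  obtain ⟨r, hr⟩ : ∃ r : 𝟙_ C ⊗ 𝟙_ C ⟶ X ⊗ Xᘁ, r ≫ dag r = 𝟙 _ := by
    have hne : (λ_ (𝟙_ C)).hom ≫ η_ X (Xᘁ) ≠ 0 := fun h0 =>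
      coevaluation_ne_zero hX (HasRightDual.exact (X := X))
        ((cancel_epi (λ_ (𝟙_ C)).hom).1 (by rw [h0, Limits.comp_zero]))
    obtain ⟨c, hc, hcc⟩ := exists_scalar_pos hI hne
    refine ⟨((Real.sqrt c)⁻¹ : ℂ) • ((λ_ (𝟙_ C)).hom ≫ η_ X (Xᘁ)), ?_⟩
    rw [dag_smul, Linear.comp_smul, Linear.smul_comp, hcc, smul_smul, smul_smul]
    have h1 : star ((Real.sqrt c : ℂ)⁻¹) * (Real.sqrt c : ℂ)⁻¹ * c = 1 := by
      have h2 : (Real.sqrt c)⁻¹ * (Real.sqrt c)⁻¹ * c = 1 := by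
        rw [← mul_inv, Real.mul_self_sqrt hc.le, inv_mul_cancel₀ hc.ne']
      have h3 := congrArg (fun t : ℝ => (t : ℂ)) h2
      simpa using h3
    rw [h1, one_smul]
  set e₁ : 𝟙_ C ⊗ 𝟙_ C ⟶ Z ⊗ Z' := b ⊗ₘ b' with he₁
  set m : X ⊗ Xᘁ ⟶ Z ⊗ Z' := a ⊗ₘ a' with hm
  set e₂ : 𝟙_ C ⊗ 𝟙_ C ⟶ Z ⊗ Z' := r ≫ m with he₂
  have h11 : e₁ ≫ dag e₁ = 𝟙 _ := by
    rw [he₁, dag_tensor, tensorHom_comp_tensorHom, hb, hb', id_tensorHom_id]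
  have hmm : m ≫ dag m = 𝟙 _ := by
    rw [hm, dag_tensor, tensorHom_comp_tensorHom, ha, ha', id_tensorHom_id]
  have h1m : e₁ ≫ dag m = 0 := by
    rw [he₁, hm, dag_tensor, tensorHom_comp_tensorHom, directSum_orthogonal hb ha
      (by rw [add_comm]; exact hab)]
    simp
  have h12 : e₁ ≫ dag e₂ = 0 := by
    rw [he₂, dag_comp, reassoc_of% h1m]; simp
  have h21 : e₂ ≫ dag e₁ = 0 := by
    rw [← dag_dag (e₂ ≫ dag e₁), dag_comp, dag_dag, h12, dag_zero]
  have h22 : e₂ ≫ dag e₂ = 𝟙 _ := by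
    rw [he₂, dag_comp, Category.assoc, reassoc_of% hmm, hr]
  -- the values of the multiplier
  set t : End (Z ⊗ Z') →ₗ[ℂ] End (Z ⊗ Z') := θ.toFun Z Z'
  have t11 : t (dag e₁ ≫ e₁) = φ (Irr.unit C) • (dag e₁ ≫ e₁) := by
    have := θ.natural (𝟙 (𝟙_ C ⊗ 𝟙_ C)) b b' (dag b) (dag b')
    rw [hid, ← dag_tensor] at this
    simpa using this
  have tm : t (dag m ≫ m) = φ (Irr.unit C) • (dag m ≫ m) := by
    have := θ.natural (𝟙 (X ⊗ Xᘁ)) a a' (dag a) (dag a')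
    rw [hid, ← dag_tensor] at this
    simpa using this
  have t21 : t (dag e₁ ≫ e₂) = φ π • (dag e₁ ≫ e₂) := by
    have h1 := Θ.natural r a a' (dag b) (dag b')
    rw [hΘ X hX, Θ.restrict, ← dag_tensor, π.mk_rep] at h1
    simpa using h1
  -- positivity
  have key : ∀ {W : C} (k : W ⟶ Z ⊗ Z') (κ : 𝟙_ C ⊗ 𝟙_ C ⟶ Z ⊗ Z'),
      ∃ c : ℝ, 0 ≤ c ∧ κ ≫ t (dag k ≫ k) ≫ dag κ = (c : ℂ) • 𝟙 _ := by
    intro W k κ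
    obtain ⟨T, hT⟩ := hpos Z Z'
    obtain ⟨g, hg⟩ := exists_comp_dag_eq (dag k)
    rw [dag_dag] at hg
    have h0 : (0 : End (Z ⊗ Z')) ≤ dag k ≫ k := by
      rw [hg]; exact star_mul_self_nonneg (R := End (Z ⊗ Z')) g
    have h1 : 0 ≤ T (dag k ≫ k) := map_nonneg T h0
    obtain ⟨N, hN⟩ := CStarAlgebra.nonneg_iff_eq_star_mul_self.1 h1
    have h2 : t (dag k ≫ k) = N ≫ dag (C := C) N := (LinearMap.congr_fun hT _).symm.trans hN
    obtain ⟨c, hc, h3⟩ := exists_scalar hI (κ ≫ (show Z ⊗ Z' ⟶ Z ⊗ Z' from N))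
    refine ⟨c, hc, ?_⟩
    rw [h2, ← h3, dag_comp]
    simp
  set κ := e₁ + e₂ with hκ
  have c1 : κ ≫ dag e₁ = 𝟙 _ := by rw [hκ, Preadditive.add_comp, h11, h21, add_zero]
  have c2 : κ ≫ dag e₂ = 𝟙 _ := by rw [hκ, Preadditive.add_comp, h12, h22, zero_add]
  have cm : κ ≫ dag m = r := by
    rw [hκ, Preadditive.add_comp, h1m, zero_add, he₂, Category.assoc, hmm, Category.comp_id]
  have c1' : e₁ ≫ dag κ = 𝟙 _ := by
    rw [← dag_dag e₁, ← dag_comp, c1, dag_id]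
  have c2' : e₂ ≫ dag κ = 𝟙 _ := by
    rw [← dag_dag e₂, ← dag_comp, c2, dag_id]
  have cm' : m ≫ dag κ = dag r := by
    rw [← dag_dag m, ← dag_comp, cm]
  have cancel : ∀ {x y : ℂ}, x • 𝟙 (𝟙_ C ⊗ 𝟙_ C) = y • 𝟙 (𝟙_ C ⊗ 𝟙_ C) → x = y := by
    intro x y hxy
    have : (x - y) • 𝟙 (𝟙_ C ⊗ 𝟙_ C) = 0 := by rw [sub_smul, hxy, sub_self]
    exact sub_eq_zero.1 ((smul_eq_zero.1 this).resolve_right hI.1)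
  have k11 : κ ≫ t (dag e₁ ≫ e₁) ≫ dag κ = φ (Irr.unit C) • 𝟙 _ := by
    rw [t11, Linear.smul_comp, Linear.comp_smul, Category.assoc, c1', Category.comp_id, c1]
  have k21 : κ ≫ t (dag e₁ ≫ e₂) ≫ dag κ = φ π • 𝟙 _ := by
    rw [t21, Linear.smul_comp, Linear.comp_smul, Category.assoc, c2', Category.comp_id, c1]
  have kmm : κ ≫ t (dag m ≫ m) ≫ dag κ = φ (Irr.unit C) • 𝟙 _ := by
    rw [tm, Linear.smul_comp, Linear.comp_smul, Category.assoc, cm', reassoc_of% cm, hr]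
  obtain ⟨ψ, k12⟩ := hI.2 (κ ≫ t (dag e₂ ≫ e₁) ≫ dag κ)
  obtain ⟨τ, -, k22⟩ := key e₂ κ
  obtain ⟨σ, hσ, kσ⟩ := key ((𝟙 _ - dag r ≫ r) ≫ m) κ
  have hτ : φ (Irr.unit C) = (τ + σ : ℝ) := by
    have h1 : dag ((𝟙 _ - dag r ≫ r) ≫ m) ≫ (𝟙 _ - dag r ≫ r) ≫ m =
        dag m ≫ m - dag e₂ ≫ e₂ := by
      have h2 : dag (𝟙 _ - dag r ≫ r) = 𝟙 _ - dag r ≫ r := by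
        rw [sub_eq_add_neg, dag_add, dag_id, ← neg_one_smul ℂ, dag_smul, dag_comp, dag_dag]
        simp
      have h3 : (𝟙 _ - dag r ≫ r) ≫ (𝟙 _ - dag r ≫ r) = 𝟙 _ - dag r ≫ r := by
        simp [Preadditive.sub_comp, Preadditive.comp_sub, reassoc_of% hr]
      rw [dag_comp, h2, Category.assoc, reassoc_of% h3, he₂, dag_comp]
      simp [Preadditive.sub_comp, Preadditive.comp_sub]
    have h4 : t (dag m ≫ m - dag e₂ ≫ e₂) = t (dag m ≫ m) - t (dag e₂ ≫ e₂) := map_sub t _ _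
    rw [h1, h4, Preadditive.sub_comp, Preadditive.comp_sub, kmm, k22, ← sub_smul] at kσ
    have := cancel kσ
    push_cast
    linear_combination this
  have hz : ∀ z : ℂ, ∃ c : ℝ, 0 ≤ c ∧
      φ (Irr.unit C) + z * φ π + star z * ψ + star z * z * τ = c := by
    intro z
    obtain ⟨c, hc, h1⟩ := key (e₁ + z • e₂) κ
    refine ⟨c, hc, cancel ?_⟩
    have h2 : dag (e₁ + z • e₂) ≫ (e₁ + z • e₂) = dag e₁ ≫ e₁ + z • (dag e₁ ≫ e₂) +
        star z • (dag e₂ ≫ e₁) + (star z * z) • (dag e₂ ≫ e₂) := by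
      simp only [dag_add, dag_smul, Preadditive.add_comp, Preadditive.comp_add, Linear.smul_comp,
        Linear.comp_smul, smul_smul, smul_add]
      rw [mul_comm]
      abel
    have h3 : t (dag (e₁ + z • e₂) ≫ (e₁ + z • e₂)) = t (dag e₁ ≫ e₁) + z • t (dag e₁ ≫ e₂) +
        star z • t (dag e₂ ≫ e₁) + (star z * z) • t (dag e₂ ≫ e₂) := by
      rw [h2]
      refine (map_add t _ _).trans (congrArg₂ _ ((map_add t _ _).trans (congrArg₂ _
        ((map_add t _ _).trans (congrArg₂ _ rfl (map_smul t _ _))) (map_smul t _ _)))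
        (map_smul t _ _))
    have h4 : ∀ (f₁ f₂ f₃ f₄ : Z ⊗ Z' ⟶ Z ⊗ Z') (u v w : ℂ),
        κ ≫ (f₁ + u • f₂ + v • f₃ + w • f₄) ≫ dag κ = κ ≫ f₁ ≫ dag κ + u • (κ ≫ f₂ ≫ dag κ) +
          v • (κ ≫ f₃ ≫ dag κ) + w • (κ ≫ f₄ ≫ dag κ) := by
      intros; simp
    rw [← h1]
    refine Eq.trans ?_ ((h4 _ _ _ _ _ _ _).symm.trans
      (congrArg (fun f => κ ≫ f ≫ dag κ) h3.symm))
    simp only [k11, k21, k12, k22, smul_smul, add_smul]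
  obtain ⟨x1, p1, q1⟩ := hz 1
  obtain ⟨x2, p2, q2⟩ := hz (-1)
  obtain ⟨x3, p3, q3⟩ := hz Complex.I
  obtain ⟨x4, p4, q4⟩ := hz (-Complex.I)
  have ht : τ ≤ τ + σ := by linarith
  rw [hτ] at q1 q2 q3 q4 ⊢
  have hu : 0 ≤ τ + σ := by
    obtain ⟨c, hc, hcc⟩ := key e₁ κ
    rw [k11, hτ] at hcc
    have := cancel hcc
    have : τ + σ = c := by exact_mod_cast this
    linarith
  have r1 := congrArg Complex.re q1
  have r2 := congrArg Complex.re q2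
  have r3 := congrArg Complex.re q3
  have r4 := congrArg Complex.re q4
  have i1 := congrArg Complex.im q1
  have i3 := congrArg Complex.im q3
  simp at r1 r2 r3 r4 i1 i3
  have hre : |(φ π).re| ≤ τ + σ := abs_le.2 ⟨by linarith, by linarith⟩
  have him : |(φ π).im| ≤ τ + σ := abs_le.2 ⟨by linarith, by linarith⟩
  rw [Complex.norm_real, Real.norm_eq_abs, abs_of_nonneg hu]
  have := Complex.norm_le_abs_re_add_abs_im (φ π)
  linarith

/-- A *-representation `Θ` of the fusion algebra is admissible if for all vectors `ξ` the function
`π ↦ d(π)⁻¹ ⟨Θ(π) ξ, ξ⟩` is a cp-multiplier. -/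
def IsAdmissible {K : Type*} [NormedAddCommGroup K] [InnerProductSpace ℂ K] [CompleteSpace K]
    (Θ : FusionAlgebra C →⋆ₐ[ℂ] (K →L[ℂ] K)) : Prop :=
  ∀ ξ : K, IsCPMultiplier fun π : Irr C =>
    (dim π.rep : ℂ)⁻¹ * inner ℂ ξ (Θ (FusionAlgebra.basis π) ξ)

theorem IsAdmissible.norm_le {K : Type*} [NormedAddCommGroup K] [InnerProductSpace ℂ K]
    [CompleteSpace K] {Θ : FusionAlgebra C →⋆ₐ[ℂ] (K →L[ℂ] K)} (h : IsAdmissible Θ) (π : Irr C) :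
    ‖Θ (FusionAlgebra.basis π)‖ ≤
      4 * (|dim π.rep| * |dim (Irr.unit C).rep|⁻¹) := by
  set T := Θ (FusionAlgebra.basis π)
  set B : ℝ := |dim π.rep| * |dim (Irr.unit C).rep|⁻¹ with hB
  have hB0 : 0 ≤ B := by positivity
  have h1 : ∀ ξ : K, ‖inner ℂ (T ξ) ξ‖ ≤ 2 * B * ‖ξ‖ ^ 2 := by
    intro ξ
    have h2 := (h ξ).norm_le π
    have h3 : Θ (FusionAlgebra.basis (Irr.unit C)) = 1 := map_one Θ
    have hd : 0 < |dim π.rep| := abs_pos.2 (dim_ne_zero π.irreducible_rep)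
    rw [h3] at h2
    simp only [norm_mul, norm_inv, Complex.norm_real, Real.norm_eq_abs,
      one_apply_eq_self, inner_self_eq_norm_sq_to_K] at h2
    rw [norm_inner_symm]
    have h4 : ‖(((‖ξ‖ : ℝ) : ℂ)) ^ 2‖ = ‖ξ‖ ^ 2 := by simp
    have h5 : ‖inner ℂ ξ (T ξ)‖ = |dim π.rep| * (|dim π.rep|⁻¹ * ‖inner ℂ ξ (T ξ)‖) := by
      field_simp
    rw [h5]
    refine (mul_le_mul_of_nonneg_left h2 hd.le).trans_eq ?_
    rw [show ‖((RCLike.ofReal ‖ξ‖ : ℂ)) ^ 2‖ = ‖ξ‖ ^ 2 from h4, hB]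
    ring
  refine ContinuousLinearMap.opNorm_le_of_re_inner_le (by positivity) fun x y hx hy => ?_
  refine (RCLike.re_le_norm _).trans ?_
  have hpol := inner_map_polarization' (T : K →ₗ[ℂ] K) x y
  simp only [ContinuousLinearMap.coe_coe] at hpol
  rw [hpol, norm_div]
  have e1 := parallelogram_law_with_norm ℂ x y
  have e2 := parallelogram_law_with_norm ℂ x (Complex.I • y)
  have hI : ‖Complex.I • y‖ = 1 := by rw [norm_smul, Complex.norm_I, hy, one_mul]
  rw [hx, hy] at e1
  rw [hx, hI] at e2
  have n1 := h1 (x + y)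
  have n2 := h1 (x - y)
  have n3 := h1 (x + Complex.I • y)
  have n4 := h1 (x - Complex.I • y)
  have tri : ∀ p q u w : ℂ, ‖p - q - Complex.I * u + Complex.I * w‖ ≤ ‖p‖ + ‖q‖ + ‖u‖ + ‖w‖ := by
    intro p q u w
    refine (norm_add_le _ _).trans ?_
    rw [norm_mul, Complex.norm_I, one_mul]
    gcongr
    refine (norm_sub_le _ _).trans ?_
    rw [norm_mul, Complex.norm_I, one_mul]
    gcongr
    exact norm_sub_le _ _
  have h4 : ‖(4 : ℂ)‖ = 4 := by simp
  rw [h4, div_le_iff₀ (by norm_num)]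
  refine (tri _ _ _ _).trans ?_
  nlinarith

end Fusion
end RigidCStarTensorCategory

section BoundedFamilies
open scoped ENNReal

/-- The C*-algebra of bounded families `(a i)` with `a i` in the C*-algebra `A i`, with the
componentwise operations and the supremum norm. -/
def BoundedFamilies {I : Type*} (A : I → Type*) [∀ i, CStarAlgebra (A i)] : Type _ := lp A ∞

variable {I : Type*} (A : I → Type*) [∀ i, CStarAlgebra (A i)] [∀ i, Nontrivial (A i)]

noncomputable instance BoundedFamilies.instCStarAlgebra : CStarAlgebra (BoundedFamilies A) :=
  { (inferInstance : NormedRing (lp A ∞)), (inferInstance : StarRing (lp A ∞)),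
    (inferInstance : CompleteSpace (lp A ∞)), (inferInstance : CStarRing (lp A ∞)),
    (inferInstance : NormedAlgebra ℂ (lp A ∞)), (inferInstance : StarModule ℂ (lp A ∞)) with }

variable {A}

/-- A family of *-homomorphisms that is bounded at every element, as one *-homomorphism. -/
noncomputable def BoundedFamilies.lift {R : Type*} [Ring R] [StarRing R] [Algebra ℂ R]
    (Θ : ∀ i, R →⋆ₐ[ℂ] A i) (h : ∀ x, Memℓp (fun i => Θ i x) ∞) : R →⋆ₐ[ℂ] BoundedFamilies A where
  toFun x := (⟨fun i => Θ i x, h x⟩ : lp A ∞)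
  map_one' := by refine Subtype.ext (funext fun i => ?_); exact map_one (Θ i)
  map_mul' x y := by refine Subtype.ext (funext fun i => ?_); exact map_mul (Θ i) x y
  map_zero' := by refine Subtype.ext (funext fun i => ?_); exact map_zero (Θ i)
  map_add' x y := by refine Subtype.ext (funext fun i => ?_); exact map_add (Θ i) x y
  commutes' c := by refine Subtype.ext (funext fun i => ?_); exact AlgHomClass.commutes (Θ i) c
  map_star' x := by refine Subtype.ext (funext fun i => ?_); exact map_star (Θ i) x

end BoundedFamilies

section ClosedRange

variable {R A : Type*} [Ring R] [StarRing R] [Algebra ℂ R] [CStarAlgebra A] (Θ : R →⋆ₐ[ℂ] A)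

/-- The closure of the range of a *-homomorphism into a C*-algebra. -/
def ClosedRange : Type _ := Θ.range.topologicalClosure

noncomputable instance ClosedRange.instCStarAlgebra : CStarAlgebra (ClosedRange Θ) :=
  haveI : IsClosed (Θ.range.topologicalClosure : Set A) :=
    StarSubalgebra.isClosed_topologicalClosure _
  inferInstanceAs (CStarAlgebra Θ.range.topologicalClosure)

/-- The *-homomorphism `Θ` with its range restricted to the closure. -/
noncomputable def ClosedRange.restrict : R →⋆ₐ[ℂ] ClosedRange Θ :=
  (StarSubalgebra.inclusion (StarSubalgebra.le_topologicalClosure Θ.range)).comp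
    Θ.rangeRestrict

end ClosedRange

section States

open scoped ComplexOrder

variable {A : Type*} [CStarAlgebra A]

/-- A state on a C*-algebra: a positive bounded functional with value `1` at the unit. -/
def IsState (ω : A →L[ℂ] ℂ) : Prop := (∀ x, 0 ≤ ω (star x * x)) ∧ ω 1 = 1

/-- A character of a C*-algebra as a bounded functional. -/
noncomputable def characterFunctional (e : A →⋆ₐ[ℂ] ℂ) : A →L[ℂ] ℂ :=
  ⟨e.toAlgHom.toLinearMap, map_continuous e⟩

end States

namespace RigidCStarTensorCategory
section Fusion
variable {C : Type u} [Category.{v} C] [Preadditive C] [Linear ℂ C]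
  [MonoidalCategory C] [MonoidalPreadditive C] [MonoidalLinear ℂ C] [RightRigidCategory C]
  [CStarTensorCategory C] [RigidCStarTensorCategory C]

variable (C) in
/-- The admissible *-representations of the fusion algebra on (nonzero) Hilbert spaces. The
universe of the Hilbert spaces contains all cyclic representations. -/
structure AdmissibleRep where
  /-- The Hilbert space. -/
  K : Type u
  [normedAddCommGroup : NormedAddCommGroup K]
  [innerProductSpace : InnerProductSpace ℂ K]
  [completeSpace : CompleteSpace K]
  [nontrivial : Nontrivial K]
  /-- The representation. -/
  Θ : FusionAlgebra C →⋆ₐ[ℂ] (K →L[ℂ] K)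
  admissible : IsAdmissible Θ

attribute [instance] AdmissibleRep.normedAddCommGroup AdmissibleRep.innerProductSpace
  AdmissibleRep.completeSpace AdmissibleRep.nontrivial

open scoped ENNReal

theorem memℓp_admissible (x : FusionAlgebra C) :
    Memℓp (fun Θ : AdmissibleRep C => Θ.Θ x) ∞ := by
  induction x using FusionAlgebra.induction_on with
  | h0 =>
    have : (fun Θ : AdmissibleRep C => Θ.Θ 0) = 0 := by funext Θ; exact map_zero Θ.Θ
    rw [this]
    exact zero_memℓp
  | hadd x y hx hy =>
    have : (fun Θ : AdmissibleRep C => Θ.Θ (x + y)) =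
        (fun Θ : AdmissibleRep C => Θ.Θ x) + (fun Θ : AdmissibleRep C => Θ.Θ y) := by
      funext Θ; exact map_add Θ.Θ x y
    rw [this]
    exact hx.add hy
  | hb c π =>
    refine memℓp_infty ⟨‖c‖ * (4 * (|dim π.rep| * |dim (Irr.unit C).rep|⁻¹)), ?_⟩
    rintro _ ⟨Θ, rfl⟩
    change ‖Θ.Θ (c • FusionAlgebra.basis π)‖ ≤ _
    rw [map_smul, norm_smul]
    exact mul_le_mul_of_nonneg_left (Θ.admissible.norm_le π) (norm_nonneg c)

variable (C) in
/-- The direct sum of all admissible representations. -/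
noncomputable def universalRep :
    FusionAlgebra C →⋆ₐ[ℂ] BoundedFamilies fun Θ : AdmissibleRep C => Θ.K →L[ℂ] Θ.K :=
  BoundedFamilies.lift (fun Θ : AdmissibleRep C => Θ.Θ) memℓp_admissible

variable (C) in
/-- The universal C*-algebra `C_u(C)`: the completion of the fusion algebra in the direct sum of
all admissible representations. -/
abbrev UniversalCStarAlgebra : Type (u + 1) := ClosedRange (universalRep C)

variable (C) in
/-- The canonical map from the fusion algebra to `C_u(C)`. -/
noncomputable def toUniversal : FusionAlgebra C →⋆ₐ[ℂ] UniversalCStarAlgebra C :=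
  ClosedRange.restrict (universalRep C)

/-- The element of `C_u(C)` defined by an object `X` of `C`. -/
noncomputable def objElement (X : C) : UniversalCStarAlgebra C := toUniversal C (FusionAlgebra.of X)

variable (C) in
/-- Property (T): every net of cp-multipliers that converges to `1` pointwise converges to `1`
uniformly. -/
def HasPropertyT : Prop :=
  ∀ (ι : Type u) [Preorder ι] [IsDirectedOrder ι] [Nonempty ι] (φ : ι → Irr C → ℂ),
    (∀ n, IsCPMultiplier (φ n)) →
    (∀ π, Filter.Tendsto (fun n => φ n π) Filter.atTop (nhds 1)) →
    TendstoUniformly φ (fun _ => 1) Filter.atTop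

/-- A nonzero projection `p` with `X p = d(X) p` for all objects `X`. -/
def IsTrivialProjection (p : UniversalCStarAlgebra C) : Prop :=
  p ≠ 0 ∧ IsStarProjection p ∧ ∀ X : C, objElement X * p = (dim X : ℂ) • p

/-- `e` is the trivial representation: `e X = d(X)`. -/
def IsTrivialRep (e : UniversalCStarAlgebra C →⋆ₐ[ℂ] ℂ) : Prop := ∀ X : C, e (objElement X) = dim X

end Fusion

end RigidCStarTensorCategory

open RigidCStarTensorCategory

/-!
A cp-multiplier `φ` is, up to normalization, the same thing as a vector state of an admissible
representation: the GNS construction applied to `π ↦ d(π) φ(π)` gives an admissible representation,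
because the diagonal coefficients of its vectors are limits of compressions of the multiplier.

By property (T), a cp-multiplier that is close to `1` on a finite set `F ⊆ Irr C` is uniformly close
to `1`, so its representation has a nonzero invariant vector, namely the point of smallest norm in
the closed convex hull of an orbit. Hence a weighted average `m` of `1` and of the `π / d(π)` and
their adjoints, `π ∈ F`, has norm at most `r < 1` on the complement of the invariant vectors, with
`r` independent of the representation, and `m ^ n` converges in `C_u(C)` to a projection `p` with
`α p = d(α) p`.

Conversely, if `p` is such a projection, then `ω x - ε x` is controlled by `ω p - 1` through the
Cauchy–Schwarz inequality for the state `ω`, uniformly in `‖x‖ ≤ 1`. Finally, norm convergence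
`ω n → ε` is uniform on the elements `π / d(π)` of the unit ball, where the states attached to
cp-multipliers take the values of these multipliers.
-/

/-! ### Positive functionals, states and orthogonal projections -/

section PositiveFunctional

open scoped ComplexOrder

/-- A positive linear functional on a unital *-algebra over `ℂ`. No norm or order on the algebra is
involved: positivity is tested on the elements `x* x`. -/
structure PositiveFunctional (R : Type*) [Ring R] [StarRing R] [Algebra ℂ R]
    extends R →ₗ[ℂ] ℂ where
  nonneg (x : R) : 0 ≤ toFun (star x * x)

namespace PositiveFunctional

variable {R : Type*} [Ring R] [StarRing R] [Algebra ℂ R]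

instance : FunLike (PositiveFunctional R) R ℂ where
  coe ω := ω.toFun
  coe_injective ω ω' h := by
    cases ω
    cases ω'
    congr
    exact DFunLike.coe_injective h

instance : LinearMapClass (PositiveFunctional R) ℂ R ℂ where
  map_add ω := map_add ω.toLinearMap
  map_smulₛₗ ω := map_smul ω.toLinearMap

variable (ω : PositiveFunctional R)

theorem re_apply_star_mul_self_nonneg (x : R) : 0 ≤ (ω (star x * x)).re :=
  (Complex.nonneg_iff.1 (ω.nonneg x)).1

variable [StarModule ℂ R]

theorem apply_star (z : R) : ω (star z) = star (ω z) := by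
  have im_eq_zero (x : R) : 0 = (ω (star x * x)).im := (Complex.nonneg_iff.1 (ω.nonneg x)).2
  have him_one := im_eq_zero 1
  have him_z := im_eq_zero z
  have him_add := im_eq_zero (1 + z)
  have him_add_I := im_eq_zero (1 + Complex.I • z)
  simp only [star_add, star_one, star_smul, add_mul, mul_add, one_mul, mul_one, map_add,
    smul_mul_assoc, mul_smul_comm, map_smul, Complex.add_im, smul_eq_mul, Complex.mul_im,
    Complex.mul_re, Complex.star_def, Complex.conj_I, Complex.neg_re, Complex.neg_im,
    Complex.I_re, Complex.I_im] at him_one him_z him_add him_add_I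
  refine Complex.ext ?_ ?_
  · rw [Complex.star_def, Complex.conj_re]; linarith
  · rw [Complex.star_def, Complex.conj_im]; linarith

/-- The type synonym of `R` that carries the sesquilinear form `⟪x, y⟫ = ω (x* y)` of a positive
functional `ω`. -/
@[nolint unusedArguments]
def PreGNS (_ : PositiveFunctional R) : Type _ := R

instance : AddCommGroup ω.PreGNS := inferInstanceAs (AddCommGroup R)

instance : Module ℂ ω.PreGNS := inferInstanceAs (Module ℂ R)

/-- The identification of `R` with the underlying space of the sesquilinear form. -/
def toPreGNS : R ≃ₗ[ℂ] ω.PreGNS := LinearEquiv.refl ℂ _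

/-- The sesquilinear form `⟪x, y⟫ = ω (x* y)`. -/
@[reducible]
def preGNSCore : PreInnerProductSpace.Core ℂ ω.PreGNS where
  inner x y := ω (star (ω.toPreGNS.symm x) * ω.toPreGNS.symm y)
  conj_inner_symm x y := by rw [← Complex.star_def, ← ω.apply_star, star_mul, star_star]
  re_inner_nonneg x := ω.re_apply_star_mul_self_nonneg _
  add_left x y z := by rw [map_add, star_add, add_mul, map_add]
  smul_left x y c := by
    rw [map_smul, star_smul, smul_mul_assoc, map_smul, smul_eq_mul, Complex.star_def]

noncomputable instance : SeminormedAddCommGroup ω.PreGNS :=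
  InnerProductSpace.Core.toSeminormedAddCommGroup (c := ω.preGNSCore)

noncomputable instance : InnerProductSpace ℂ ω.PreGNS := InnerProductSpace.ofCore ω.preGNSCore

theorem inner_toPreGNS (x y : R) :
    inner ℂ (ω.toPreGNS x) (ω.toPreGNS y) = ω (star x * y) := rfl

theorem norm_toPreGNS_sq (x : R) : ‖ω.toPreGNS x‖ ^ 2 = (ω (star x * x)).re := by
  rw [← inner_toPreGNS, ← inner_self_eq_norm_sq (𝕜 := ℂ)]
  rfl

theorem norm_sq_apply_star_mul_le (x y : R) :
    ‖ω (star x * y)‖ ^ 2 ≤ (ω (star x * x)).re * (ω (star y * y)).re := by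
  rw [← norm_toPreGNS_sq, ← norm_toPreGNS_sq, ← mul_pow, ← inner_toPreGNS]
  gcongr
  exact norm_inner_le_norm _ _

/-- Left multiplications are bounded for the seminorm `x ↦ ω (x* x) ^ (1 / 2)`. This is automatic
on C*-algebras, but not on general *-algebras. -/
def IsLeftBounded : Prop :=
  ∀ a, ∃ M : ℝ, ∀ x, (ω (star (a * x) * (a * x))).re ≤ M * (ω (star x * x)).re

/-- The Hilbert space of the GNS construction. -/
abbrev GNS : Type _ := UniformSpace.Completion ω.PreGNS

/-- The canonical map from the algebra to the Hilbert space of the GNS construction. -/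
noncomputable def toGNS (x : R) : ω.GNS := (ω.toPreGNS x : ω.GNS)

theorem denseRange_toGNS : DenseRange ω.toGNS :=
  UniformSpace.Completion.denseRange_coe (α := ω.PreGNS)

theorem inner_toGNS (x y : R) : inner ℂ (ω.toGNS x) (ω.toGNS y) = ω (star x * y) :=
  UniformSpace.Completion.inner_coe _ _

theorem toGNS_add (x y : R) : ω.toGNS (x + y) = ω.toGNS x + ω.toGNS y :=
  UniformSpace.Completion.coe_add _ _

theorem toGNS_smul (c : ℂ) (x : R) : ω.toGNS (c • x) = c • ω.toGNS x :=
  UniformSpace.Completion.coe_smul c (ω.toPreGNS x)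

theorem toGNS_zero : ω.toGNS 0 = 0 := UniformSpace.Completion.coe_zero

variable {ω}

theorem ext_toGNS {S T : ω.GNS →L[ℂ] ω.GNS} (h : ∀ x, S (ω.toGNS x) = T (ω.toGNS x)) : S = T :=
  ContinuousLinearMap.coeFn_injective <|
    ω.denseRange_toGNS.equalizer S.continuous T.continuous (funext h)

theorem IsLeftBounded.exists_clm (hω : ω.IsLeftBounded) (a : R) :
    ∃ T : ω.GNS →L[ℂ] ω.GNS, ∀ x, T (ω.toGNS x) = ω.toGNS (a * x) := by
  obtain ⟨M, hM⟩ := hω a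
  have hbound (x : R) : ‖ω.toPreGNS (a * x)‖ ≤ √(max M 0) * ‖ω.toPreGNS x‖ := by
    rw [← sq_le_sq₀ (norm_nonneg _) (by positivity), mul_pow, Real.sq_sqrt (le_max_right _ _),
      norm_toPreGNS_sq, norm_toPreGNS_sq]
    exact (hM x).trans
      (mul_le_mul_of_nonneg_right (le_max_left _ _) (ω.re_apply_star_mul_self_nonneg x))
  let T : ω.PreGNS →L[ℂ] ω.PreGNS :=
    (ω.toPreGNS.toLinearMap ∘ₗ LinearMap.mulLeft ℂ a ∘ₗ ω.toPreGNS.symm.toLinearMap).mkContinuous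
      _ hbound
  exact ⟨T.completion, fun x => T.completion_apply_coe (ω.toPreGNS x)⟩

/-- The GNS representation, given on the image of `R` by left multiplication. -/
noncomputable def gnsRep (hω : ω.IsLeftBounded) : R →⋆ₐ[ℂ] (ω.GNS →L[ℂ] ω.GNS) :=
  let T (a : R) : ω.GNS →L[ℂ] ω.GNS := (hω.exists_clm a).choose
  have hT (a x : R) : T a (ω.toGNS x) = ω.toGNS (a * x) := (hω.exists_clm a).choose_spec x
  { toFun := T
    map_one' := ext_toGNS fun x => by rw [hT, one_mul, one_apply_eq_self]
    map_mul' a b := ext_toGNS fun x => by rw [mul_apply_eq_comp, hT, hT, hT, mul_assoc]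
    map_zero' := ext_toGNS fun x => by rw [hT, zero_mul, toGNS_zero, zero_apply]
    map_add' a b := ext_toGNS fun x => by rw [add_apply, hT, hT, hT, add_mul, toGNS_add]
    commutes' c := ext_toGNS fun x => by
      rw [hT, ← Algebra.smul_def, toGNS_smul]
      rfl
    map_star' a := by
      refine (ContinuousLinearMap.eq_adjoint_iff _ _).mpr fun ξ ζ => ?_
      induction ξ using ω.denseRange_toGNS.induction_on with
      | hp => exact isClosed_eq (by fun_prop) (by fun_prop)
      | ih x =>
      induction ζ using ω.denseRange_toGNS.induction_on with
      | hp => exact isClosed_eq (by fun_prop) (by fun_prop)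
      | ih y => rw [hT, hT, inner_toGNS, inner_toGNS, star_mul, star_star, mul_assoc] }

theorem gnsRep_toGNS (hω : ω.IsLeftBounded) (a x : R) :
    gnsRep hω a (ω.toGNS x) = ω.toGNS (a * x) :=
  (hω.exists_clm a).choose_spec x

end PositiveFunctional

end PositiveFunctional

section States

open scoped ComplexOrder

variable {A : Type*} [CStarAlgebra A]

namespace IsState

variable {ω : A →L[ℂ] ℂ}

theorem norm_sq_apply_mul_le (hω : IsState ω) (x y : A) :
    ‖ω (x * y)‖ ^ 2 ≤ (ω (x * star x)).re * (ω (star y * y)).re := by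
  let ψ : PositiveFunctional A := ⟨ω.toLinearMap, hω.1⟩
  have h := ψ.norm_sq_apply_star_mul_le (star x) y
  rwa [star_star] at h

theorem norm_le_one (hω : IsState ω) : ‖ω‖ ≤ 1 := by
  have norm_le_sqrt : ‖ω‖ ≤ √‖ω‖ := by
    refine ω.opNorm_le_bound (Real.sqrt_nonneg _) fun x => le_of_sq_le_sq ?_ (by positivity)
    have cauchy_schwarz := hω.norm_sq_apply_mul_le x 1
    rw [mul_one, star_one, mul_one, hω.2, Complex.one_re, mul_one] at cauchy_schwarz
    rw [mul_pow, Real.sq_sqrt (norm_nonneg _)]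
    calc ‖ω x‖ ^ 2 ≤ (ω (x * star x)).re := cauchy_schwarz
      _ ≤ ‖ω (x * star x)‖ := Complex.re_le_norm _
      _ ≤ ‖ω‖ * ‖x * star x‖ := ω.le_opNorm _
      _ = ‖ω‖ * ‖x‖ ^ 2 := by rw [CStarRing.norm_self_mul_star, sq]
  have norm_sq_le : ‖ω‖ ^ 2 ≤ ‖ω‖ := (Real.le_sqrt (norm_nonneg _) (norm_nonneg _)).1 norm_le_sqrt
  by_contra! hlt
  nlinarith

theorem norm_apply_le (hω : IsState ω) (x : A) : ‖ω x‖ ≤ ‖x‖ := by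
  simpa using ω.le_of_opNorm_le hω.norm_le_one x

end IsState

theorem isState_characterFunctional (e : A →⋆ₐ[ℂ] ℂ) : IsState (characterFunctional e) := by
  refine ⟨fun x => ?_, map_one e⟩
  change 0 ≤ e (star x * x)
  rw [map_mul, map_star]
  exact star_mul_self_nonneg _

namespace IsState

variable {ω : A →L[ℂ] ℂ}

theorem norm_apply_mul_one_sub_le (hω : IsState ω) {p : A} (hp : IsStarProjection p) (x : A) :
    ‖ω (x * (1 - p))‖ ≤ √‖ω p - 1‖ * ‖x‖ := by
  have hq : star (1 - p) * (1 - p) = 1 - p := by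
    rw [hp.one_sub.isSelfAdjoint.star_eq, hp.one_sub.isIdempotentElem.eq]
  have apply_mul_star_le : (ω (x * star x)).re ≤ ‖x‖ ^ 2 := by
    refine (Complex.re_le_norm _).trans ((hω.norm_apply_le _).trans_eq ?_)
    rw [CStarRing.norm_self_mul_star, sq]
  have apply_one_sub_le : (ω (1 - p)).re ≤ ‖ω p - 1‖ := by
    refine (Complex.re_le_norm _).trans_eq ?_
    rw [map_sub, hω.2, norm_sub_rev]
  have apply_one_sub_nonneg : 0 ≤ (ω (1 - p)).re := by
    rw [← hq]
    exact (Complex.nonneg_iff.1 (hω.1 _)).1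
  have cauchy_schwarz := hω.norm_sq_apply_mul_le x (1 - p)
  rw [hq] at cauchy_schwarz
  refine le_of_sq_le_sq ?_ (by positivity)
  calc ‖ω (x * (1 - p))‖ ^ 2
      ≤ (ω (x * star x)).re * (ω (1 - p)).re := cauchy_schwarz
    _ ≤ ‖x‖ ^ 2 * ‖ω p - 1‖ :=
        mul_le_mul apply_mul_star_le apply_one_sub_le apply_one_sub_nonneg (by positivity)
    _ = (√‖ω p - 1‖ * ‖x‖) ^ 2 := by rw [mul_pow, Real.sq_sqrt (norm_nonneg _), mul_comm]

theorem norm_sub_characterFunctional_le (hω : IsState ω) {e : A →⋆ₐ[ℂ] ℂ} {p : A}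
    (hp : IsStarProjection p) (h : ∀ x, x * p = e x • p) :
    ‖ω - characterFunctional e‖ ≤ √‖ω p - 1‖ + ‖ω p - 1‖ := by
  refine ContinuousLinearMap.opNorm_le_bound _ (by positivity) fun x => ?_
  have decomposition :
      (ω - characterFunctional e) x = ω (x * (1 - p)) + (ω p - 1) * e x := by
    change ω x - e x = _
    rw [mul_sub, mul_one, h, map_sub, map_smul, smul_eq_mul]
    ring
  have norm_character_le : ‖e x‖ ≤ ‖x‖ := (isState_characterFunctional e).norm_apply_le x
  rw [decomposition, add_mul]
  refine (norm_add_le _ _).trans (add_le_add (hω.norm_apply_mul_one_sub_le hp x) ?_)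
  rw [norm_mul]
  gcongr

theorem tendsto_of_denseRange {R ι : Type*} {l : Filter ι} {j : R → A} (hj : DenseRange j)
    {ω : ι → A →L[ℂ] ℂ} (hω : ∀ n, IsState (ω n)) (ψ : A →L[ℂ] ℂ)
    (h : ∀ a, Filter.Tendsto (fun n => ω n (j a)) l (nhds (ψ (j a)))) (x : A) :
    Filter.Tendsto (fun n => ω n x) l (nhds (ψ x)) := by
  have equicontinuous : Equicontinuous fun n x => ω n x :=
    (LipschitzWith.uniformEquicontinuous _ 1 fun n =>
      (ω n).lipschitz.weaken (hω n).norm_le_one).equicontinuous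
  exact hj.induction_on x (equicontinuous.isClosed_setOfPred_tendsto ψ.continuous) h

end IsState

end States

section VectorStates

open scoped ComplexOrder

variable {A H : Type*} [CStarAlgebra A] [NormedAddCommGroup H] [InnerProductSpace ℂ H]
  [CompleteSpace H]

/-- The vector functional `x ↦ ⟨x ξ, ξ⟩ / ‖ξ‖²` of a representation. -/
noncomputable def vectorState (ρ : A →⋆ₐ[ℂ] (H →L[ℂ] H)) (ξ : H) : A →L[ℂ] ℂ :=
  ((‖ξ‖ : ℂ) ^ 2)⁻¹ • (innerSL ℂ ξ ∘L ContinuousLinearMap.apply ℂ H ξ ∘L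
    ⟨ρ.toAlgHom.toLinearMap, map_continuous ρ⟩)

theorem vectorState_apply (ρ : A →⋆ₐ[ℂ] (H →L[ℂ] H)) (ξ : H) (x : A) :
    vectorState ρ ξ x = ((‖ξ‖ : ℂ) ^ 2)⁻¹ * inner ℂ ξ (ρ x ξ) := rfl

theorem isState_vectorState (ρ : A →⋆ₐ[ℂ] (H →L[ℂ] H)) {ξ : H} (hξ : ξ ≠ 0) :
    IsState (vectorState ρ ξ) := by
  refine ⟨fun x => ?_, ?_⟩
  · rw [vectorState_apply, map_mul, map_star, mul_apply_eq_comp,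
      ContinuousLinearMap.star_eq_adjoint, ContinuousLinearMap.adjoint_inner_right,
      inner_self_eq_norm_sq_to_K]
    exact mul_nonneg (inv_nonneg.2 (pow_nonneg (Complex.zero_le_real.2 (norm_nonneg _)) 2))
      (pow_nonneg (RCLike.ofReal_nonneg.2 (norm_nonneg _)) 2)
  · rw [vectorState_apply, map_one, one_apply_eq_self, inner_self_eq_norm_sq_to_K]
    exact inv_mul_cancel₀ (by simpa using hξ)

end VectorStates

section HilbertSpace

theorem exists_mem_forall_norm_le_imp_eq {E : Type*} [NormedAddCommGroup E]
    [InnerProductSpace ℝ E] [CompleteSpace E] {Q : Set E} (hclosed : IsClosed Q)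
    (hconvex : Convex ℝ Q) (hne : Q.Nonempty) : ∃ η ∈ Q, ∀ x ∈ Q, ‖x‖ ≤ ‖η‖ → x = η := by
  obtain ⟨η, hη, hmin⟩ :=
    exists_norm_eq_iInf_of_complete_convex hne hclosed.isComplete hconvex (0 : E)
  refine ⟨η, hη, fun x hx hxη => sub_eq_zero.1 <| norm_eq_zero.1 ?_⟩
  have inner_le := (norm_eq_iInf_iff_real_inner_le_zero hconvex hη).1 hmin x hx
  rw [zero_sub, inner_neg_left, neg_nonpos] at inner_le
  have norm_sq : ‖x‖ ^ 2 = ‖η‖ ^ 2 + 2 * inner ℝ η (x - η) + ‖x - η‖ ^ 2 := by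
    rw [← norm_add_sq_real, add_sub_cancel]
  have := norm_nonneg x
  nlinarith

theorem exists_mem_forall_apply_eq_of_norm_le {E I : Type*} [NormedAddCommGroup E]
    [InnerProductSpace ℝ E] [CompleteSpace E] {Q : Set E} (hclosed : IsClosed Q)
    (hconvex : Convex ℝ Q) (hne : Q.Nonempty) {T : I → E → E} (hT : ∀ i x, ‖T i x‖ ≤ ‖x‖)
    (hmaps : ∀ i, Set.MapsTo (T i) Q Q) : ∃ η ∈ Q, ∀ i, T i η = η := by
  obtain ⟨η, hη, hmin⟩ := exists_mem_forall_norm_le_imp_eq hclosed hconvex hne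
  exact ⟨η, hη, fun i => hmin _ (hmaps i hη) (hT i η)⟩

theorem sub_pow_succ_of_mul_eq {R : Type*} [Ring R] {B P : R} (hPP : P * P = P) (hBP : B * P = P)
    (hPB : P * B = P) (n : ℕ) : (B - P) ^ (n + 1) = B ^ (n + 1) - P := by
  have hpow (k : ℕ) : B ^ k * P = P := by
    induction k with
    | zero => rw [pow_zero, one_mul]
    | succ k ih => rw [pow_succ, mul_assoc, hBP, ih]
  induction n with
  | zero => simp only [zero_add, pow_one]
  | succ n ih =>
    rw [pow_succ, ih, sub_mul, mul_sub, mul_sub, hpow, hPB, hPP, ← pow_succ, sub_self, sub_zero]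

variable {H : Type*} [NormedAddCommGroup H] [InnerProductSpace ℂ H] [CompleteSpace H]
  {B : H →L[ℂ] H} {V : Submodule ℂ H} [V.HasOrthogonalProjection]

theorem inner_sub_starProjection_apply (hB : IsSelfAdjoint B) (hV : ∀ x ∈ V, B x = x) (x : H) :
    inner ℂ ((B - V.starProjection) x) x =
      inner ℂ (B (Vᗮ.starProjection x)) (Vᗮ.starProjection x) := by
  have hPx : V.starProjection x ∈ V := Submodule.starProjection_apply_mem V x
  have hQx : Vᗮ.starProjection x = x - V.starProjection x :=
    Submodule.starProjection_orthogonal_val x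
  have hsub : (B - V.starProjection) x = B (Vᗮ.starProjection x) := by
    rw [hQx, map_sub, hV _ hPx, sub_apply]
  have horth : inner ℂ (B (Vᗮ.starProjection x)) (V.starProjection x) = 0 := by
    rw [← ContinuousLinearMap.adjoint_inner_right, ← ContinuousLinearMap.star_eq_adjoint,
      hB.star_eq, hV _ hPx]
    exact Submodule.inner_left_of_mem_orthogonal hPx (Submodule.starProjection_apply_mem _ x)
  rw [hsub]
  nth_rw 2 [← sub_add_cancel x (V.starProjection x)]
  rw [← hQx, inner_add_right, horth, add_zero]

theorem norm_sub_starProjection_le (hB : IsSelfAdjoint B) (hV : ∀ x ∈ V, B x = x) {r : ℝ}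
    (hr : 0 ≤ r) (h : ∀ x ∈ Vᗮ, |(inner ℂ (B x) x).re| ≤ r * ‖x‖ ^ 2) :
    ‖B - V.starProjection‖ ≤ r := by
  have hsymm : (B - V.starProjection : H →L[ℂ] H).IsSymmetric :=
    (hB.sub (isSelfAdjoint_starProjection V)).isSymmetric
  rw [ContinuousLinearMap.norm_eq_iSup_rayleighQuotient _ hsymm]
  refine Real.iSup_le (fun x => ?_) hr
  rw [ContinuousLinearMap.rayleighQuotient, ContinuousLinearMap.reApplyInnerSelf_apply,
    inner_sub_starProjection_apply hB hV, abs_div, abs_sq]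
  refine div_le_of_le_mul₀ (sq_nonneg _) hr ?_
  calc |(inner ℂ (B (Vᗮ.starProjection x)) (Vᗮ.starProjection x)).re|
      ≤ r * ‖Vᗮ.starProjection x‖ ^ 2 := h _ (Submodule.starProjection_apply_mem _ x)
    _ ≤ r * ‖x‖ ^ 2 := by gcongr; exact Submodule.norm_starProjection_apply_le _ x

theorem norm_pow_sub_starProjection_le (hB : IsSelfAdjoint B) (hV : ∀ x ∈ V, B x = x) {r : ℝ}
    (hr : 0 ≤ r) (h : ∀ x ∈ Vᗮ, |(inner ℂ (B x) x).re| ≤ r * ‖x‖ ^ 2) (n : ℕ) :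
    ‖B ^ (n + 1) - V.starProjection‖ ≤ r ^ (n + 1) := by
  set P := V.starProjection
  have hBP : B * P = P := by
    ext x
    exact hV _ (Submodule.starProjection_apply_mem V x)
  have hPB : P * B = P := by
    have := congrArg star hBP
    rwa [star_mul, hB.star_eq, (isSelfAdjoint_starProjection V).star_eq] at this
  rw [← sub_pow_succ_of_mul_eq V.isIdempotentElem_starProjection hBP hPB]
  exact (norm_pow_le' _ n.succ_pos).trans
    (pow_le_pow_left₀ (norm_nonneg _) (norm_sub_starProjection_le hB hV hr h) _)

end HilbertSpace

theorem le_of_forall_pow_two_pow_le {a b c : ℝ} (hb : 0 ≤ b)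
    (h : ∀ n : ℕ, a ^ 2 ^ n ≤ c * b ^ 2 ^ n) : a ≤ b := by
  by_contra! hab
  obtain rfl | hb' := hb.eq_or_lt
  · have : a ≤ 0 := by simpa using h 0
    exact this.not_gt hab
  · have one_lt : 1 < a / b := (one_lt_div hb').2 hab
    obtain ⟨n, hn⟩ := pow_unbounded_of_one_lt c one_lt
    refine hn.not_ge ?_
    calc (a / b) ^ n ≤ (a / b) ^ 2 ^ n := pow_le_pow_right₀ one_lt.le Nat.lt_two_pow_self.le
      _ = a ^ 2 ^ n / b ^ 2 ^ n := div_pow a b _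
      _ ≤ c := (div_le_iff₀ (by positivity)).2 (h n)

section BoundedFamilies

open scoped ENNReal

variable {I : Type*} {A : I → Type*} [∀ i, CStarAlgebra (A i)] [∀ i, Nontrivial (A i)]

/-- The projection of the bounded families to their components at `i`. -/
noncomputable def BoundedFamilies.eval (i : I) : BoundedFamilies A →⋆ₐ[ℂ] A i where
  toFun x := (show lp A ∞ from x) i
  map_one' := rfl
  map_mul' _ _ := rfl
  map_zero' := rfl
  map_add' _ _ := rfl
  commutes' _ := rfl
  map_star' _ := rfl

theorem BoundedFamilies.norm_le_of_forall_le {x : BoundedFamilies A} {M : ℝ} (hM : 0 ≤ M)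
    (h : ∀ i, ‖BoundedFamilies.eval i x‖ ≤ M) : ‖x‖ ≤ M :=
  lp.norm_le_of_forall_le (f := (show lp A ∞ from x)) hM h

end BoundedFamilies

section ClosedRange

variable {R A : Type*} [Ring R] [StarRing R] [Algebra ℂ R] [CStarAlgebra A] (Θ : R →⋆ₐ[ℂ] A)

/-- The inclusion of the closure of the range of a *-homomorphism into the ambient C*-algebra. -/
noncomputable def ClosedRange.incl : ClosedRange Θ →⋆ₐ[ℂ] A :=
  Θ.range.topologicalClosure.subtype

theorem ClosedRange.denseRange_restrict : DenseRange (ClosedRange.restrict Θ) := fun x => by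
  rw [Metric.mem_closure_iff]
  intro r hr
  obtain ⟨_, ⟨y, rfl⟩, hy⟩ := Metric.mem_closure_iff.1 x.2 r hr
  exact ⟨_, ⟨y, rfl⟩, hy⟩

end ClosedRange

/-! ### Standard solutions and the dimension -/

namespace CStarTensorCategory

theorem IsIrreducible.smul_id_injective {C : Type u} [Category.{v} C] [Preadditive C] [Linear ℂ C]
    {X : C} (hX : IsIrreducible X) : Function.Injective fun a : ℂ => a • 𝟙 X :=
  smul_left_injective ℂ hX.1

section Dagger

variable {C : Type u} [Category.{v} C] [Preadditive C] [Linear ℂ C]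
  [MonoidalCategory C] [MonoidalPreadditive C] [MonoidalLinear ℂ C] [CStarTensorCategory C]

variable (C) in
/-- The passage to the adjoint as an additive map. -/
def dagAddHom (X Y : C) : (X ⟶ Y) →+ (Y ⟶ X) := AddMonoidHom.mk' dag dag_add

theorem dag_sub {X Y : C} (f g : X ⟶ Y) : dag (f - g) = dag f - dag g :=
  map_sub (dagAddHom C X Y) f g

theorem dag_sum {ι : Type*} (s : Finset ι) {X Y : C} (f : ι → (X ⟶ Y)) :
    dag (∑ i ∈ s, f i) = ∑ i ∈ s, dag (f i) :=
  map_sum (dagAddHom C X Y) f s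

theorem dag_leftUnitor_inv (X : C) : dag (λ_ X).inv = (λ_ X).hom := by
  rw [← dag_leftUnitor, dag_dag]

theorem dag_rightUnitor_inv (X : C) : dag (ρ_ X).inv = (ρ_ X).hom := by
  rw [← dag_rightUnitor, dag_dag]

theorem dag_associator_inv (X Y Z : C) : dag (α_ X Y Z).inv = (α_ X Y Z).hom := by
  rw [← dag_associator, dag_dag]

end Dagger

end CStarTensorCategory

namespace RigidCStarTensorCategory

open CStarTensorCategory

section ComparisonOfDuals

variable {C : Type u} [Category.{v} C] [MonoidalCategory C] {X Y Y' : C}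
  (p : ExactPairing X Y) (p' : ExactPairing X Y')

theorem coevaluation_comp_rightDualIso : η_ X Y ≫ X ◁ (rightDualIso p p').hom = η_ X Y' := by
  have h := @coevaluation_comp_rightAdjointMate C _ _ X X ⟨Y'⟩ ⟨Y⟩ (𝟙 X)
  rw [id_whiskerRight, Category.comp_id] at h
  exact h

theorem rightDualIso_comp_evaluation : (rightDualIso p p').hom ▷ X ≫ ε_ X Y' = ε_ X Y := by
  have h := @rightAdjointMate_comp_evaluation C _ _ X X ⟨Y'⟩ ⟨Y⟩ (𝟙 X)
  rw [MonoidalCategory.whiskerLeft_id, Category.id_comp] at h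
  exact h

theorem rightDualIso_inv_comp_evaluation : (rightDualIso p p').inv ▷ X ≫ ε_ X Y = ε_ X Y' := by
  rw [← rightDualIso_comp_evaluation p p', ← comp_whiskerRight_assoc, Iso.inv_hom_id,
    id_whiskerRight, Category.id_comp]

theorem eq_zero_of_coevaluation_comp_whiskerLeft [Preadditive C] [MonoidalPreadditive C]
    {g : Y ⟶ Y'} (h : η_ X Y ≫ X ◁ g = 0) : g = 0 := by
  have h' := congrArg (tensorLeftHomEquiv (𝟙_ C) X Y Y').symm
    (h.trans (by rw [MonoidalPreadditive.whiskerLeft_zero, Limits.comp_zero] :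
      0 = η_ X Y ≫ X ◁ (0 : Y ⟶ Y')))
  rw [tensorLeftHomEquiv_symm_coevaluation_comp_whiskerLeft,
    tensorLeftHomEquiv_symm_coevaluation_comp_whiskerLeft] at h'
  exact (cancel_epi _).1 h'

end ComparisonOfDuals

namespace IsStandard

variable {C : Type u} [Category.{v} C] [Preadditive C] [Linear ℂ C]
  [MonoidalCategory C] [MonoidalPreadditive C] [MonoidalLinear ℂ C] [CStarTensorCategory C]
  {X Y Y' : C} {p : ExactPairing X Y} {p' : ExactPairing X Y'}

theorem trace_conj (hp : IsStandard p) (y : Y ⟶ Y) :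
    η_ X Y ≫ X ◁ y ≫ dag (η_ X Y) = dag (ε_ X Y) ≫ y ▷ X ≫ ε_ X Y := by
  let _ : HasLeftDual Y := ⟨X⟩
  have coevaluation_mate : η_ X Y ≫ (ᘁy) ▷ Y = η_ X Y ≫ X ◁ y :=
    coevaluation_comp_leftAdjointMate y
  have mate_evaluation : Y ◁ (ᘁy) ≫ ε_ X Y = y ▷ X ≫ ε_ X Y := leftAdjointMate_comp_evaluation y
  rw [← Category.assoc, ← coevaluation_mate, Category.assoc, ← mate_evaluation]
  exact (hp _).symm

theorem dag_evaluation_comp_evaluation (hp : IsStandard p) :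
    dag (ε_ X Y) ≫ ε_ X Y = η_ X Y ≫ dag (η_ X Y) := by
  simpa only [MonoidalCategory.whiskerLeft_id, id_whiskerRight, Category.id_comp] using hp (𝟙 X)

theorem dualPairing (hp : IsStandard p) : IsStandard (dualPairing p) := by
  intro y
  change dag (dag (η_ X Y)) ≫ X ◁ y ≫ dag (η_ X Y) = dag (ε_ X Y) ≫ y ▷ X ≫ dag (dag (ε_ X Y))
  rw [dag_dag, dag_dag]
  exact hp.trace_conj y

theorem trace_rightDualIso_hom :
    η_ X Y ≫ X ◁ ((rightDualIso p p').hom ≫ dag (rightDualIso p p').hom) ≫ dag (η_ X Y) =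
      η_ X Y' ≫ dag (η_ X Y') := by
  rw [← coevaluation_comp_rightDualIso p p', dag_comp, dag_whiskerLeft,
    MonoidalCategory.whiskerLeft_comp, Category.assoc, Category.assoc]

theorem trace_rightDualIso_inv (hp : IsStandard p) (hp' : IsStandard p') :
    η_ X Y ≫ X ◁ (dag (rightDualIso p p').inv ≫ (rightDualIso p p').inv) ≫ dag (η_ X Y) =
      η_ X Y' ≫ dag (η_ X Y') := by
  rw [hp.trace_conj, ← hp'.dag_evaluation_comp_evaluation,
    ← rightDualIso_inv_comp_evaluation p p', dag_comp, dag_whiskerRight, comp_whiskerRight,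
    Category.assoc, Category.assoc]

-- With `g` the comparison isomorphism, this expands `(g - (g⁻¹)*) (g - (g⁻¹)*)*`. The left-hand
-- side is positive and the right-hand side changes its sign when `p` and `p'` are exchanged.
theorem coevaluation_comp_defect_comp_dag (hp : IsStandard p) (hp' : IsStandard p') :
    (η_ X Y ≫ X ◁ ((rightDualIso p p').hom - dag (rightDualIso p p').inv)) ≫
      dag (η_ X Y ≫ X ◁ ((rightDualIso p p').hom - dag (rightDualIso p p').inv)) =
      (2 : ℂ) • (η_ X Y' ≫ dag (η_ X Y') - η_ X Y ≫ dag (η_ X Y)) := by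
  have trace_hom := trace_rightDualIso_hom (p := p) (p' := p')
  have trace_inv := hp.trace_rightDualIso_inv hp'
  set g := rightDualIso p p'
  have dag_inv_comp_dag_hom : dag g.inv ≫ dag g.hom = 𝟙 Y := by
    rw [← dag_comp, g.hom_inv_id, dag_id]
  have expansion : (g.hom - dag g.inv) ≫ dag (g.hom - dag g.inv) + 𝟙 Y + 𝟙 Y =
      g.hom ≫ dag g.hom + dag g.inv ≫ g.inv := by
    rw [dag_sub, dag_dag, Preadditive.sub_comp, Preadditive.comp_sub, Preadditive.comp_sub,
      g.hom_inv_id, dag_inv_comp_dag_hom]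
    abel
  have h := congrArg (fun y => η_ X Y ≫ X ◁ y ≫ dag (η_ X Y)) expansion
  simp only [MonoidalPreadditive.whiskerLeft_add, MonoidalCategory.whiskerLeft_id,
    Preadditive.add_comp, Preadditive.comp_add, Category.id_comp, trace_hom, trace_inv] at h
  rw [dag_comp, dag_whiskerLeft, Category.assoc, ← whiskerLeft_comp_assoc, two_smul]
  rw [← eq_sub_iff_add_eq, ← eq_sub_iff_add_eq] at h
  rw [h]
  abel

end IsStandard

section Dimension

variable {C : Type u} [Category.{v} C] [Preadditive C] [Linear ℂ C]
  [MonoidalCategory C] [MonoidalPreadditive C] [MonoidalLinear ℂ C] [RightRigidCategory C]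
  [CStarTensorCategory C] [RigidCStarTensorCategory C] {X Y Y' : C} {p : ExactPairing X Y}
  {p' : ExactPairing X Y'}

theorem IsStandard.dim_le (hp : IsStandard p) (hp' : IsStandard p') {d d' : ℝ}
    (hd : η_ X Y ≫ dag (η_ X Y) = (d : ℂ) • 𝟙 (𝟙_ C))
    (hd' : η_ X Y' ≫ dag (η_ X Y') = (d' : ℂ) • 𝟙 (𝟙_ C)) : d ≤ d' := by
  obtain ⟨c, hc, hcomp⟩ := exists_scalar irreducible_unit
    (η_ X Y ≫ X ◁ ((rightDualIso p p').hom - dag (rightDualIso p p').inv))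
  rw [hp.coevaluation_comp_defect_comp_dag hp', hd, hd', ← sub_smul, smul_smul] at hcomp
  have h : 2 * (d' - d) = c := by exact_mod_cast irreducible_unit.smul_id_injective hcomp
  linarith

theorem IsDimension.unique {d d' : ℝ} (h : IsDimension X d) (h' : IsDimension X d') :
    d = d' := by
  obtain ⟨Y, p, hp, hd⟩ := h
  obtain ⟨Y', p', hp', hd'⟩ := h'
  exact le_antisymm (hp.dim_le hp' hd hd') (hp'.dim_le hp hd' hd)

theorem IsDimension.dim_eq {d : ℝ} (h : IsDimension X d) : dim X = d :=
  IsDimension.unique (Classical.epsilon_spec (p := IsDimension X) ⟨d, h⟩) h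

namespace IsStandard

theorem coevaluation_comp_dag (hp : IsStandard p) :
    η_ X Y ≫ dag (η_ X Y) = (dim X : ℂ) • 𝟙 (𝟙_ C) := by
  obtain ⟨d, -, hd⟩ := exists_scalar irreducible_unit (η_ X Y)
  rw [hd, IsDimension.dim_eq ⟨Y, p, hp, hd⟩]

theorem rightDualIso_hom (hp : IsStandard p) (hp' : IsStandard p') :
    (rightDualIso p p').hom = dag (rightDualIso p p').inv := by
  have h := hp.coevaluation_comp_defect_comp_dag hp'
  rw [hp.coevaluation_comp_dag, hp'.coevaluation_comp_dag, sub_self, smul_zero] at h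
  exact sub_eq_zero.1 (eq_zero_of_coevaluation_comp_whiskerLeft p (eq_zero_of_comp_dag h))

theorem trace_unique (hp : IsStandard p) (hp' : IsStandard p') (f : X ⟶ X) :
    η_ X Y ≫ f ▷ Y ≫ dag (η_ X Y) = η_ X Y' ≫ f ▷ Y' ≫ dag (η_ X Y') := by
  have dag_hom : dag (rightDualIso p p').hom = (rightDualIso p p').inv := by
    rw [hp.rightDualIso_hom hp', dag_dag]
  rw [← coevaluation_comp_rightDualIso p p', dag_comp, dag_whiskerLeft, dag_hom, Category.assoc,
    ← whisker_exchange_assoc, ← whiskerLeft_comp_assoc, Iso.hom_inv_id,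
    MonoidalCategory.whiskerLeft_id, Category.id_comp]

end IsStandard

theorem dim_pos (hX : IsIrreducible X) : 0 < dim X := by
  obtain ⟨_, Y, p, hp, -⟩ := exists_isDimension hX
  obtain ⟨c, hc, hcomp⟩ := exists_scalar irreducible_unit (η_ X Y)
  have dim_eq : dim X = c := by
    exact_mod_cast irreducible_unit.smul_id_injective (hp.coevaluation_comp_dag.symm.trans hcomp)
  exact lt_of_le_of_ne (dim_eq ▸ hc) (dim_ne_zero hX).symm

end Dimension

section SumPairing

variable {C : Type u} [Category.{v} C] [MonoidalCategory C]

-- In the two zigzag identities for a sum of pairings, these lemmas turn the `(i, j)` term into the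
-- zigzag of the `i`-th pairing when `i = j`, and into zero when `a i` and `a j` are orthogonal.
theorem zigzag_tensorHom_right {V V' W W' Z Z' : C} (η : 𝟙_ C ⟶ W ⊗ W') (ε : Z' ⊗ Z ⟶ 𝟙_ C)
    (a : W ⟶ V) (b : W' ⟶ V') (a' : V ⟶ Z) (b' : V' ⟶ Z') :
    V' ◁ (η ≫ (a ⊗ₘ b)) ≫ (α_ V' V V').inv ≫ ((b' ⊗ₘ a') ≫ ε) ▷ V' =
      b' ▷ 𝟙_ C ≫ Z' ◁ (η ≫ (a ≫ a') ▷ W') ≫ (α_ Z' Z W').inv ≫ ε ▷ W' ≫ 𝟙_ C ◁ b := by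
  have slide_b : V' ◁ V ◁ b ≫ (α_ V' V V').inv ≫ ((b' ⊗ₘ a') ≫ ε) ▷ V' =
      (α_ V' V W').inv ≫ ((b' ⊗ₘ a') ≫ ε) ▷ W' ≫ 𝟙_ C ◁ b := by
    rw [associator_inv_naturality_right_assoc, whisker_exchange]
  have slide_b' : V' ◁ (η ≫ a ▷ W') ≫ b' ▷ (V ⊗ W') = b' ▷ 𝟙_ C ≫ Z' ◁ (η ≫ a ▷ W') :=
    whisker_exchange _ _
  rw [MonoidalCategory.tensorHom_def a b, ← Category.assoc η, MonoidalCategory.whiskerLeft_comp,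
    Category.assoc, slide_b, MonoidalCategory.tensorHom_def b' a']
  simp only [comp_whiskerRight, Category.assoc] at slide_b' ⊢
  rw [← associator_inv_naturality_left_assoc, reassoc_of% slide_b']
  simp

theorem zigzag_tensorHom_left {V V' W W' Z Z' : C} (η : 𝟙_ C ⟶ W ⊗ W') (ε : Z' ⊗ Z ⟶ 𝟙_ C)
    (a : W ⟶ V) (b : W' ⟶ V') (a' : V ⟶ Z) (b' : V' ⟶ Z') :
    (η ≫ (a ⊗ₘ b)) ▷ V ≫ (α_ V V' V).hom ≫ V ◁ ((b' ⊗ₘ a') ≫ ε) =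
      𝟙_ C ◁ a' ≫ (η ≫ W ◁ (b ≫ b')) ▷ Z ≫ (α_ W Z' Z).hom ≫ W ◁ ε ≫ a ▷ 𝟙_ C := by
  have slide_a : a ▷ V' ▷ V ≫ (α_ V V' V).hom ≫ V ◁ ((b' ⊗ₘ a') ≫ ε) =
      (α_ W V' V).hom ≫ W ◁ ((b' ⊗ₘ a') ≫ ε) ≫ a ▷ 𝟙_ C := by
    rw [associator_naturality_left_assoc, ← whisker_exchange]
  have slide_a' : (η ≫ W ◁ b) ▷ V ≫ (W ⊗ V') ◁ a' = 𝟙_ C ◁ a' ≫ (η ≫ W ◁ b) ▷ Z :=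
    (whisker_exchange _ _).symm
  rw [MonoidalCategory.tensorHom_def' a b, ← Category.assoc η, comp_whiskerRight,
    Category.assoc, slide_a, MonoidalCategory.tensorHom_def' b' a']
  simp only [MonoidalCategory.whiskerLeft_comp, Category.assoc] at slide_a' ⊢
  rw [← associator_naturality_right_assoc, reassoc_of% slide_a']
  simp

end SumPairing

section OrthogonalSums

variable {C : Type u} [Category.{v} C] [Preadditive C] [Linear ℂ C]
  [MonoidalCategory C] [MonoidalPreadditive C] [MonoidalLinear ℂ C] [CStarTensorCategory C]

/-- `V`, with the isometries `a i`, is an orthogonal direct sum of the family `W`. -/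
abbrev IsOrthSum {n : ℕ} (V : C) (W : Fin n → C) (a : ∀ i, W i ⟶ V) : Prop :=
  IsDirectSum V W a fun i => dag (a i)

theorem isOrthSum_of_isIso {X Y : C} (u : X ⟶ Y) [IsIso u] (hu : u ≫ dag u = 𝟙 X) :
    IsOrthSum Y (fun _ : Fin 1 => X) fun _ => u := by
  refine ⟨fun _ => hu, fun i j hij => absurd (Subsingleton.elim i j) hij, ?_⟩
  rw [Fin.sum_univ_one, ← cancel_epi u, reassoc_of% hu, Category.comp_id]

theorem IsOrthSum.cons {n : ℕ} {V Z : C} {W : Fin (n + 1) → C} {a : ∀ i : Fin n, W i.succ ⟶ V}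
    (h : IsOrthSum V (fun i => W i.succ) a) {b : W 0 ⟶ Z} {c : V ⟶ Z} (hb : b ≫ dag b = 𝟙 (W 0))
    (hc : c ≫ dag c = 𝟙 V) (hbc : dag b ≫ b + dag c ≫ c = 𝟙 Z) :
    IsOrthSum Z W (Fin.cases (motive := fun i => W i ⟶ Z) b fun i => a i ≫ c) := by
  have b_orth_c : b ≫ dag c = 0 := directSum_orthogonal hb hc hbc
  have c_orth_b : c ≫ dag b = 0 := directSum_orthogonal hc hb (by rw [add_comm]; exact hbc)
  refine ⟨fun i => ?_, fun i j hij => ?_, ?_⟩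
  · cases i using Fin.cases with
    | zero => exact hb
    | succ i => simp [dag_comp, reassoc_of% hc, h.1]
  · cases i using Fin.cases with
    | zero =>
      cases j using Fin.cases with
      | zero => exact absurd rfl hij
      | succ j => simp [dag_comp, reassoc_of% b_orth_c]
    | succ i =>
      cases j using Fin.cases with
      | zero => simp [c_orth_b]
      | succ j => simp [dag_comp, reassoc_of% hc, h.2.1 i j fun h => hij (congrArg Fin.succ h)]
  · have sum_tail : ∑ i, dag c ≫ dag (a i) ≫ a i ≫ c = dag c ≫ (∑ i, dag (a i) ≫ a i) ≫ c := by
      simp only [Preadditive.sum_comp, Preadditive.comp_sum, Category.assoc]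
    rw [Fin.sum_univ_succ]
    simp only [Fin.cases_zero, Fin.cases_succ, dag_comp, Category.assoc]
    rw [sum_tail, h.2.2, Category.id_comp, hbc]

-- The axioms provide no zero object, so the empty family is excluded.
theorem exists_orthSum (n : ℕ) (W : Fin (n + 1) → C) :
    ∃ (V : C) (a : ∀ i, W i ⟶ V), IsOrthSum V W a := by
  induction n with
  | zero =>
    obtain ⟨X, rfl⟩ : ∃ X, W = fun _ => X := ⟨W 0, funext fun i => by rw [Fin.fin_one_eq_zero i]⟩
    exact ⟨X, _, isOrthSum_of_isIso (𝟙 X) (by rw [dag_id, Category.comp_id])⟩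
  | succ n ih =>
    obtain ⟨V, a, h⟩ := ih fun i => W i.succ
    obtain ⟨Z, b, c, hb, hc, hbc⟩ := exists_directSum (W 0) V
    exact ⟨Z, _, IsOrthSum.cons h hb hc hbc⟩

variable {n : ℕ} {V V' : C} {W W' : Fin n → C} {a : ∀ i, W i ⟶ V} {b : ∀ i, W' i ⟶ V'}
  (h : IsOrthSum V W a) (h' : IsOrthSum V' W' b) (p : ∀ i, ExactPairing (W i) (W' i))

/-- The direct sum of solutions of the conjugate equations. -/
@[reducible]
def sumPairing : ExactPairing V V' where
  coevaluation' := ∑ i, η_ (W i) (W' i) ≫ (a i ⊗ₘ b i)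
  evaluation' := ∑ i, (dag (b i) ⊗ₘ dag (a i)) ≫ ε_ (W i) (W' i)
  coevaluation_evaluation' := by
    simp only [whiskerLeft_sum, sum_whiskerRight, Preadditive.sum_comp, Preadditive.comp_sum,
      zigzag_tensorHom_right]
    have term (i j) : dag (b j) ▷ 𝟙_ C ≫ W' j ◁ (η_ (W i) (W' i) ≫ (a i ≫ dag (a j)) ▷ W' i) ≫
        (α_ (W' j) (W j) (W' i)).inv ≫ ε_ (W j) (W' j) ▷ W' i ≫ 𝟙_ C ◁ b i =
        if i = j then (ρ_ V').hom ≫ (dag (b i) ≫ b i) ≫ (λ_ V').inv else 0 := by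
      split_ifs with hij
      · subst hij
        rw [h.1]
        simp
      · rw [h.2.1 i j hij]
        simp
    simp only [term, Finset.sum_ite_eq', Finset.mem_univ, if_true]
    rw [← Preadditive.comp_sum, ← Preadditive.sum_comp, h'.2.2, Category.id_comp]
  evaluation_coevaluation' := by
    simp only [whiskerLeft_sum, sum_whiskerRight, Preadditive.sum_comp, Preadditive.comp_sum,
      zigzag_tensorHom_left]
    have term (i j) : 𝟙_ C ◁ dag (a j) ≫ (η_ (W i) (W' i) ≫ W i ◁ (b i ≫ dag (b j))) ▷ W j ≫
        (α_ (W i) (W' j) (W j)).hom ≫ W i ◁ ε_ (W j) (W' j) ≫ a i ▷ 𝟙_ C =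
        if i = j then (λ_ V).hom ≫ (dag (a i) ≫ a i) ≫ (ρ_ V).inv else 0 := by
      split_ifs with hij
      · subst hij
        rw [h'.1]
        simp
      · rw [h'.2.1 i j hij]
        simp
    simp only [term, Finset.sum_ite_eq', Finset.mem_univ, if_true]
    rw [← Preadditive.comp_sum, ← Preadditive.sum_comp, h.2.2, Category.id_comp]

theorem sumPairing_trace (f : V ⟶ V) :
    (sumPairing h h' p).coevaluation' ≫ f ▷ V' ≫ dag (sumPairing h h' p).coevaluation' =
      ∑ i, η_ (W i) (W' i) ≫ (a i ≫ f ≫ dag (a i)) ▷ W' i ≫ dag (η_ (W i) (W' i)) := by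
  change (∑ i, η_ (W i) (W' i) ≫ (a i ⊗ₘ b i)) ≫ f ▷ V' ≫
    dag (∑ i, η_ (W i) (W' i) ≫ (a i ⊗ₘ b i)) = _
  simp only [dag_sum, Preadditive.sum_comp, Preadditive.comp_sum, dag_comp, dag_tensor,
    Category.assoc, ← tensorHom_id, tensorHom_comp_tensorHom_assoc, Category.id_comp]
  refine Finset.sum_congr rfl fun i _ => ?_
  rw [Finset.sum_eq_single_of_mem i (Finset.mem_univ i), h'.1]
  intro j _ hij
  rw [h'.2.1 j i hij, MonoidalPreadditive.tensor_zero, Limits.zero_comp, Limits.comp_zero]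

theorem sumPairing_conjTrace (f : V ⟶ V) :
    dag (sumPairing h h' p).evaluation' ≫ V' ◁ f ≫ (sumPairing h h' p).evaluation' =
      ∑ i, dag (ε_ (W i) (W' i)) ≫ W' i ◁ (a i ≫ f ≫ dag (a i)) ≫ ε_ (W i) (W' i) := by
  change dag (∑ i, (dag (b i) ⊗ₘ dag (a i)) ≫ ε_ (W i) (W' i)) ≫ V' ◁ f ≫
    (∑ i, (dag (b i) ⊗ₘ dag (a i)) ≫ ε_ (W i) (W' i)) = _
  simp only [dag_sum, Preadditive.sum_comp, Preadditive.comp_sum, dag_comp, dag_tensor, dag_dag,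
    Category.assoc, ← id_tensorHom, tensorHom_comp_tensorHom_assoc, Category.id_comp]
  refine Finset.sum_congr rfl fun i _ => ?_
  rw [Finset.sum_eq_single_of_mem i (Finset.mem_univ i), h'.1]
  intro j _ hij
  rw [h'.2.1 j i hij, MonoidalPreadditive.zero_tensor, Limits.zero_comp, Limits.comp_zero]

theorem IsStandard.sumPairing (hp : ∀ i, IsStandard (p i)) : IsStandard (sumPairing h h' p) :=
  fun f => calc
    _ = ∑ i, dag (ε_ (W i) (W' i)) ≫ W' i ◁ (a i ≫ f ≫ dag (a i)) ≫ ε_ (W i) (W' i) :=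
      sumPairing_conjTrace h h' p f
    _ = ∑ i, η_ (W i) (W' i) ≫ (a i ≫ f ≫ dag (a i)) ▷ W' i ≫ dag (η_ (W i) (W' i)) :=
      Finset.sum_congr rfl fun i _ => hp i _
    _ = _ := (sumPairing_trace h h' p f).symm

/-- The solution of the conjugate equations on a zero object. -/
@[reducible]
def zeroPairing {V : C} (hV : 𝟙 V = 0) : ExactPairing V V where
  coevaluation' := 0
  evaluation' := 0
  coevaluation_evaluation' := by
    rw [← Category.id_comp (ρ_ V).hom, ← id_whiskerRight, hV]
    simp
  evaluation_coevaluation' := by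
    rw [← Category.id_comp (λ_ V).hom, ← MonoidalCategory.whiskerLeft_id, hV]
    simp

theorem IsOrthSum.exists_isStandard {n : ℕ} {V : C} {W W' : Fin n → C} {a : ∀ i, W i ⟶ V}
    (h : IsOrthSum V W a) (p : ∀ i, ExactPairing (W i) (W' i)) (hp : ∀ i, IsStandard (p i)) :
    ∃ (V' : C) (P : ExactPairing V V'), IsStandard P ∧ ∀ f : V ⟶ V,
      η_ V V' ≫ f ▷ V' ≫ dag (η_ V V') =
      ∑ i, η_ (W i) (W' i) ≫ (a i ≫ f ≫ dag (a i)) ▷ W' i ≫ dag (η_ (W i) (W' i)) := by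
  cases n with
  | zero =>
    have hV : 𝟙 V = 0 := h.2.2.symm.trans Finset.sum_empty
    refine ⟨V, zeroPairing hV, fun f => ?_, fun f => ?_⟩
    · change dag (0 : V ⊗ V ⟶ 𝟙_ C) ≫ _ ≫ 0 = (0 : 𝟙_ C ⟶ V ⊗ V) ≫ _
      simp only [Limits.comp_zero, Limits.zero_comp]
    · exact Limits.zero_comp
  | succ n =>
    obtain ⟨V', b, h'⟩ := exists_orthSum n W'
    exact ⟨V', _, IsStandard.sumPairing h h' p hp, sumPairing_trace h h' p⟩

end OrthogonalSums

section DimensionOfSums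

variable {C : Type u} [Category.{v} C] [Preadditive C] [Linear ℂ C]
  [MonoidalCategory C] [MonoidalPreadditive C] [MonoidalLinear ℂ C] [RightRigidCategory C]
  [CStarTensorCategory C] [RigidCStarTensorCategory C]

theorem exists_irreducible_orthSum (X : C) : ∃ (n : ℕ) (Y : Fin n → C) (a : ∀ i, Y i ⟶ X),
    (∀ i, IsIrreducible (Y i)) ∧ IsOrthSum X Y a := by
  obtain ⟨n, Y, a, hY, isometry, orthogonal, sum_eq⟩ := semisimple X
  exact ⟨n, Y, a, hY, isometry, orthogonal, sum_eq⟩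

theorem exists_isStandard (X : C) : ∃ (Y : C) (p : ExactPairing X Y), IsStandard p := by
  obtain ⟨n, Y, a, hY, h⟩ := exists_irreducible_orthSum X
  choose _ Y' p hp _ using fun i => exists_isDimension (hY i)
  obtain ⟨X', P, hP, -⟩ := IsOrthSum.exists_isStandard h p hp
  exact ⟨X', P, hP⟩

theorem dim_orthSum {n : ℕ} {V : C} {W : Fin n → C} {a : ∀ i, W i ⟶ V}
    (h : IsOrthSum V W a) : dim V = ∑ i, dim (W i) := by
  choose W' p hp using fun i => exists_isStandard (W i)
  obtain ⟨V', P, hP, trace_eq⟩ := IsOrthSum.exists_isStandard h p hp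
  have trace_id := trace_eq (𝟙 V)
  simp only [id_whiskerRight, Category.id_comp, h.1, hP.coevaluation_comp_dag,
    fun i => (hp i).coevaluation_comp_dag] at trace_id
  rw [← Finset.sum_smul] at trace_id
  exact_mod_cast irreducible_unit.smul_id_injective trace_id

theorem IsStandard.trace_summand {n : ℕ} {V V' : C} {W : Fin n → C} {a : ∀ i, W i ⟶ V}
    (h : IsOrthSum V W a) {P : ExactPairing V V'} (hP : IsStandard P) (i : Fin n) :
    η_ V V' ≫ (dag (a i) ≫ a i) ▷ V' ≫ dag (η_ V V') = (dim (W i) : ℂ) • 𝟙 (𝟙_ C) := by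
  choose W' p hp using fun i => exists_isStandard (W i)
  obtain ⟨V'', Q, hQ, trace_eq⟩ := IsOrthSum.exists_isStandard h p hp
  rw [hP.trace_unique hQ, trace_eq, Finset.sum_eq_single_of_mem i (Finset.mem_univ i)]
  · simp only [Category.assoc, h.1, Category.comp_id, id_whiskerRight, Category.id_comp]
    rw [(hp i).coevaluation_comp_dag]
  · intro j _ hij
    simp only [Category.assoc]
    rw [reassoc_of% h.2.1 j i hij]
    simp only [Limits.zero_comp, MonoidalPreadditive.zero_whiskerRight, Limits.comp_zero]

theorem dim_congr_of_isIrreducible {X Y : C} (hX : IsIrreducible X) (e : X ≅ Y) :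
    dim X = dim Y := by
  have he : e.hom ≠ 0 := fun h => hX.1 (by rw [← e.hom_inv_id, h, Limits.zero_comp])
  obtain ⟨c, hc, hcomp⟩ := exists_scalar_pos hX he
  have hr : (√c : ℂ)⁻¹ ≠ 0 := inv_ne_zero (Complex.ofReal_ne_zero.2 (Real.sqrt_pos.2 hc).ne')
  set u : X ⟶ Y := (√c : ℂ)⁻¹ • e.hom
  have : IsIso u := hX.isIso (hX.congr e) (smul_ne_zero hr he)
  have hu : u ≫ dag u = 𝟙 X := by
    have normalize : star ((√c : ℂ)⁻¹) * (√c : ℂ)⁻¹ * c = 1 := by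
      rw [star_inv₀, Complex.star_def, Complex.conj_ofReal, ← mul_inv, ← Complex.ofReal_mul,
        Real.mul_self_sqrt hc.le, inv_mul_cancel₀ (Complex.ofReal_ne_zero.2 hc.ne')]
    rw [dag_smul, Linear.comp_smul, Linear.smul_comp, hcomp, smul_smul, smul_smul, normalize,
      one_smul]
  simpa only [Fin.sum_univ_one] using (dim_orthSum (isOrthSum_of_isIso u hu)).symm

/-- The linear functional on the fusion algebra that takes the value `f π` at the basis element
`π`. -/
noncomputable def FusionAlgebra.extend (f : Irr C → ℂ) : FusionAlgebra C →ₗ[ℂ] ℂ :=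
  Finsupp.lift ℂ ℂ (Irr C) f

theorem FusionAlgebra.extend_basis (f : Irr C → ℂ) (π : Irr C) :
    FusionAlgebra.extend f (FusionAlgebra.basis π) = f π := by
  change Finsupp.lift ℂ ℂ (Irr C) f (Finsupp.single π 1) = f π
  simp

theorem FusionAlgebra.extend_of (f : Irr C → ℂ) {n : ℕ} {V : C} {W : Fin n → C}
    {b : ∀ i, W i ⟶ V} {b' : ∀ i, V ⟶ W i} (h : IsDirectSum V W b b')
    (hW : ∀ i, IsIrreducible (W i)) :
    FusionAlgebra.extend f (FusionAlgebra.of V) = ∑ i, f (Irr.mk (W i) (hW i)) := by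
  rw [FusionAlgebra.of_isDirectSum h, map_sum]
  refine Finset.sum_congr rfl fun i _ => ?_
  rw [FusionAlgebra.of_irreducible (hW i), FusionAlgebra.extend_basis]

theorem FusionAlgebra.extend_dim_of (X : C) :
    FusionAlgebra.extend (fun π => (dim π.rep : ℂ)) (FusionAlgebra.of X) = dim X := by
  obtain ⟨n, Y, a, hY, h⟩ := exists_irreducible_orthSum X
  rw [FusionAlgebra.extend_of _ h hY, dim_orthSum h, Complex.ofReal_sum]
  refine Finset.sum_congr rfl fun i _ => congrArg _ ?_
  exact dim_congr_of_isIrreducible (Irr.irreducible_rep _) (Irr.rep_mk (hY i)).some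

theorem dim_congr {X Y : C} (e : X ≅ Y) : dim X = dim Y := by
  have h := FusionAlgebra.extend_dim_of X
  rw [FusionAlgebra.of_congr e, FusionAlgebra.extend_dim_of] at h
  exact_mod_cast h.symm

theorem dim_rep_mk {X : C} (hX : IsIrreducible X) : dim (Irr.mk X hX).rep = dim X :=
  dim_congr (Irr.rep_mk hX).some

theorem dim_dual (X : C) : dim (Xᘁ) = dim X := by
  obtain ⟨Y, p, hp⟩ := exists_isStandard X
  rw [← dim_congr (rightDualIso p (HasRightDual.exact (X := X)))]
  refine IsDimension.dim_eq ⟨X, dualPairing p, hp.dualPairing, ?_⟩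
  change dag (ε_ X Y) ≫ dag (dag (ε_ X Y)) = _
  rw [dag_dag, hp.dag_evaluation_comp_evaluation, hp.coevaluation_comp_dag]

end DimensionOfSums

section PartialTraces

theorem tensor_coevaluation_eq {C : Type u} [Category.{v} C] [MonoidalCategory C]
    {A A' B B' : C} [ExactPairing A A'] [ExactPairing B B'] : η_ (A ⊗ B) (B' ⊗ A') =
    η_ A A' ≫ ((ρ_ A).inv ≫ A ◁ η_ B B' ≫ (α_ A B B').inv) ▷ A' ≫ (α_ (A ⊗ B) B' A').hom := by
  rw [ExactPairing.tensor_coevaluation]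
  monoidal

theorem tensor_evaluation_eq {C : Type u} [Category.{v} C] [MonoidalCategory C]
    {A A' B B' : C} [ExactPairing A A'] [ExactPairing B B'] : ε_ (A ⊗ B) (B' ⊗ A') =
    (α_ B' A' (A ⊗ B)).hom ≫ B' ◁ ((α_ A' A B).inv ≫ ε_ A A' ▷ B ≫ (λ_ B).hom) ≫ ε_ B B' := by
  rw [ExactPairing.tensor_evaluation]
  monoidal

variable {C : Type u} [Category.{v} C] [Preadditive C] [Linear ℂ C]
  [MonoidalCategory C] [MonoidalPreadditive C] [MonoidalLinear ℂ C] [CStarTensorCategory C]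

/-- The partial trace of an endomorphism of `A ⊗ B` over `B`. -/
def rightPartialTrace {A B B' : C} (s : 𝟙_ C ⟶ B ⊗ B') (f : A ⊗ B ⟶ A ⊗ B) : A ⟶ A :=
  (ρ_ A).inv ≫ A ◁ s ≫ (α_ A B B').inv ≫ f ▷ B' ≫ (α_ A B B').hom ≫ A ◁ dag s ≫ (ρ_ A).hom

/-- The partial trace of an endomorphism of `A ⊗ B` over `A`. -/
def leftPartialTrace {A A' B : C} (t : A' ⊗ A ⟶ 𝟙_ C) (f : A ⊗ B ⟶ A ⊗ B) : B ⟶ B :=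
  (λ_ B).inv ≫ dag t ▷ B ≫ (α_ A' A B).hom ≫ A' ◁ f ≫ (α_ A' A B).inv ≫ t ▷ B ≫ (λ_ B).hom

theorem partialTrace_exchange {A A' B B' : C} (t : A' ⊗ A ⟶ 𝟙_ C) (s : 𝟙_ C ⟶ B ⊗ B')
    (f : A ⊗ B ⟶ A ⊗ B) :
    dag t ≫ A' ◁ rightPartialTrace s f ≫ t = s ≫ leftPartialTrace t f ▷ B' ≫ dag s :=
  calc dag t ≫ A' ◁ rightPartialTrace s f ≫ t
    _ = 𝟙 _ ⊗≫ (dag t ▷ 𝟙_ C ≫ (A' ⊗ A) ◁ s) ⊗≫ A' ◁ f ▷ B' ⊗≫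
          ((A' ⊗ A) ◁ dag s ≫ t ▷ 𝟙_ C) ⊗≫ 𝟙 _ := by
      rw [rightPartialTrace]
      monoidal
    _ = 𝟙 _ ⊗≫ (𝟙_ C ◁ s ≫ dag t ▷ (B ⊗ B')) ⊗≫ A' ◁ f ▷ B' ⊗≫
          (t ▷ (B ⊗ B') ≫ 𝟙_ C ◁ dag s) ⊗≫ 𝟙 _ := by
      rw [whisker_exchange (dag t) s, ← whisker_exchange t (dag s)]
    _ = s ≫ leftPartialTrace t f ▷ B' ≫ dag s := by
      rw [leftPartialTrace]
      monoidal

theorem rightPartialTrace_id (A : C) {B B' : C} {s : 𝟙_ C ⟶ B ⊗ B'} {c : ℂ}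
    (hs : s ≫ dag s = c • 𝟙 (𝟙_ C)) : rightPartialTrace s (𝟙 (A ⊗ B)) = c • 𝟙 A := by
  have whiskered : A ◁ s ≫ A ◁ dag s = c • 𝟙 _ := by
    rw [← MonoidalCategory.whiskerLeft_comp, hs, MonoidalLinear.whiskerLeft_smul,
      MonoidalCategory.whiskerLeft_id]
  simp only [rightPartialTrace, id_whiskerRight, Category.id_comp, Iso.inv_hom_id_assoc]
  rw [reassoc_of% whiskered, Linear.smul_comp, Linear.comp_smul, Category.id_comp, Iso.inv_hom_id]

variable {A A' B B' : C}

theorem tensor_trace [ExactPairing A A'] [ExactPairing B B'] (f : A ⊗ B ⟶ A ⊗ B) :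
    η_ (A ⊗ B) (B' ⊗ A') ≫ f ▷ (B' ⊗ A') ≫ dag (η_ (A ⊗ B) (B' ⊗ A')) =
      η_ A A' ≫ rightPartialTrace (η_ B B') f ▷ A' ≫ dag (η_ A A') := by
  rw [tensor_coevaluation_eq, rightPartialTrace]
  simp only [dag_comp, dag_whiskerRight, dag_whiskerLeft, dag_associator, dag_associator_inv,
    dag_rightUnitor_inv, comp_whiskerRight, Category.assoc]
  simp

theorem tensor_conjTrace [ExactPairing A A'] [ExactPairing B B'] (f : A ⊗ B ⟶ A ⊗ B) :
    dag (ε_ (A ⊗ B) (B' ⊗ A')) ≫ (B' ⊗ A') ◁ f ≫ ε_ (A ⊗ B) (B' ⊗ A') =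
      dag (ε_ B B') ≫ B' ◁ leftPartialTrace (ε_ A A') f ≫ ε_ B B' := by
  rw [tensor_evaluation_eq, leftPartialTrace]
  simp only [dag_comp, dag_whiskerRight, dag_whiskerLeft, dag_associator, dag_associator_inv,
    dag_leftUnitor, MonoidalCategory.whiskerLeft_comp, Category.assoc]
  simp

theorem IsStandard.tensor {p : ExactPairing A A'} {q : ExactPairing B B'} (hp : IsStandard p)
    (hq : IsStandard q) :
    IsStandard (ExactPairing.tensor : ExactPairing (A ⊗ B) (B' ⊗ A')) := by
  intro f
  rw [tensor_conjTrace, hq, ← partialTrace_exchange, hp, tensor_trace]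

theorem IsStandard.tensor_trace_eq_leftPartialTrace {p : ExactPairing A A'}
    {q : ExactPairing B B'} (hp : IsStandard p) (f : A ⊗ B ⟶ A ⊗ B) :
    η_ (A ⊗ B) (B' ⊗ A') ≫ f ▷ (B' ⊗ A') ≫ dag (η_ (A ⊗ B) (B' ⊗ A')) =
      η_ B B' ≫ leftPartialTrace (ε_ A A') f ▷ B' ≫ dag (η_ B B') := by
  rw [tensor_trace, ← hp, partialTrace_exchange]

end PartialTraces

section DimensionHom

variable {C : Type u} [Category.{v} C] [Preadditive C] [Linear ℂ C]
  [MonoidalCategory C] [MonoidalPreadditive C] [MonoidalLinear ℂ C] [RightRigidCategory C]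
  [CStarTensorCategory C] [RigidCStarTensorCategory C]

theorem dim_tensor (A B : C) : dim (A ⊗ B) = dim A * dim B := by
  obtain ⟨A', p, hp⟩ := exists_isStandard A
  obtain ⟨B', q, hq⟩ := exists_isStandard B
  have trace_id := tensor_trace (A' := A') (B' := B') (𝟙 (A ⊗ B))
  rw [id_whiskerRight, Category.id_comp, (hp.tensor hq).coevaluation_comp_dag,
    rightPartialTrace_id A hq.coevaluation_comp_dag, MonoidalLinear.smul_whiskerRight,
    id_whiskerRight, Linear.smul_comp, Linear.comp_smul, Category.id_comp,
    hp.coevaluation_comp_dag, smul_smul, mul_comm] at trace_id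
  exact_mod_cast irreducible_unit.smul_id_injective trace_id

theorem dim_unit : dim (𝟙_ C) = 1 := by
  have dim_mul_self : dim (𝟙_ C) = dim (𝟙_ C) * dim (𝟙_ C) := by
    rw [← dim_tensor, dim_congr (λ_ (𝟙_ C))]
  exact (mul_eq_left₀ (dim_pos irreducible_unit).ne').1 dim_mul_self.symm

theorem dim_rep_unit : dim (Irr.unit C).rep = 1 :=
  (dim_rep_mk irreducible_unit).trans dim_unit

theorem dim_rep_conj (π : Irr C) : dim π.conj.rep = dim π.rep :=
  (dim_rep_mk _).trans (dim_dual _)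

variable (C) in
/-- The dimension as a unital *-homomorphism on the fusion algebra: the trivial representation,
before completion. -/
noncomputable def dimHom : FusionAlgebra C →⋆ₐ[ℂ] ℂ :=
  let extendDim := FusionAlgebra.extend fun π : Irr C => (dim π.rep : ℂ)
  have extendDim_one : extendDim 1 = 1 := by
    change extendDim (FusionAlgebra.basis (Irr.unit C)) = 1
    rw [FusionAlgebra.extend_basis, dim_rep_unit, Complex.ofReal_one]
  { toFun := extendDim
    map_one' := extendDim_one
    map_mul' := fun x y => by
      induction x using FusionAlgebra.induction_on with
      | h0 => simp
      | hadd x x' h h' => simp only [add_mul, map_add, h, h']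
      | hb c π =>
      induction y using FusionAlgebra.induction_on with
      | h0 => simp
      | hadd x x' h h' => simp only [mul_add, map_add, h, h']
      | hb d ρ =>
      rw [smul_mul_smul_comm, ← FusionAlgebra.of_rep, ← FusionAlgebra.of_rep,
        FusionAlgebra.of_mul_of]
      simp only [extendDim, map_smul, FusionAlgebra.extend_dim_of, dim_tensor, smul_eq_mul]
      push_cast
      ring
    map_zero' := map_zero _
    map_add' := map_add _
    commutes' := fun c => by
      rw [Algebra.algebraMap_eq_smul_one, map_smul, extendDim_one]
      exact mul_one c
    map_star' := fun x => by
      induction x using FusionAlgebra.induction_on with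
      | h0 => simp
      | hadd x x' h h' => simp only [star_add, map_add, h, h']
      | hb c π =>
      rw [star_smul, FusionAlgebra.star_basis, map_smul, map_smul]
      simp [extendDim, FusionAlgebra.extend_basis, dim_rep_conj] }

theorem dimHom_of (X : C) : dimHom C (FusionAlgebra.of X) = dim X :=
  FusionAlgebra.extend_dim_of X

theorem dimHom_basis (π : Irr C) : dimHom C (FusionAlgebra.basis π) = dim π.rep := by
  rw [← FusionAlgebra.of_rep, dimHom_of]

end DimensionHom

/-! ### Multipliers and their symbols -/

section Amplification

section Monoidal

variable {C : Type u} [Category.{v} C] [MonoidalCategory C]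

/-- The morphism `1 ⊗ x ⊗ 1`, bracketed so that it again goes between tensor products of two
objects. This is `amplification` for morphisms that need not be endomorphisms. -/
def ampHom (X₂ Y₂ : C) {X Y Z W : C} (x : Z ⊗ W ⟶ X ⊗ Y) :
    (X₂ ⊗ Z) ⊗ (W ⊗ Y₂) ⟶ (X₂ ⊗ X) ⊗ (Y ⊗ Y₂) :=
  (α_ X₂ Z (W ⊗ Y₂)).hom ≫
    X₂ ◁ ((α_ Z W Y₂).inv ≫ x ▷ Y₂ ≫ (α_ X Y Y₂).hom) ≫ (α_ X₂ X (Y ⊗ Y₂)).inv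

theorem ampHom_comp (X₂ Y₂ : C) {X Y Z W Z' W' : C} (x : Z ⊗ W ⟶ X ⊗ Y) (y : X ⊗ Y ⟶ Z' ⊗ W') :
    ampHom X₂ Y₂ (x ≫ y) = ampHom X₂ Y₂ x ≫ ampHom X₂ Y₂ y := by
  simp [ampHom]

theorem ampHom_tensorHom (X₂ Y₂ : C) {X Y Z W : C} (a : Z ⟶ X) (b : W ⟶ Y) :
    ampHom X₂ Y₂ (a ⊗ₘ b) = (X₂ ◁ a) ⊗ₘ (b ▷ Y₂) := by
  simp [ampHom, MonoidalCategory.tensorHom_def]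

theorem ampHom_naturality {X₂ X₂' Y₂ Y₂' X Y Z W : C} (f : X₂ ⟶ X₂') (g : Y₂ ⟶ Y₂')
    (x : Z ⊗ W ⟶ X ⊗ Y) :
    (f ▷ Z ⊗ₘ W ◁ g) ≫ ampHom X₂' Y₂' x = ampHom X₂ Y₂ x ≫ (f ▷ X ⊗ₘ Y ◁ g) :=
  calc (f ▷ Z ⊗ₘ W ◁ g) ≫ ampHom X₂' Y₂' x
    _ = 𝟙 _ ⊗≫ f ▷ (Z ⊗ W ⊗ Y₂) ⊗≫ X₂' ◁ ((Z ⊗ W) ◁ g ≫ x ▷ Y₂') ⊗≫ 𝟙 _ := by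
      rw [MonoidalCategory.tensorHom_def, ampHom]
      monoidal
    _ = 𝟙 _ ⊗≫ (f ▷ ((Z ⊗ W) ⊗ Y₂) ≫ X₂' ◁ (x ▷ Y₂)) ⊗≫ (X₂' ⊗ X ⊗ Y) ◁ g ⊗≫ 𝟙 _ := by
      rw [whisker_exchange]
      monoidal
    _ = ampHom X₂ Y₂ x ≫ (f ▷ X ⊗ₘ Y ◁ g) := by
      rw [← whisker_exchange, MonoidalCategory.tensorHom_def, ampHom]
      monoidal

theorem ampHom_ampHom (X₃ Y₃ X₂ Y₂ : C) {X Y Z W : C} (x : Z ⊗ W ⟶ X ⊗ Y) :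
    ampHom (X₃ ⊗ X₂) (Y₂ ⊗ Y₃) x = ((α_ X₃ X₂ Z).hom ⊗ₘ (α_ W Y₂ Y₃).inv) ≫
      ampHom X₃ Y₃ (ampHom X₂ Y₂ x) ≫ ((α_ X₃ X₂ X).inv ⊗ₘ (α_ Y Y₂ Y₃).hom) := by
  simp only [MonoidalCategory.tensorHom_def, ampHom]
  monoidal

end Monoidal

variable {C : Type u} [Category.{v} C] [Preadditive C] [Linear ℂ C]
  [MonoidalCategory C] [MonoidalPreadditive C] [MonoidalLinear ℂ C]

/-- `ampHom` as a linear map. -/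
def ampHomₗ (X₂ Y₂ X Y Z W : C) :
    (Z ⊗ W ⟶ X ⊗ Y) →ₗ[ℂ] ((X₂ ⊗ Z) ⊗ (W ⊗ Y₂) ⟶ (X₂ ⊗ X) ⊗ (Y ⊗ Y₂)) where
  toFun := ampHom X₂ Y₂
  map_add' x y := by simp [ampHom]
  map_smul' c x := by simp [ampHom]

theorem ampHom_smul (X₂ Y₂ : C) {X Y Z W : C} (c : ℂ) (x : Z ⊗ W ⟶ X ⊗ Y) :
    ampHom X₂ Y₂ (c • x) = c • ampHom X₂ Y₂ x :=
  (ampHomₗ X₂ Y₂ X Y Z W).map_smul c x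

variable [CStarTensorCategory C]

theorem dag_ampHom (X₂ Y₂ : C) {X Y Z W : C} (x : Z ⊗ W ⟶ X ⊗ Y) :
    dag (ampHom X₂ Y₂ x) = ampHom X₂ Y₂ (dag x) := by
  simp [ampHom, dag_comp, dag_whiskerLeft, dag_whiskerRight, dag_associator, dag_associator_inv]

-- A morphism `Z ⊗ W ⟶ X ⊗ Y` is a corner of an endomorphism of `(X ⊕ Z) ⊗ (Y ⊕ W)`.
theorem extension_ampHom {θ : Multiplier C} (Θ : θ.Extension) (X₂ Y₂ : C) {X Y Z W : C}
    (x : Z ⊗ W ⟶ X ⊗ Y) :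
    Θ.toFun _ _ _ _ (ampHom X₂ Y₂ x) = ampHom X₂ Y₂ (Θ.toFun _ _ _ _ x) := by
  obtain ⟨P, a, c, ha, hc, -⟩ := exists_directSum X Z
  obtain ⟨Q, b, e, hb, he, -⟩ := exists_directSum Y W
  have corner : θ.toFun P Q ((dag c ⊗ₘ dag e) ≫ x ≫ (a ⊗ₘ b)) =
      (dag c ⊗ₘ dag e) ≫ Θ.toFun X Y Z W x ≫ (a ⊗ₘ b) :=
    (Θ.restrict _ _ _).symm.trans (Θ.natural x a b (dag c) (dag e))
  have amplify_corner : (X₂ ◁ dag c ⊗ₘ dag e ▷ Y₂) ≫ Θ.toFun _ _ _ _ (ampHom X₂ Y₂ x) ≫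
        (X₂ ◁ a ⊗ₘ b ▷ Y₂) =
      (X₂ ◁ dag c ⊗ₘ dag e ▷ Y₂) ≫ ampHom X₂ Y₂ (Θ.toFun X Y Z W x) ≫ (X₂ ◁ a ⊗ₘ b ▷ Y₂) := by
    have := θ.amplify X₂ P Q Y₂ ((dag c ⊗ₘ dag e) ≫ x ≫ (a ⊗ₘ b))
    rw [← Θ.restrict, corner] at this
    change Θ.toFun _ _ _ _ (ampHom X₂ Y₂ _) = ampHom X₂ Y₂ _ at this
    simpa only [ampHom_comp, ampHom_tensorHom, Θ.natural] using this
  have isometry_ce : (X₂ ◁ c ⊗ₘ e ▷ Y₂) ≫ (X₂ ◁ dag c ⊗ₘ dag e ▷ Y₂) = 𝟙 _ := by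
    rw [tensorHom_comp_tensorHom, ← MonoidalCategory.whiskerLeft_comp, ← comp_whiskerRight, hc, he]
    simp
  have isometry_ab : (X₂ ◁ a ⊗ₘ b ▷ Y₂) ≫ (X₂ ◁ dag a ⊗ₘ dag b ▷ Y₂) = 𝟙 _ := by
    rw [tensorHom_comp_tensorHom, ← MonoidalCategory.whiskerLeft_comp, ← comp_whiskerRight, ha, hb]
    simp
  simpa only [Category.assoc, isometry_ab, Category.comp_id, reassoc_of% isometry_ce] using
    congrArg (fun f => (X₂ ◁ c ⊗ₘ e ▷ Y₂) ≫ f ≫ (X₂ ◁ dag a ⊗ₘ dag b ▷ Y₂)) amplify_corner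

end Amplification

section InsertEnd

section Monoidal

variable {C : Type u} [Category.{v} C] [MonoidalCategory C] {X' X : C} [ExactPairing X' X]

/-- Inserting an endomorphism `g` of `X' ⊗ Z`, where `X'` is conjugate to `X`, into a morphism
`X ⊗ Y ⟶ Z ⊗ W`: bend the leg `X` to the other side, apply `g`, and bend it back. -/
def insertEnd {Y Z W : C} (g : X' ⊗ Z ⟶ X' ⊗ Z) (x : X ⊗ Y ⟶ Z ⊗ W) : X ⊗ Y ⟶ Z ⊗ W :=
  X ◁ ((λ_ Y).inv ≫ η_ X' X ▷ Y ≫ (α_ X' X Y).hom ≫ X' ◁ x ≫ (α_ X' Z W).inv ≫ g ▷ W) ≫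
    (α_ X (X' ⊗ Z) W).inv ≫ ((α_ X X' Z).inv ≫ ε_ X' X ▷ Z ≫ (λ_ Z).hom) ▷ W

theorem insertEnd_id {Y Z W : C} (x : X ⊗ Y ⟶ Z ⊗ W) : insertEnd (𝟙 (X' ⊗ Z)) x = x :=
  calc insertEnd (𝟙 (X' ⊗ Z)) x
    _ = 𝟙 _ ⊗≫ X ◁ η_ X' X ▷ Y ⊗≫ ((X ⊗ X') ◁ x ≫ ε_ X' X ▷ (Z ⊗ W)) ⊗≫ 𝟙 _ := by
      rw [insertEnd]
      monoidal
    _ = 𝟙 _ ⊗≫ (X ◁ η_ X' X ⊗≫ ε_ X' X ▷ X) ▷ Y ⊗≫ x := by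
      rw [whisker_exchange]
      monoidal
    _ = x := by
      rw [ExactPairing.coevaluation_evaluation'']
      monoidal

-- If `g` factors through `K`, then `g` can be cut at `K`: up to composition with tensor products
-- of morphisms, what remains is the coevaluation of `K`, on which multipliers act by scalars.
theorem insertEnd_factor {Y Z W K K' : C} [ExactPairing K K'] (a : K ⟶ X' ⊗ Z) (a' : X' ⊗ Z ⟶ K)
    (x : X ⊗ Y ⟶ Z ⊗ W) : ∃ (A : X ⊗ K ⟶ Z) (B : K' ⊗ Y ⟶ W), insertEnd (a' ≫ a) x =
      ((ρ_ X).inv ⊗ₘ (λ_ Y).inv) ≫ ampHom X Y ((λ_ (𝟙_ C)).hom ≫ η_ K K') ≫ (A ⊗ₘ B) := by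
  set n : Y ⟶ K ⊗ W :=
    (λ_ Y).inv ≫ η_ X' X ▷ Y ≫ (α_ X' X Y).hom ≫ X' ◁ x ≫ (α_ X' Z W).inv ≫ a' ▷ W with hn
  set A : X ⊗ K ⟶ Z := X ◁ a ≫ (α_ X X' Z).inv ≫ ε_ X' X ▷ Z ≫ (λ_ Z).hom with hA
  set B : K' ⊗ Y ⟶ W := (tensorLeftHomEquiv Y K K' W).symm n
  have n_eq : n = (λ_ Y).inv ≫ η_ K K' ▷ Y ≫ (α_ K K' Y).hom ≫ K ◁ B :=
    ((tensorLeftHomEquiv Y K K' W).apply_symm_apply n).symm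
  refine ⟨A, B, ?_⟩
  calc insertEnd (a' ≫ a) x
    _ = X ◁ n ≫ (α_ X K W).inv ≫ A ▷ W := by
      rw [insertEnd, hn, hA]
      monoidal
    _ = _ := by
      rw [n_eq, MonoidalCategory.tensorHom_def' A B, ampHom, MonoidalCategory.tensorHom_def]
      monoidal

end Monoidal

variable {C : Type u} [Category.{v} C] [Preadditive C] [MonoidalCategory C]
  [MonoidalPreadditive C] {X' X : C} [ExactPairing X' X]

theorem insertEnd_sum {Y Z W : C} {ι : Type*} (s : Finset ι) (g : ι → (X' ⊗ Z ⟶ X' ⊗ Z))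
    (x : X ⊗ Y ⟶ Z ⊗ W) : insertEnd (∑ i ∈ s, g i) x = ∑ i ∈ s, insertEnd (g i) x := by
  simp only [insertEnd, sum_whiskerRight, Preadditive.comp_sum, whiskerLeft_sum,
    Preadditive.sum_comp]

variable [Linear ℂ C] [MonoidalLinear ℂ C]

/-- `insertEnd` as a linear map in the second variable. -/
def insertEndₗ (Y W : C) {Z : C} (g : X' ⊗ Z ⟶ X' ⊗ Z) :
    (X ⊗ Y ⟶ Z ⊗ W) →ₗ[ℂ] (X ⊗ Y ⟶ Z ⊗ W) where
  toFun := insertEnd g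
  map_add' x y := by simp [insertEnd]
  map_smul' c x := by simp [insertEnd]

end InsertEnd

section ExtensionFormula

variable {C : Type u} [Category.{v} C] [Preadditive C] [Linear ℂ C]
  [MonoidalCategory C] [MonoidalPreadditive C] [MonoidalLinear ℂ C] [RightRigidCategory C]
  [CStarTensorCategory C] {θ : Multiplier C}

/-- The extension of a multiplier acts on the morphisms `𝟙 ⊗ 𝟙 ⟶ X ⊗ Xᘁ`, for `X` irreducible,
as multiplication by the value of `φ` at the class of `X`. A multiplier has symbol `φ` if it has an
extension with symbol `φ`. -/
def Multiplier.Extension.HasSymbol (Θ : θ.Extension) (φ : Irr C → ℂ) : Prop :=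
  ∀ (X : C) (hX : IsIrreducible X) (v : 𝟙_ C ⊗ 𝟙_ C ⟶ X ⊗ Xᘁ),
    Θ.toFun X (Xᘁ) (𝟙_ C) (𝟙_ C) v = φ (Irr.mk X hX) • v

theorem extension_insertEnd {φ : Irr C → ℂ} {Θ : θ.Extension} (hΘ : Θ.HasSymbol φ)
    {X' X Y Z W K : C} [ExactPairing X' X] (hK : IsIrreducible K) (a : K ⟶ X' ⊗ Z)
    (a' : X' ⊗ Z ⟶ K) (x : X ⊗ Y ⟶ Z ⊗ W) :
    Θ.toFun _ _ _ _ (insertEnd (a' ≫ a) x) = φ (Irr.mk K hK) • insertEnd (a' ≫ a) x := by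
  obtain ⟨A, B, h⟩ := insertEnd_factor (K' := Kᘁ) a a' x
  rw [h, Θ.natural, extension_ampHom, hΘ K hK, ampHom_smul, Linear.smul_comp, Linear.comp_smul]

theorem extension_eq_sum {φ : Irr C → ℂ} {Θ : θ.Extension} (hΘ : Θ.HasSymbol φ) {X' X Y Z W : C}
    [ExactPairing X' X] {n : ℕ} {K : Fin n → C} (hK : ∀ i, IsIrreducible (K i))
    {a : ∀ i, K i ⟶ X' ⊗ Z} (h : IsOrthSum (X' ⊗ Z) K a) (x : X ⊗ Y ⟶ Z ⊗ W) :
    Θ.toFun _ _ _ _ x = ∑ i, φ (Irr.mk (K i) (hK i)) • insertEnd (dag (a i) ≫ a i) x := by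
  conv_lhs => rw [← insertEnd_id (X' := X') x, ← h.2.2, insertEnd_sum, map_sum]
  exact Finset.sum_congr rfl fun i _ => extension_insertEnd hΘ (hK i) _ _ x

variable [RigidCStarTensorCategory C]

theorem exists_extension_formula (X Y Z W : C) : ∃ (n : ℕ) (π : Fin n → Irr C)
    (T : Fin n → (Z ⊗ W ⟶ X ⊗ Y) →ₗ[ℂ] (Z ⊗ W ⟶ X ⊗ Y)),
    ∀ (θ : Multiplier C) (φ : Irr C → ℂ) (Θ : θ.Extension), Θ.HasSymbol φ →
      Θ.toFun X Y Z W = ∑ i, φ (π i) • T i := by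
  let _ : ExactPairing (Zᘁ) Z := dualPairing HasRightDual.exact
  obtain ⟨n, K, a, hK, h⟩ := exists_irreducible_orthSum (Zᘁ ⊗ X)
  exact ⟨n, fun i => Irr.mk (K i) (hK i), fun i => insertEndₗ W Y (dag (a i) ≫ a i),
    fun θ φ Θ hΘ => LinearMap.ext fun x => (extension_eq_sum hΘ hK h x).trans (by simp; rfl)⟩

/-- The action, on the morphisms `Z ⊗ W ⟶ X ⊗ Y`, of the multiplier with symbol `φ`. -/
noncomputable def symbolMap (φ : Irr C → ℂ) (X Y Z W : C) :
    (Z ⊗ W ⟶ X ⊗ Y) →ₗ[ℂ] (Z ⊗ W ⟶ X ⊗ Y) :=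
  ∑ i, φ ((exists_extension_formula X Y Z W).choose_spec.choose i) •
    (exists_extension_formula X Y Z W).choose_spec.choose_spec.choose i

theorem Multiplier.Extension.HasSymbol.toFun_eq {φ : Irr C → ℂ} {Θ : θ.Extension}
    (hΘ : Θ.HasSymbol φ) (X Y Z W : C) : Θ.toFun X Y Z W = symbolMap φ X Y Z W :=
  (exists_extension_formula X Y Z W).choose_spec.choose_spec.choose_spec θ φ Θ hΘ

variable {ι : Type*} {l : Filter ι} {φ : ι → Irr C → ℂ} {ψ : Irr C → ℂ}

theorem tendsto_symbolMap {X Y Z W : C} {H : Type*} [AddCommMonoid H] [Module ℂ H]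
    [TopologicalSpace H] [ContinuousAdd H] [ContinuousSMul ℂ H]
    (h : ∀ π, Filter.Tendsto (fun i => φ i π) l (nhds (ψ π)))
    (A : (Z ⊗ W ⟶ X ⊗ Y) →ₗ[ℂ] H) (x : Z ⊗ W ⟶ X ⊗ Y) :
    Filter.Tendsto (fun i => A (symbolMap (φ i) X Y Z W x)) l
      (nhds (A (symbolMap ψ X Y Z W x))) := by
  simp only [symbolMap, LinearMap.sum_apply, LinearMap.smul_apply, map_sum, map_smul]
  exact tendsto_finsetSum _ fun k _ => (h _).smul_const _

theorem eq_of_forall_dual_tendsto [l.NeBot] {H : Type*} [AddCommGroup H] [Module ℂ H] {g : ι → H}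
    {x y : H} (hx : ∀ f : Module.Dual ℂ H, Filter.Tendsto (fun i => f (g i)) l (nhds (f x)))
    (hy : ∀ f : Module.Dual ℂ H, Filter.Tendsto (fun i => f (g i)) l (nhds (f y))) : x = y := by
  refine sub_eq_zero.1 ((Module.forall_dual_apply_eq_zero_iff ℂ _).1 fun f => ?_)
  rw [map_sub, tendsto_nhds_unique (hx f) (hy f), sub_self]

theorem symbolMap_eq_of_tendsto [l.NeBot] {X Y Z W X' Y' Z' W' : C} {H : Type*} [AddCommGroup H]
    [Module ℂ H] (h : ∀ π, Filter.Tendsto (fun i => φ i π) l (nhds (ψ π)))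
    (A : (Z ⊗ W ⟶ X ⊗ Y) →ₗ[ℂ] H) (B : (Z' ⊗ W' ⟶ X' ⊗ Y') →ₗ[ℂ] H) {x : Z ⊗ W ⟶ X ⊗ Y}
    {y : Z' ⊗ W' ⟶ X' ⊗ Y'}
    (hAB : ∀ i, A (symbolMap (φ i) X Y Z W x) = B (symbolMap (φ i) X' Y' Z' W' y)) :
    A (symbolMap ψ X Y Z W x) = B (symbolMap ψ X' Y' Z' W' y) :=
  eq_of_forall_dual_tendsto (fun f => tendsto_symbolMap h (f ∘ₗ A) x) fun f =>
    (tendsto_symbolMap h (f ∘ₗ B) y).congr fun i => congrArg f (hAB i).symm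

theorem exists_hasSymbol_of_tendsto [l.NeBot] {θ : ι → Multiplier C} {Θ : ∀ i, (θ i).Extension}
    (hΘ : ∀ i, (Θ i).HasSymbol (φ i))
    (h : ∀ π, Filter.Tendsto (fun i => φ i π) l (nhds (ψ π))) :
    ∃ (θ' : Multiplier C) (Θ' : θ'.Extension), Θ'.HasSymbol ψ := by
  have toFun_eq (i) (X Y Z W : C) (x : Z ⊗ W ⟶ X ⊗ Y) :
      (Θ i).toFun X Y Z W x = symbolMap (φ i) X Y Z W x := by rw [(hΘ i).toFun_eq]
  have natural {X₁ Y₁ Z₁ W₁ X₂ Y₂ Z₂ W₂ : C} (x : Z₁ ⊗ W₁ ⟶ X₁ ⊗ Y₁) (a : X₁ ⟶ X₂)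
      (b : Y₁ ⟶ Y₂) (a' : Z₂ ⟶ Z₁) (b' : W₂ ⟶ W₁) :
      symbolMap ψ X₂ Y₂ Z₂ W₂ ((a' ⊗ₘ b') ≫ x ≫ (a ⊗ₘ b)) =
        (a' ⊗ₘ b') ≫ symbolMap ψ X₁ Y₁ Z₁ W₁ x ≫ (a ⊗ₘ b) :=
    symbolMap_eq_of_tendsto h LinearMap.id
      (Linear.leftComp ℂ _ (a' ⊗ₘ b') ∘ₗ Linear.rightComp ℂ _ (a ⊗ₘ b)) fun i => by
        simp only [← toFun_eq]
        exact (Θ i).natural x a b a' b'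
  have amplify (X₂ X₁ Y₁ Y₂ : C) (x : X₁ ⊗ Y₁ ⟶ X₁ ⊗ Y₁) :
      symbolMap ψ _ _ _ _ (ampHom X₂ Y₂ x) = ampHom X₂ Y₂ (symbolMap ψ X₁ Y₁ X₁ Y₁ x) :=
    symbolMap_eq_of_tendsto h LinearMap.id (ampHomₗ X₂ Y₂ X₁ Y₁ X₁ Y₁) fun i => by
      simp only [← toFun_eq]
      exact extension_ampHom (Θ i) X₂ Y₂ x
  refine ⟨⟨fun X Y => symbolMap ψ X Y X Y, natural, amplify⟩,
    ⟨symbolMap ψ, natural, fun X Y x => rfl⟩, fun X hX v => ?_⟩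
  refine eq_of_forall_dual_tendsto (fun f => tendsto_symbolMap h f v) fun f => ?_
  simp only [← toFun_eq, fun i => hΘ i X hX v, map_smul]
  exact (h _).smul_const _

end ExtensionFormula

section Positivity

theorem exists_eq_star_mul_self {A : Type*} [CStarAlgebra A] [PartialOrder A] [StarOrderedRing A]
    {x : A} (hx : 0 ≤ x) : ∃ y, x = star y * y :=
  CStarAlgebra.nonneg_iff_eq_star_mul_self.1 hx

variable {C : Type u} [Category.{v} C] [Preadditive C] [Linear ℂ C]
  [MonoidalCategory C] [MonoidalPreadditive C] [MonoidalLinear ℂ C] [CStarTensorCategory C]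

theorem comp_dag_nonneg {X Y : C} (f : X ⟶ Y) : (0 : End X) ≤ f ≫ dag f := by
  obtain ⟨g, hg⟩ := exists_comp_dag_eq f
  rw [hg]
  exact star_mul_self_nonneg (R := End X) g

theorem exists_eq_comp_dag {X : C} {x : X ⟶ X} (hx : (0 : End X) ≤ x) :
    ∃ g : X ⟶ X, x = g ≫ dag g :=
  exists_eq_star_mul_self (A := End X) hx

theorem compression_nonneg {X Y : C} (h : Y ⟶ X) {x : X ⟶ X} (hx : (0 : End X) ≤ x) :
    (0 : End Y) ≤ h ≫ x ≫ dag h := by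
  obtain ⟨g, rfl⟩ := exists_eq_comp_dag hx
  simpa only [dag_comp, Category.assoc] using comp_dag_nonneg (h ≫ g)

theorem IsOrthSum.whiskerLeft {n : ℕ} {V : C} {W : Fin n → C} {a : ∀ i, W i ⟶ V}
    (h : IsOrthSum V W a) (Z : C) : IsOrthSum (Z ⊗ V) (fun i => Z ⊗ W i) fun i => Z ◁ a i := by
  simpa only [IsOrthSum, dag_whiskerLeft] using IsDirectSum.whiskerLeft h Z

/-- The endomorphism of `V` given by a matrix over `End U` and morphisms `b i : U ⟶ V`. If these
exhibit `V` as an orthogonal sum of copies of `U`, then it is the endomorphism whose matrix is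
`M`. -/
def ofMatrix {k : ℕ} {U V : C} (b : Fin k → (U ⟶ V))
    (M : CStarMatrix (Fin k) (Fin k) (End U)) : V ⟶ V :=
  ∑ i, ∑ j, dag (b j) ≫ M i j ≫ b i

theorem ofMatrix_nonneg {k : ℕ} {U V : C} (b : Fin k → (U ⟶ V))
    {M : CStarMatrix (Fin k) (Fin k) (End U)} (hM : 0 ≤ M) : (0 : End V) ≤ ofMatrix b M := by
  obtain ⟨N, hN⟩ := exists_eq_star_mul_self hM
  have entry (i j) : M i j = ∑ l, (show U ⟶ U from N l j) ≫ dag (show U ⟶ U from N l i) := by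
    rw [hN, CStarMatrix.mul_apply]
    rfl
  have sum_of_squares : ofMatrix b M =
      ∑ l, (∑ j, dag (b j) ≫ N l j) ≫ dag (∑ j, dag (b j) ≫ N l j) := by
    simp only [ofMatrix, entry, dag_sum, Preadditive.sum_comp, Preadditive.comp_sum, dag_comp,
      dag_dag, Category.assoc]
    rw [Finset.sum_comm_cycle]
  rw [sum_of_squares]
  exact Finset.sum_nonneg fun l _ => comp_dag_nonneg _

theorem comp_ofMatrix_comp_dag {k : ℕ} {U V : C} {b : Fin k → (U ⟶ V)}
    (hb : IsOrthSum V (fun _ => U) b) (M : CStarMatrix (Fin k) (Fin k) (End U)) (i j : Fin k) :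
    b j ≫ ofMatrix b M ≫ dag (b i) = M i j := by
  simp only [ofMatrix, Preadditive.sum_comp, Preadditive.comp_sum, Category.assoc]
  rw [Finset.sum_eq_single_of_mem i (Finset.mem_univ i),
    Finset.sum_eq_single_of_mem j (Finset.mem_univ j), reassoc_of% hb.1 j, hb.1 i,
    Category.comp_id]
  · intro j' _ hj'
    rw [reassoc_of% hb.2.1 j j' hj'.symm, Limits.zero_comp]
  · intro i' _ hi'
    simp only [hb.2.1 i' i hi', Limits.comp_zero, Finset.sum_const_zero]

theorem matrix_of_nonneg {k : ℕ} {U V : C} {b : Fin k → (U ⟶ V)}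
    (hb : IsOrthSum V (fun _ => U) b) {x : V ⟶ V} (hx : (0 : End V) ≤ x) :
    (0 : CStarMatrix (Fin k) (Fin k) (End U)) ≤
      CStarMatrix.ofMatrix fun i j => b j ≫ x ≫ dag (b i) := by
  obtain ⟨g, rfl⟩ := exists_eq_comp_dag hx
  let P : CStarMatrix (Fin k) (Fin k) (End U) :=
    CStarMatrix.ofMatrix fun l j => b j ≫ g ≫ dag (b l)
  have eq_star_mul : CStarMatrix.ofMatrix (fun i j => b j ≫ (g ≫ dag g) ≫ dag (b i)) =
      star P * P := by
    ext i j
    rw [CStarMatrix.mul_apply]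
    change b j ≫ (g ≫ dag g) ≫ dag (b i) =
      ∑ l, (b j ≫ g ≫ dag (b l)) ≫ dag (b i ≫ g ≫ dag (b l))
    calc b j ≫ (g ≫ dag g) ≫ dag (b i)
      _ = b j ≫ g ≫ (∑ l, dag (b l) ≫ b l) ≫ dag g ≫ dag (b i) := by
        rw [hb.2.2, Category.id_comp, Category.assoc]
      _ = _ := by
        simp only [dag_comp, dag_dag, Preadditive.sum_comp, Preadditive.comp_sum, Category.assoc]
  rw [eq_star_mul]
  exact star_mul_self_nonneg P

theorem Multiplier.IsPositiveType.map_nonneg {θ : Multiplier C} (hθ : θ.IsPositiveType) {X Y : C}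
    {x : X ⊗ Y ⟶ X ⊗ Y} (hx : (0 : End (X ⊗ Y)) ≤ x) : 0 ≤ θ.toFun X Y x := by
  obtain ⟨T, hT⟩ := hθ X Y
  rw [← hT]
  exact _root_.map_nonneg T hx

-- A matrix over `End (X ⊗ Y)` is an endomorphism of the tensor product of `X` with a direct sum of
-- copies of `Y`, so positivity of all the maps of a multiplier already gives complete positivity.
theorem Multiplier.isPositiveType_of_nonneg {θ : Multiplier C}
    (h : ∀ (X Y : C) (x : X ⊗ Y ⟶ X ⊗ Y), (0 : End (X ⊗ Y)) ≤ x → 0 ≤ θ.toFun X Y x) :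
    θ.IsPositiveType := by
  intro X Y
  refine ⟨⟨θ.toFun X Y, fun k M hM => ?_⟩, rfl⟩
  cases k with
  | zero => exact (CStarMatrix.ext fun i => i.elim0 : (0 : CStarMatrix (Fin 0) (Fin 0) _) = _).le
  | succ k =>
    obtain ⟨V, b, hb⟩ := exists_orthSum k fun _ => Y
    have hXb : IsOrthSum (X ⊗ V) (fun _ => X ⊗ Y) fun i => X ◁ b i := hb.whiskerLeft X
    have toFun_ofMatrix : θ.toFun X V (ofMatrix (fun i => X ◁ b i) M) =
        ofMatrix (fun i => X ◁ b i) (M.map (θ.toFun X Y)) := by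
      refine (map_sum (θ.toFun X V) _ _).trans (Finset.sum_congr rfl fun i _ => ?_)
      refine (map_sum (θ.toFun X V) _ _).trans (Finset.sum_congr rfl fun j _ => ?_)
      beta_reduce
      rw [dag_whiskerLeft, ← id_tensorHom, ← id_tensorHom]
      exact θ.natural (M i j) (𝟙 X) (b i) (𝟙 X) (dag (b j))
    have matrix_eq : M.map (θ.toFun X Y) = CStarMatrix.ofMatrix fun i j =>
        X ◁ b j ≫ θ.toFun X V (ofMatrix (fun i => X ◁ b i) M) ≫ dag (X ◁ b i) := by
      ext i j
      rw [toFun_ofMatrix]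
      exact (comp_ofMatrix_comp_dag hXb _ i j).symm
    rw [matrix_eq]
    exact matrix_of_nonneg hXb (h X V _ (ofMatrix_nonneg _ hM))

theorem IsCPMultiplier.of_tendsto [RightRigidCategory C] [RigidCStarTensorCategory C] {ι : Type*}
    {l : Filter ι} [l.NeBot] {φ : ι → Irr C → ℂ} {ψ : Irr C → ℂ}
    (h : ∀ π, Filter.Tendsto (fun i => φ i π) l (nhds (ψ π)))
    (hφ : ∀ i, IsCPMultiplier (φ i)) : IsCPMultiplier ψ := by
  choose θ hθ Θ hΘ using hφ
  have hΘ (i) : (Θ i).HasSymbol (φ i) := hΘ i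
  obtain ⟨θ', Θ', hΘ'⟩ := exists_hasSymbol_of_tendsto hΘ h
  have hΘ' : Θ'.HasSymbol ψ := hΘ'
  refine ⟨θ', Multiplier.isPositiveType_of_nonneg fun X Y x hx => ?_, Θ', hΘ'⟩
  have toFun_tendsto : Filter.Tendsto (fun i => (θ i).toFun X Y x) l (nhds (θ'.toFun X Y x)) := by
    simp only [← (Θ _).restrict, ← Θ'.restrict, (hΘ _).toFun_eq, hΘ'.toFun_eq]
    exact tendsto_symbolMap h (LinearMap.id : End (X ⊗ Y) →ₗ[ℂ] End (X ⊗ Y)) x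
  exact ge_of_tendsto' toFun_tendsto fun i => (hθ i).map_nonneg hx

end Positivity

section InsertPair

section Monoidal

variable {C : Type u} [Category.{v} C] [MonoidalCategory C]

/-- The morphism `1 ⊗ s ⊗ 1`, bracketed so that it again goes between tensor products of two
objects. -/
def insertPair (X Y : C) {V V' : C} (s : 𝟙_ C ⟶ V ⊗ V') : X ⊗ Y ⟶ (X ⊗ V) ⊗ (V' ⊗ Y) :=
  ((ρ_ X).inv ⊗ₘ (λ_ Y).inv) ≫ ampHom X Y ((λ_ (𝟙_ C)).hom ≫ s)

theorem insertPair_naturality {X X' Y Y' V V' : C} (a : X ⟶ X') (b : Y ⟶ Y')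
    (s : 𝟙_ C ⟶ V ⊗ V') :
    (a ⊗ₘ b) ≫ insertPair X' Y' s = insertPair X Y s ≫ (a ▷ V ⊗ₘ V' ◁ b) := by
  rw [insertPair, insertPair, Category.assoc, ← ampHom_naturality,
    tensorHom_comp_tensorHom_assoc, tensorHom_comp_tensorHom_assoc, rightUnitor_inv_naturality,
    leftUnitor_inv_naturality]

theorem insertPair_comp_tensorHom (X Y : C) {V V' W W' : C} (s : 𝟙_ C ⟶ V ⊗ V') (c : V ⟶ W)
    (d : V' ⟶ W') :
    insertPair X Y (s ≫ (c ⊗ₘ d)) = insertPair X Y s ≫ (X ◁ c ⊗ₘ d ▷ Y) := by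
  rw [insertPair, insertPair, ← Category.assoc (λ_ (𝟙_ C)).hom, ampHom_comp, ampHom_tensorHom,
    Category.assoc]

theorem insertPair_tensor (X₂ X₁ Y₁ Y₂ : C) {V V' : C} (s : 𝟙_ C ⟶ V ⊗ V') :
    insertPair (X₂ ⊗ X₁) (Y₁ ⊗ Y₂) s = ampHom X₂ Y₂ (insertPair X₁ Y₁ s) ≫
      ((α_ X₂ X₁ V).inv ⊗ₘ (α_ V' Y₁ Y₂).hom) := by
  rw [insertPair, insertPair, ampHom_comp, ampHom_tensorHom, ampHom_ampHom, Category.assoc,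
    tensorHom_comp_tensorHom_assoc]
  congr 2 <;> monoidal

theorem insertPair_unit {V V' : C} (s : 𝟙_ C ⟶ V ⊗ V') :
    insertPair (𝟙_ C) (𝟙_ C) s = (λ_ (𝟙_ C)).hom ≫ s ≫ ((λ_ V).inv ⊗ₘ (ρ_ V').inv) := by
  simp only [insertPair, ampHom, MonoidalCategory.tensorHom_def]
  monoidal

theorem coevaluation_comp_insertPair {X X' W W' : C} [ExactPairing X X'] [ExactPairing W W'] :
    η_ X X' ≫ insertPair X X' (η_ W W') = η_ (X ⊗ W) (W' ⊗ X') := by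
  simp only [tensor_coevaluation_eq, insertPair, ampHom, MonoidalCategory.tensorHom_def]
  monoidal

end Monoidal

variable {C : Type u} [Category.{v} C] [Preadditive C] [Linear ℂ C]
  [MonoidalCategory C] [MonoidalPreadditive C] [MonoidalLinear ℂ C]

/-- `insertPair` as a linear map. -/
def insertPairₗ (X Y V V' : C) : (𝟙_ C ⟶ V ⊗ V') →ₗ[ℂ] (X ⊗ Y ⟶ (X ⊗ V) ⊗ (V' ⊗ Y)) :=
  Linear.leftComp ℂ _ ((ρ_ X).inv ⊗ₘ (λ_ Y).inv) ∘ₗ ampHomₗ X Y V V' (𝟙_ C) (𝟙_ C) ∘ₗ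
    Linear.leftComp ℂ _ (λ_ (𝟙_ C)).hom

theorem insertPair_sum_smul (X Y : C) {V V' : C} {ι : Type*} (t : Finset ι) (c : ι → ℂ)
    (s : ι → (𝟙_ C ⟶ V ⊗ V')) :
    insertPair X Y (∑ i ∈ t, c i • s i) = ∑ i ∈ t, c i • insertPair X Y (s i) := by
  change insertPairₗ X Y V V' (∑ i ∈ t, c i • s i) = ∑ i ∈ t, c i • insertPairₗ X Y V V' (s i)
  simp only [map_sum, map_smul]

variable [CStarTensorCategory C]

theorem dag_insertPair_naturality {X X' Y Y' V V' : C} (a : X ⟶ X') (b : Y ⟶ Y')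
    (s : 𝟙_ C ⟶ V ⊗ V') :
    dag (insertPair X Y s) ≫ (a ⊗ₘ b) = (a ▷ V ⊗ₘ V' ◁ b) ≫ dag (insertPair X' Y' s) := by
  have h := congrArg dag (insertPair_naturality (dag a) (dag b) s)
  simpa only [dag_comp, dag_tensor, dag_dag, dag_whiskerLeft, dag_whiskerRight] using h

variable {n : ℕ} {U U' : C} {V V' : Fin n → C} {a : ∀ i, V i ⟶ U} {a' : ∀ i, V' i ⟶ U'}

theorem insertPair_sum_comp_dag (h : IsOrthSum U V a) (h' : IsOrthSum U' V' a')
    (s : ∀ i, 𝟙_ C ⟶ V i ⊗ V' i) (X Y : C) (i : Fin n) :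
    insertPair X Y (∑ i, s i ≫ (a i ⊗ₘ a' i)) ≫ (X ◁ dag (a i) ⊗ₘ dag (a' i) ▷ Y) =
      insertPair X Y (s i) := by
  rw [← insertPair_comp_tensorHom, Preadditive.sum_comp,
    Finset.sum_eq_single_of_mem i (Finset.mem_univ i)]
  · rw [Category.assoc, tensorHom_comp_tensorHom, h.1, h'.1, id_tensorHom_id, Category.comp_id]
  · intro j _ hji
    rw [Category.assoc, tensorHom_comp_tensorHom, h.2.1 j i hji, MonoidalPreadditive.zero_tensor,
      Limits.comp_zero]

end InsertPair

section Compression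

variable {C : Type u} [Category.{v} C] [Preadditive C] [Linear ℂ C]
  [MonoidalCategory C] [MonoidalPreadditive C] [MonoidalLinear ℂ C] [CStarTensorCategory C]
  {θ : Multiplier C} (Θ : θ.Extension) {V V' : C} (u v : 𝟙_ C ⟶ V ⊗ V')

namespace Multiplier.Extension

/-- The compression `x ↦ (1 ⊗ u ⊗ 1)* Θ((1 ⊗ v ⊗ 1) x (1 ⊗ v ⊗ 1)*) (1 ⊗ u ⊗ 1)` of a multiplier
by morphisms `u, v : 𝟙 ⟶ V ⊗ V'`. On the side of the fusion algebra it corresponds to replacing a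
functional `ω` by `y ↦ ω (x* y x)`. -/
def compressMap (X Y Z W : C) : (Z ⊗ W ⟶ X ⊗ Y) →ₗ[ℂ] (Z ⊗ W ⟶ X ⊗ Y) where
  toFun x := insertPair Z W u ≫ Θ.toFun _ _ _ _
    (dag (insertPair Z W v) ≫ x ≫ insertPair X Y v) ≫ dag (insertPair X Y u)
  map_add' x y := by simp
  map_smul' c x := by simp

theorem compressMap_apply (X Y Z W : C) (x : Z ⊗ W ⟶ X ⊗ Y) :
    Θ.compressMap u v X Y Z W x = insertPair Z W u ≫ Θ.toFun _ _ _ _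
      (dag (insertPair Z W v) ≫ x ≫ insertPair X Y v) ≫ dag (insertPair X Y u) := rfl

theorem compressMap_naturality {X₁ Y₁ Z₁ W₁ X₂ Y₂ Z₂ W₂ : C} (x : Z₁ ⊗ W₁ ⟶ X₁ ⊗ Y₁)
    (a : X₁ ⟶ X₂) (b : Y₁ ⟶ Y₂) (a' : Z₂ ⟶ Z₁) (b' : W₂ ⟶ W₁) :
    Θ.compressMap u v X₂ Y₂ Z₂ W₂ ((a' ⊗ₘ b') ≫ x ≫ (a ⊗ₘ b)) =
      (a' ⊗ₘ b') ≫ Θ.compressMap u v X₁ Y₁ Z₁ W₁ x ≫ (a ⊗ₘ b) := by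
  have natural := Θ.natural (dag (insertPair Z₁ W₁ v) ≫ x ≫ insertPair X₁ Y₁ v) (a ▷ V) (V' ◁ b)
    (a' ▷ V) (V' ◁ b')
  simp only [Category.assoc] at natural
  simp only [compressMap_apply, Category.assoc]
  rw [reassoc_of% dag_insertPair_naturality a' b' v, insertPair_naturality a b v,
    dag_insertPair_naturality a b u, reassoc_of% insertPair_naturality a' b' u, natural]
  simp only [Category.assoc]

theorem compressMap_ampHom (X₂ Y₂ : C) {X Y Z W : C} (x : Z ⊗ W ⟶ X ⊗ Y) :
    Θ.compressMap u v _ _ _ _ (ampHom X₂ Y₂ x) =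
      ampHom X₂ Y₂ (Θ.compressMap u v X Y Z W x) := by
  have natural := Θ.natural (ampHom X₂ Y₂ (dag (insertPair Z W v) ≫ x ≫ insertPair X Y v))
    (α_ X₂ X V).inv (α_ V' Y Y₂).hom (α_ X₂ Z V).hom (α_ V' W Y₂).inv
  rw [extension_ampHom] at natural
  simp only [ampHom_comp, Category.assoc] at natural
  have associators_cancel (X Y : C) :
      ((α_ X₂ X V).inv ⊗ₘ (α_ V' Y Y₂).hom) ≫ ((α_ X₂ X V).hom ⊗ₘ (α_ V' Y Y₂).inv) = 𝟙 _ := by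
    rw [tensorHom_comp_tensorHom, Iso.inv_hom_id, Iso.hom_inv_id, id_tensorHom_id]
  simp only [compressMap_apply, insertPair_tensor, dag_comp, dag_tensor, dag_associator,
    dag_associator_inv, dag_ampHom, Category.assoc, ampHom_comp, natural,
    reassoc_of% associators_cancel]

/-- The multiplier given by the maps `compressMap`. -/
def compress : Multiplier C where
  toFun X Y := Θ.compressMap u v X Y X Y
  natural x a b a' b' := Θ.compressMap_naturality u v x a b a' b'
  amplify X₂ _ _ Y₂ x := Θ.compressMap_ampHom u v X₂ Y₂ x

/-- The extension of the multiplier `compress`. -/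
def compressExtension : (Θ.compress u v).Extension where
  toFun := Θ.compressMap u v
  natural x a b a' b' := Θ.compressMap_naturality u v x a b a' b'
  restrict _ _ _ := rfl

theorem isPositiveType_compress (hθ : θ.IsPositiveType) : (Θ.compress u v).IsPositiveType := by
  refine Multiplier.isPositiveType_of_nonneg fun X Y x hx => compression_nonneg _ ?_
  rw [Θ.restrict]
  refine hθ.map_nonneg ?_
  simpa only [dag_dag] using compression_nonneg (dag (insertPair X Y v)) hx

theorem compressMap_sum {n : ℕ} {U U' : C} {V V' : Fin n → C} {a : ∀ i, V i ⟶ U}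
    {a' : ∀ i, V' i ⟶ U'} (h : IsOrthSum U V a) (h' : IsOrthSum U' V' a')
    (s : ∀ i, 𝟙_ C ⟶ V i ⊗ V' i) (c : Fin n → ℂ) {X Y Z W : C} (x : Z ⊗ W ⟶ X ⊗ Y) :
    Θ.compressMap (∑ i, s i ≫ (a i ⊗ₘ a' i)) (∑ i, c i • s i ≫ (a i ⊗ₘ a' i)) X Y Z W x =
      ∑ i, ∑ j, (star (c i) * c j) • insertPair Z W (s i) ≫ Θ.toFun _ _ _ _
        (dag (insertPair Z W (s i)) ≫ x ≫ insertPair X Y (s j)) ≫ dag (insertPair X Y (s j)) := by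
  have comp_dag_insertPair_sum (i) : (X ◁ a i ⊗ₘ a' i ▷ Y) ≫
      dag (insertPair X Y (∑ i, s i ≫ (a i ⊗ₘ a' i))) = dag (insertPair X Y (s i)) := by
    have := congrArg dag (insertPair_sum_comp_dag h h' s X Y i)
    simpa only [dag_comp, dag_tensor, dag_whiskerLeft, dag_whiskerRight, dag_dag] using this
  rw [compressMap_apply]
  simp only [insertPair_sum_smul _ _ _ c, insertPair_comp_tensorHom, dag_sum, dag_smul, dag_comp,
    dag_tensor, dag_whiskerLeft, dag_whiskerRight, Preadditive.sum_comp, Preadditive.comp_sum,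
    Linear.smul_comp, Linear.comp_smul, Finset.smul_sum, smul_smul, map_sum, map_smul]
  rw [Finset.sum_comm]
  refine Finset.sum_congr rfl fun i _ => Finset.sum_congr rfl fun j _ => ?_
  have natural := Θ.natural (dag (insertPair Z W (s i)) ≫ x ≫ insertPair X Y (s j))
    (X ◁ a j) (a' j ▷ Y) (Z ◁ dag (a i)) (dag (a' i) ▷ W)
  simp only [Category.assoc] at natural ⊢
  rw [natural, mul_comm]
  simp only [Category.assoc, comp_dag_insertPair_sum, reassoc_of% insertPair_sum_comp_dag h h' s]

end Multiplier.Extension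

end Compression

section CompressionSymbol

section

variable {C : Type u} [Category.{v} C] [Preadditive C] [Linear ℂ C]
  [MonoidalCategory C] [MonoidalPreadditive C] [MonoidalLinear ℂ C]

theorem exists_eq_smul_coevaluation {X X' : C} (hX : IsIrreducible X) (r : ExactPairing X X')
    (h : 𝟙_ C ⟶ X ⊗ X') : ∃ c : ℂ, h = c • η_ X X' := by
  obtain ⟨c, hc⟩ := hX.2 ((λ_ X).inv ≫ (tensorRightHomEquiv (𝟙_ C) X X' X).symm h)
  refine ⟨c, (tensorRightHomEquiv (𝟙_ C) X X' X).symm.injective ?_⟩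
  have smul_eq : c • η_ X X' = η_ X X' ≫ (c • 𝟙 X) ▷ X' := by simp
  rw [smul_eq, tensorRightHomEquiv_symm_coevaluation_comp_whiskerRight, ← hc]
  simp

variable [CStarTensorCategory C]

theorem coevaluation_comp_insertEnd {V V' B B' : C} (p : ExactPairing V V')
    (e : V' ⊗ B ⟶ V' ⊗ B) (R : 𝟙_ C ⟶ B ⊗ B') :
    letI := dualPairing p
    η_ V V' ≫ insertEnd (X' := V') e (dag (η_ V V') ≫ R) =
      R ≫ leftPartialTrace (dag (η_ V V')) e ▷ B' := by
  let _ := dualPairing p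
  have zigzag : η_ V' V ▷ V' ⊗≫ V' ◁ dag (η_ V V') = ⊗𝟙.hom :=
    ExactPairing.evaluation_coevaluation'' V' V
  have dual_evaluation : ε_ V' V = dag (η_ V V') := rfl
  calc η_ V V' ≫ insertEnd (X' := V') e (dag (η_ V V') ≫ R)
    _ = η_ V V' ⊗≫ V ◁ (η_ V' V ▷ V' ⊗≫ V' ◁ dag (η_ V V')) ⊗≫ (V ⊗ V') ◁ R ⊗≫
          V ◁ e ▷ B' ⊗≫ dag (η_ V V') ▷ (B ⊗ B') ⊗≫ 𝟙 _ := by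
      rw [insertEnd, dual_evaluation]
      monoidal
    _ = 𝟙 _ ⊗≫ (η_ V V' ▷ 𝟙_ C ≫ (V ⊗ V') ◁ R) ⊗≫ V ◁ e ▷ B' ⊗≫
          dag (η_ V V') ▷ (B ⊗ B') ⊗≫ 𝟙 _ := by
      rw [zigzag]
      monoidal
    _ = _ := by
      rw [← whisker_exchange, leftPartialTrace, dag_dag]
      monoidal

end

variable {C : Type u} [Category.{v} C] [Preadditive C] [Linear ℂ C]
  [MonoidalCategory C] [MonoidalPreadditive C] [MonoidalLinear ℂ C] [RightRigidCategory C]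
  {θ : Multiplier C} {Θ : θ.Extension} {φ : Irr C → ℂ}

theorem Multiplier.Extension.hasSymbol_of_coevaluation
    (h : ∀ (X : C) (hX : IsIrreducible X), ∃ (X' : C) (_ : ExactPairing X X'),
      Θ.toFun X X' (𝟙_ C) (𝟙_ C) ((λ_ (𝟙_ C)).hom ≫ η_ X X') =
        φ (Irr.mk X hX) • ((λ_ (𝟙_ C)).hom ≫ η_ X X')) :
    Θ.HasSymbol φ := by
  intro X hX x
  obtain ⟨X', r, hr⟩ := h X hX
  obtain ⟨c, hc⟩ :=
    exists_eq_smul_coevaluation hX (HasRightDual.exact (X := X)) ((λ_ (𝟙_ C)).inv ≫ x)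
  have x_eq : x = c • (𝟙 _ ⊗ₘ 𝟙 _) ≫ ((λ_ (𝟙_ C)).hom ≫ η_ X X') ≫
      (𝟙 X ⊗ₘ (rightDualIso r (HasRightDual.exact (X := X))).hom) := by
    rw [id_tensorHom_id, Category.id_comp, id_tensorHom, Category.assoc,
      coevaluation_comp_rightDualIso, ← Linear.comp_smul, ← hc, Iso.hom_inv_id_assoc]
  rw [x_eq, map_smul, Θ.natural, hr, smul_comm, Linear.smul_comp, Linear.comp_smul]

variable [CStarTensorCategory C] [RigidCStarTensorCategory C]

/-- The linear functional on the fusion algebra that corresponds to the function `φ` on `Irr C`. It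
is normalized so that the function `1` corresponds to the dimension. -/
noncomputable def symbolFunctional (φ : Irr C → ℂ) : FusionAlgebra C →ₗ[ℂ] ℂ :=
  FusionAlgebra.extend fun π => dim π.rep * φ π

theorem symbolFunctional_basis (φ : Irr C → ℂ) (π : Irr C) :
    symbolFunctional φ (FusionAlgebra.basis π) = dim π.rep * φ π :=
  FusionAlgebra.extend_basis _ _

section StandardPairings

variable {V V' : C} {p : ExactPairing V V'} (hp : IsStandard p)
include hp

theorem extension_coevaluation (hΘ : Θ.HasSymbol φ) {B B' : C} {q : ExactPairing B B'}
    (hq : IsStandard q) :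
    η_ V V' ≫ Θ.toFun _ _ _ _ (dag (η_ V V') ≫ η_ B B') ≫ dag (η_ B B') =
      symbolFunctional φ (FusionAlgebra.of (V' ⊗ B)) • 𝟙 (𝟙_ C) := by
  let _ := dualPairing p
  obtain ⟨n, K, a, hK, h⟩ := exists_irreducible_orthSum (V' ⊗ B)
  rw [extension_eq_sum (X' := V') hΘ hK h, symbolFunctional, FusionAlgebra.extend_of _ h hK]
  simp only [Preadditive.sum_comp, Preadditive.comp_sum, Linear.smul_comp, Linear.comp_smul,
    Finset.sum_smul]
  refine Finset.sum_congr rfl fun i _ => ?_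
  have trace_summand :
      η_ B B' ≫ leftPartialTrace (dag (η_ V V')) (dag (a i) ≫ a i) ▷ B' ≫ dag (η_ B B') =
        (dim (K i) : ℂ) • 𝟙 (𝟙_ C) :=
    (hp.dualPairing.tensor_trace_eq_leftPartialTrace (dag (a i) ≫ a i)).symm.trans
      (IsStandard.trace_summand h (hp.dualPairing.tensor hq) i)
  rw [← Category.assoc, coevaluation_comp_insertEnd p, Category.assoc, trace_summand, smul_smul,
    dim_rep_mk, mul_comm]

variable {W W' X X' : C} {q : ExactPairing W W'} (hq : IsStandard q) {r : ExactPairing X X'}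
  (hr : IsStandard r) (hX : IsIrreducible X) (hΘ : Θ.HasSymbol φ)
include hq hr hX hΘ

theorem coevaluation_comp_extension_comp_dag_insertPair :
    η_ V V' ≫ Θ.toFun _ _ _ _ (dag (η_ V V') ≫ η_ (X ⊗ W) (W' ⊗ X')) ≫
        dag (insertPair X X' (η_ W W')) =
      ((dim X : ℂ)⁻¹ * symbolFunctional φ (FusionAlgebra.of (V' ⊗ (X ⊗ W)))) • η_ X X' := by
  obtain ⟨c, hc⟩ := exists_eq_smul_coevaluation hX r (η_ V V' ≫
    Θ.toFun _ _ _ _ (dag (η_ V V') ≫ η_ (X ⊗ W) (W' ⊗ X')) ≫ dag (insertPair X X' (η_ W W')))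
  have dim_mul : dim X * c = symbolFunctional φ (FusionAlgebra.of (V' ⊗ (X ⊗ W))) := by
    refine (irreducible_unit (C := C)).smul_id_injective ?_
    beta_reduce
    rw [← extension_coevaluation hp hΘ (hr.tensor hq), mul_comm, ← smul_smul,
      ← hr.coevaluation_comp_dag, ← Linear.smul_comp, ← hc, Category.assoc, Category.assoc,
      ← dag_comp, coevaluation_comp_insertPair]
  rw [hc, ← dim_mul, inv_mul_cancel_left₀ (Complex.ofReal_ne_zero.2 (dim_ne_zero hX))]

theorem insertPair_comp_extension_comp_dag_insertPair :
    insertPair (𝟙_ C) (𝟙_ C) (η_ V V') ≫ Θ.toFun _ _ _ _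
      (dag (insertPair (𝟙_ C) (𝟙_ C) (η_ V V')) ≫ ((λ_ (𝟙_ C)).hom ≫ η_ X X') ≫
        insertPair X X' (η_ W W')) ≫ dag (insertPair X X' (η_ W W')) =
      ((dim X : ℂ)⁻¹ * symbolFunctional φ (FusionAlgebra.of (V' ⊗ (X ⊗ W)))) •
        ((λ_ (𝟙_ C)).hom ≫ η_ X X') := by
  have argument_eq : dag (insertPair (𝟙_ C) (𝟙_ C) (η_ V V')) ≫ ((λ_ (𝟙_ C)).hom ≫ η_ X X') ≫
      insertPair X X' (η_ W W') =
      ((λ_ V).hom ⊗ₘ (ρ_ V').hom) ≫ dag (η_ V V') ≫ η_ (X ⊗ W) (W' ⊗ X') := by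
    rw [insertPair_unit, Category.assoc, coevaluation_comp_insertPair]
    simp [dag_comp, dag_tensor, dag_leftUnitor, dag_leftUnitor_inv, dag_rightUnitor_inv]
  have natural := Θ.natural (dag (η_ V V') ≫ η_ (X ⊗ W) (W' ⊗ X')) (𝟙 _) (𝟙 _) (λ_ V).hom
    (ρ_ V').hom
  simp only [id_tensorHom_id, Category.comp_id] at natural
  have unitors_cancel : ((λ_ V).inv ⊗ₘ (ρ_ V').inv) ≫ ((λ_ V).hom ⊗ₘ (ρ_ V').hom) = 𝟙 _ := by
    rw [tensorHom_comp_tensorHom, Iso.inv_hom_id, Iso.inv_hom_id, id_tensorHom_id]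
  rw [argument_eq, natural, insertPair_unit]
  simp only [Category.assoc, reassoc_of% unitors_cancel]
  rw [coevaluation_comp_extension_comp_dag_insertPair hp hq hr hX hΘ, Linear.comp_smul]

end StandardPairings

theorem FusionAlgebra.exists_eq_sum_smul_of (x : FusionAlgebra C) :
    ∃ (n : ℕ) (V : Fin (n + 1) → C) (c : Fin (n + 1) → ℂ), x = ∑ i, c i • of (V i) := by
  induction x using FusionAlgebra.induction_on with
  | h0 => exact ⟨0, fun _ => 𝟙_ C, 0, by simp⟩
  | hb c π => exact ⟨0, fun _ => π.rep, fun _ => c, by simp [FusionAlgebra.of_rep]⟩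
  | hadd x y hx hy =>
    obtain ⟨n, V, c, rfl⟩ := hx
    obtain ⟨m, W, d, rfl⟩ := hy
    refine ⟨n + 1 + m, (Fin.append V W : Fin (n + 1 + (m + 1)) → C),
      (Fin.append c d : Fin (n + 1 + (m + 1)) → ℂ), ?_⟩
    refine Eq.trans ?_ (Fin.sum_univ_add (a := n + 1) (b := m + 1) _).symm
    simp

theorem FusionAlgebra.star_mul_mul_sum_smul_of {n : ℕ} {V V' : Fin n → C}
    (p : ∀ i, ExactPairing (V i) (V' i)) (c : Fin n → ℂ) (X : C) :
    star (∑ i, c i • of (V i)) * (of X * ∑ i, c i • of (V i)) =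
      ∑ i, ∑ j, (star (c i) * c j) • of (V' i ⊗ (X ⊗ V j)) := by
  have star_of_V (i) : star (of (V i)) = of (V' i) :=
    (star_of _).trans (of_congr (rightDualIso HasRightDual.exact (p i)))
  simp only [star_sum, star_smul, star_of_V, Finset.sum_mul, Finset.mul_sum, mul_smul_comm,
    smul_mul_assoc, of_mul_of, Finset.smul_sum, smul_smul, mul_comm (c _)]
  exact Finset.sum_comm

theorem hasSymbol_compressExtension (hΘ : Θ.HasSymbol φ) {n : ℕ} {U U' : C} {V V' : Fin n → C}
    {p : ∀ i, ExactPairing (V i) (V' i)} (hp : ∀ i, IsStandard (p i)) {a : ∀ i, V i ⟶ U}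
    {a' : ∀ i, V' i ⟶ U'} (ha : IsOrthSum U V a) (ha' : IsOrthSum U' V' a') (c : Fin n → ℂ)
    {x : FusionAlgebra C} (hx : x = ∑ i, c i • FusionAlgebra.of (V i)) :
    (Θ.compressExtension (∑ i, η_ (V i) (V' i) ≫ (a i ⊗ₘ a' i))
      (∑ i, c i • η_ (V i) (V' i) ≫ (a i ⊗ₘ a' i))).HasSymbol fun π =>
        (dim π.rep : ℂ)⁻¹ * symbolFunctional φ (star x * (FusionAlgebra.basis π * x)) := by
  refine Multiplier.Extension.hasSymbol_of_coevaluation fun X hX => ?_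
  obtain ⟨X', r, hr⟩ := exists_isStandard X
  have compressed_element : star x * (FusionAlgebra.basis (Irr.mk X hX) * x) =
      ∑ i, ∑ j, (star (c i) * c j) • FusionAlgebra.of (V' i ⊗ (X ⊗ V j)) := by
    rw [hx, ← FusionAlgebra.of_irreducible hX, FusionAlgebra.star_mul_mul_sum_smul_of p c X]
  refine ⟨X', r, (Θ.compressMap_sum ha ha' _ c _).trans ?_⟩
  simp only [insertPair_comp_extension_comp_dag_insertPair (hp _) (hp _) hr hX hΘ, smul_smul,
    ← Finset.sum_smul, compressed_element, map_sum, map_smul, Finset.mul_sum, dim_rep_mk,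
    smul_eq_mul, mul_left_comm]

theorem IsCPMultiplier.compress (hφ : IsCPMultiplier φ) (x : FusionAlgebra C) :
    IsCPMultiplier fun π => (dim π.rep : ℂ)⁻¹ *
      symbolFunctional φ (star x * (FusionAlgebra.basis π * x)) := by
  obtain ⟨θ, hθ, Θ, hΘ⟩ := hφ
  obtain ⟨n, V, c, hx⟩ := FusionAlgebra.exists_eq_sum_smul_of x
  choose V' p hp using fun i => exists_isStandard (V i)
  obtain ⟨U, a, ha⟩ := exists_orthSum n V
  obtain ⟨U', a', ha'⟩ := exists_orthSum n V'
  exact ⟨_, Θ.isPositiveType_compress _ _ hθ, _, hasSymbol_compressExtension hΘ hp ha ha' c hx⟩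

end CompressionSymbol

/-! ### Admissible representations and the trivial representation -/

variable {C : Type u} [Category.{v} C] [Preadditive C] [Linear ℂ C]
  [MonoidalCategory C] [MonoidalPreadditive C] [MonoidalLinear ℂ C] [RightRigidCategory C]
  [CStarTensorCategory C] [RigidCStarTensorCategory C]

section MultiplierGNS

open scoped ComplexOrder

namespace IsCPMultiplier

variable {φ : Irr C → ℂ}

theorem unit_nonneg (hφ : IsCPMultiplier φ) : 0 ≤ φ (Irr.unit C) := by
  obtain ⟨θ, hθ, Θ, hΘ⟩ := hφ
  have unit_irreducible : IsIrreducible (𝟙_ C ⊗ 𝟙_ C) := irreducible_unit.congr (λ_ (𝟙_ C)).symm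
  have one_nonneg : (0 : End (𝟙_ C ⊗ 𝟙_ C)) ≤ 𝟙 (𝟙_ C ⊗ 𝟙_ C) := by
    simpa only [dag_id, Category.comp_id] using comp_dag_nonneg (𝟙 (𝟙_ C ⊗ 𝟙_ C))
  have map_one_nonneg := hθ.map_nonneg one_nonneg
  rw [θ.toFun_id ⟨Θ, hΘ⟩] at map_one_nonneg
  obtain ⟨g, hg⟩ := exists_eq_comp_dag map_one_nonneg
  obtain ⟨c, hc, hgc⟩ := exists_scalar unit_irreducible g
  rw [unit_irreducible.smul_id_injective (hg.trans hgc)]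
  exact_mod_cast hc

theorem symbolFunctional_nonneg (hφ : IsCPMultiplier φ) (x : FusionAlgebra C) :
    0 ≤ symbolFunctional φ (star x * x) := by
  simpa only [show FusionAlgebra.basis (Irr.unit C) * x = x from one_mul x, dim_rep_unit,
    Complex.ofReal_one, inv_one, one_mul] using (hφ.compress x).unit_nonneg

theorem norm_symbolFunctional_le (hφ : IsCPMultiplier φ) (x : FusionAlgebra C) (π : Irr C) :
    ‖symbolFunctional φ (star x * (FusionAlgebra.basis π * x))‖ ≤
      2 * dim π.rep * (symbolFunctional φ (star x * x)).re := by
  have hd : 0 < dim π.rep := dim_pos π.irreducible_rep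
  have norm_le := (hφ.compress x).norm_le π
  rw [show FusionAlgebra.basis (Irr.unit C) * x = x from one_mul x, dim_rep_unit,
    Complex.ofReal_one, inv_one, one_mul, norm_mul, norm_inv, Complex.norm_real,
    Real.norm_of_nonneg hd.le, inv_mul_le_iff₀ hd] at norm_le
  rw [Complex.re_eq_norm.2 (hφ.symbolFunctional_nonneg x)]
  linarith

theorem exists_norm_symbolFunctional_le (hφ : IsCPMultiplier φ) (a : FusionAlgebra C) :
    ∃ M : ℝ, ∀ x, ‖symbolFunctional φ (star x * (a * x))‖ ≤
      M * (symbolFunctional φ (star x * x)).re := by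
  induction a using FusionAlgebra.induction_on with
  | h0 => exact ⟨0, fun x => by simp⟩
  | hadd a b ha hb =>
    obtain ⟨M, hM⟩ := ha
    obtain ⟨N, hN⟩ := hb
    refine ⟨M + N, fun x => ?_⟩
    rw [add_mul, mul_add, map_add, add_mul]
    exact (norm_add_le _ _).trans (add_le_add (hM x) (hN x))
  | hb c π =>
    refine ⟨‖c‖ * (2 * dim π.rep), fun x => ?_⟩
    rw [smul_mul_assoc, mul_smul_comm, map_smul, norm_smul, mul_assoc]
    exact mul_le_mul_of_nonneg_left (hφ.norm_symbolFunctional_le x π) (norm_nonneg c)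

/-- The positive functional on the fusion algebra given by a cp-multiplier. -/
noncomputable def positiveFunctional (hφ : IsCPMultiplier φ) :
    PositiveFunctional (FusionAlgebra C) where
  __ := symbolFunctional φ
  nonneg := hφ.symbolFunctional_nonneg

theorem positiveFunctional_apply (hφ : IsCPMultiplier φ) (x : FusionAlgebra C) :
    hφ.positiveFunctional x = symbolFunctional φ x := rfl

theorem isLeftBounded_positiveFunctional (hφ : IsCPMultiplier φ) :
    hφ.positiveFunctional.IsLeftBounded := fun a => by
  obtain ⟨M, hM⟩ := hφ.exists_norm_symbolFunctional_le (star a * a)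
  refine ⟨M, fun x => ?_⟩
  rw [star_mul, mul_assoc, ← mul_assoc (star a)]
  exact (Complex.re_le_norm _).trans (hM x)

/-- The GNS representation of a cp-multiplier. -/
noncomputable abbrev gnsRep (hφ : IsCPMultiplier φ) : FusionAlgebra C →⋆ₐ[ℂ]
    (hφ.positiveFunctional.GNS →L[ℂ] hφ.positiveFunctional.GNS) :=
  PositiveFunctional.gnsRep hφ.isLeftBounded_positiveFunctional

theorem inner_toGNS_gnsRep (hφ : IsCPMultiplier φ) (a x : FusionAlgebra C) :
    inner ℂ (hφ.positiveFunctional.toGNS x) (hφ.gnsRep a (hφ.positiveFunctional.toGNS x)) =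
      symbolFunctional φ (star x * (a * x)) := by
  rw [PositiveFunctional.gnsRep_toGNS, PositiveFunctional.inner_toGNS, positiveFunctional_apply]

theorem inner_toGNS_one (hφ : IsCPMultiplier φ) (π : Irr C) :
    inner ℂ (hφ.positiveFunctional.toGNS 1)
      (hφ.gnsRep (FusionAlgebra.basis π) (hφ.positiveFunctional.toGNS 1)) = dim π.rep * φ π := by
  rw [inner_toGNS_gnsRep, star_one, one_mul, mul_one, symbolFunctional_basis]

-- The coefficients of the vectors in the image of the fusion algebra are compressions of `φ`; the
-- others are pointwise limits of these.
theorem isAdmissible_gnsRep (hφ : IsCPMultiplier φ) : IsAdmissible hφ.gnsRep := fun ξ => by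
  let j := hφ.positiveFunctional.toGNS
  have : (Filter.comap j (nhds ξ)).NeBot :=
    Filter.comap_neBot fun _ ht => hφ.positiveFunctional.denseRange_toGNS.mem_nhds ht
  have j_tendsto : Filter.Tendsto j (Filter.comap j (nhds ξ)) (nhds ξ) := Filter.tendsto_comap
  refine of_tendsto (l := Filter.comap j (nhds ξ)) (φ := fun x π =>
    (dim π.rep : ℂ)⁻¹ * inner ℂ (j x) (hφ.gnsRep (FusionAlgebra.basis π) (j x)))
    (fun π => ?_) fun x => ?_
  · exact (j_tendsto.inner (((hφ.gnsRep (FusionAlgebra.basis π)).continuous.tendsto ξ).comp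
      j_tendsto)).const_mul _
  · simp only [j, inner_toGNS_gnsRep]
    exact hφ.compress x

end IsCPMultiplier

end MultiplierGNS

section UniversalAlgebra

namespace AdmissibleRep

/-- The extension of an admissible representation to the universal C*-algebra. -/
noncomputable def extend (Θ : AdmissibleRep C) :
    UniversalCStarAlgebra C →⋆ₐ[ℂ] (Θ.K →L[ℂ] Θ.K) :=
  (BoundedFamilies.eval Θ).comp (ClosedRange.incl (universalRep C))

theorem extend_toUniversal (Θ : AdmissibleRep C) (x : FusionAlgebra C) :
    Θ.extend (toUniversal C x) = Θ.Θ x := rfl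

end AdmissibleRep

namespace UniversalCStarAlgebra

theorem norm_le {x : UniversalCStarAlgebra C} {M : ℝ} (hM : 0 ≤ M)
    (h : ∀ Θ : AdmissibleRep C, ‖Θ.extend x‖ ≤ M) : ‖x‖ ≤ M :=
  BoundedFamilies.norm_le_of_forall_le (x := ClosedRange.incl (universalRep C) x) hM h

theorem ext_extend {x y : UniversalCStarAlgebra C}
    (h : ∀ Θ : AdmissibleRep C, Θ.extend x = Θ.extend y) : x = y := by
  rw [← sub_eq_zero, ← norm_le_zero_iff]
  exact norm_le le_rfl fun Θ => by rw [map_sub, h, sub_self, norm_zero]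

end UniversalCStarAlgebra

variable (C) in
theorem denseRange_toUniversal : DenseRange (toUniversal C) :=
  ClosedRange.denseRange_restrict _

end UniversalAlgebra

section TrivialRepresentation

omit [RigidCStarTensorCategory C] in
theorem isCPMultiplier_one : IsCPMultiplier fun _ : Irr C => 1 :=
  ⟨{ toFun _ _ := LinearMap.id, natural _ _ _ _ _ := rfl, amplify _ _ _ _ _ := rfl },
    Multiplier.isPositiveType_of_nonneg fun _ _ _ hx => hx,
    { toFun _ _ _ _ := LinearMap.id, natural _ _ _ _ _ := rfl, restrict _ _ _ := rfl },
    fun _ _ _ => (one_smul ℂ _).symm⟩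

theorem symbolFunctional_one (x : FusionAlgebra C) :
    symbolFunctional (fun _ => 1) x = dimHom C x := by
  simp only [symbolFunctional, mul_one]
  rfl

theorem isCPMultiplier_normSq_dimHom (x : FusionAlgebra C) :
    IsCPMultiplier fun _ : Irr C => star (dimHom C x) * dimHom C x := by
  convert isCPMultiplier_one.compress x using 2 with π
  have hd : (dim π.rep : ℂ) ≠ 0 := by exact_mod_cast dim_ne_zero π.irreducible_rep
  rw [symbolFunctional_one, map_mul, map_mul, map_star, dimHom_basis, mul_left_comm _ (dim _ : ℂ),
    inv_mul_cancel_left₀ hd]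

variable (C) in
/-- The trivial representation, on a one-dimensional Hilbert space. -/
noncomputable def trivialRep : AdmissibleRep C where
  K := EuclideanSpace ℂ PUnit.{u + 1}
  Θ := (StarAlgHom.ofId ℂ _).comp (dimHom C)
  admissible ξ := by
    convert isCPMultiplier_normSq_dimHom (C := C) ((‖ξ‖ : ℂ) • 1) using 2 with π
    have hd : (dim π.rep : ℂ) ≠ 0 := by exact_mod_cast dim_ne_zero π.irreducible_rep
    change (dim π.rep : ℂ)⁻¹ * inner ℂ ξ (dimHom C (FusionAlgebra.basis π) • ξ) = _
    rw [dimHom_basis, inner_smul_right, inner_self_eq_norm_sq_to_K, inv_mul_cancel_left₀ hd,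
      map_smul, map_one, smul_eq_mul, mul_one, Complex.star_def, Complex.conj_ofReal]
    exact sq _

variable (C) in
/-- The embedding of the scalars into the operators on the space of the trivial representation. -/
noncomputable abbrev trivialRepScalar : ℂ →⋆ₐ[ℂ] ((trivialRep C).K →L[ℂ] (trivialRep C).K) :=
  StarAlgHom.ofId ℂ _

variable (C) in
theorem trivialRepScalar_injective : Function.Injective (trivialRepScalar C) :=
  (algebraMap ℂ ((trivialRep C).K →L[ℂ] (trivialRep C).K)).injective

theorem trivialRep_extend_mem_range (x : UniversalCStarAlgebra C) :
    (trivialRep C).extend x ∈ (trivialRepScalar C).range := by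
  have isClosed_range : IsClosed (Set.range (trivialRepScalar C)) :=
    (NonUnitalStarAlgHom.isometry (trivialRepScalar C)
      (trivialRepScalar_injective C)).isClosedEmbedding.isClosed_range
  exact (denseRange_toUniversal C).induction_on x
    (isClosed_range.preimage (map_continuous (trivialRep C).extend)) fun a => ⟨dimHom C a, rfl⟩

variable (C) in
/-- The trivial representation of the universal C*-algebra, as a character: the operators of
`trivialRep` are scalar. -/
noncomputable def trivialCharacter : UniversalCStarAlgebra C →⋆ₐ[ℂ] ℂ :=
  ((StarAlgEquiv.ofInjective (trivialRepScalar C) (trivialRepScalar_injective C)).symm :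
    (trivialRepScalar C).range →⋆ₐ[ℂ] ℂ).comp
    ((trivialRep C).extend.codRestrict (trivialRepScalar C).range trivialRep_extend_mem_range)

theorem trivialRepScalar_trivialCharacter (x : UniversalCStarAlgebra C) :
    trivialRepScalar C (trivialCharacter C x) = (trivialRep C).extend x :=
  congrArg Subtype.val
    ((StarAlgEquiv.ofInjective (trivialRepScalar C) (trivialRepScalar_injective C)).apply_symm_apply
      ⟨(trivialRep C).extend x, trivialRep_extend_mem_range x⟩)

theorem trivialCharacter_toUniversal (a : FusionAlgebra C) :
    trivialCharacter C (toUniversal C a) = dimHom C a :=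
  trivialRepScalar_injective C (trivialRepScalar_trivialCharacter _)

theorem isTrivialRep_trivialCharacter : IsTrivialRep (trivialCharacter C) := fun X =>
  (trivialCharacter_toUniversal _).trans (dimHom_of X)

theorem IsTrivialRep.eq_trivialCharacter {e : UniversalCStarAlgebra C →⋆ₐ[ℂ] ℂ}
    (he : IsTrivialRep e) : e = trivialCharacter C := by
  refine StarAlgHom.ext fun x => (denseRange_toUniversal C).induction_on x
    (isClosed_eq (map_continuous e) (map_continuous _)) fun a => ?_
  obtain ⟨n, V, c, rfl⟩ := FusionAlgebra.exists_eq_sum_smul_of a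
  simp only [map_sum, map_smul]
  exact Finset.sum_congr rfl fun i _ => congrArg _
    ((he (V i)).trans (isTrivialRep_trivialCharacter (V i)).symm)

namespace IsTrivialProjection

variable {p : UniversalCStarAlgebra C}

theorem mul_eq (hp : IsTrivialProjection p) (x : UniversalCStarAlgebra C) :
    x * p = trivialCharacter C x • p := by
  refine (denseRange_toUniversal C).induction_on x (isClosed_eq (by fun_prop)
    ((map_continuous (trivialCharacter C)).smul continuous_const)) fun a => ?_
  obtain ⟨n, V, c, rfl⟩ := FusionAlgebra.exists_eq_sum_smul_of a
  simp only [map_sum, map_smul, Finset.sum_mul, Finset.sum_smul, smul_mul_assoc, smul_assoc]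
  refine Finset.sum_congr rfl fun i _ => congrArg _ ?_
  exact (hp.2.2 (V i)).trans (congrArg (· • p) (isTrivialRep_trivialCharacter (V i)).symm)

theorem eq_mul (hp : IsTrivialProjection p) (x : UniversalCStarAlgebra C) :
    p * x = trivialCharacter C x • p := by
  have := congrArg star (hp.mul_eq (star x))
  rwa [star_mul, star_star, star_smul, map_star, star_star, hp.2.1.isSelfAdjoint.star_eq] at this

theorem trivialCharacter_eq (hp : IsTrivialProjection p) : trivialCharacter C p = 1 := by
  refine smul_left_injective ℂ hp.1 ?_
  beta_reduce
  rw [← hp.mul_eq p, hp.2.1.isIdempotentElem.eq, one_smul]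

theorem unique {q : UniversalCStarAlgebra C} (hp : IsTrivialProjection p)
    (hq : IsTrivialProjection q) : q = p := calc
  q = p * q := by rw [hq.mul_eq p, hp.trivialCharacter_eq, one_smul]
  _ = p := by rw [hp.eq_mul q, hq.trivialCharacter_eq, one_smul]

end IsTrivialProjection

end TrivialRepresentation

section NormBounds

theorem dim_nonneg (X : C) : 0 ≤ dim X := by
  obtain ⟨n, Y, a, hY, h⟩ := exists_irreducible_orthSum X
  rw [dim_orthSum h]
  exact Finset.sum_nonneg fun i _ => (dim_pos (hY i)).le

theorem FusionAlgebra.exists_of_pow (X : C) (n : ℕ) :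
    ∃ Z : C, of X ^ n = of Z ∧ dim Z = dim X ^ n := by
  induction n with
  | zero =>
    exact ⟨𝟙_ C, (pow_zero (of X)).trans (of_irreducible (irreducible_unit (C := C))).symm,
      by rw [dim_unit, pow_zero]⟩
  | succ n ih =>
    obtain ⟨Z, of_pow, dim_pow⟩ := ih
    exact ⟨Z ⊗ X, by rw [pow_succ, of_pow, of_mul_of], by rw [dim_tensor, dim_pow, pow_succ]⟩

namespace AdmissibleRep

variable (Θ : AdmissibleRep C)

theorem norm_of_le_four_mul (X : C) : ‖Θ.Θ (FusionAlgebra.of X)‖ ≤ 4 * dim X := by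
  obtain ⟨n, Y, a, hY, h⟩ := exists_irreducible_orthSum X
  rw [dim_orthSum h, FusionAlgebra.of_isDirectSum h, map_sum, Finset.mul_sum]
  refine norm_sum_le_of_le _ fun i _ => ?_
  rw [FusionAlgebra.of_irreducible (hY i)]
  refine (Θ.admissible.norm_le _).trans_eq ?_
  rw [dim_rep_unit, dim_rep_mk, abs_one, inv_one, mul_one, abs_of_pos (dim_pos (hY i))]

-- The factor 4 disappears on applying the weaker bound to the tensor powers of `X* ⊗ X`.
theorem norm_of_le (X : C) : ‖Θ.Θ (FusionAlgebra.of X)‖ ≤ dim X := by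
  set T := Θ.Θ (FusionAlgebra.of X) with hT
  have star_mul_self_eq : star T * T = Θ.Θ (FusionAlgebra.of (Xᘁ ⊗ X)) := by
    rw [hT, ← map_star, ← map_mul, FusionAlgebra.star_of, FusionAlgebra.of_mul_of]
  have norm_star_mul_self_le : ‖star T * T‖ ≤ dim X ^ 2 := by
    refine le_of_forall_pow_two_pow_le (c := 4) (by positivity) fun n => ?_
    obtain ⟨Z, of_pow, dim_pow⟩ := FusionAlgebra.exists_of_pow (Xᘁ ⊗ X) (2 ^ n)
    calc ‖star T * T‖ ^ 2 ^ n = ‖(star T * T) ^ 2 ^ n‖ :=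
          congrArg NNReal.toReal ((IsSelfAdjoint.star_mul_self T).nnnorm_pow_two_pow n).symm
      _ = ‖Θ.Θ (FusionAlgebra.of Z)‖ := by rw [star_mul_self_eq, ← map_pow, of_pow]
      _ ≤ 4 * dim Z := Θ.norm_of_le_four_mul Z
      _ = 4 * (dim X ^ 2) ^ 2 ^ n := by rw [dim_pow, dim_tensor, dim_dual, sq]
  rw [CStarRing.norm_star_mul_self, ← sq] at norm_star_mul_self_le
  exact le_of_sq_le_sq norm_star_mul_self_le (dim_nonneg X)

end AdmissibleRep

end NormBounds

section NormalizedBasis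

namespace FusionAlgebra

/-- The basis element `π / d(π)`, which the dimension homomorphism sends to `1`. -/
noncomputable def normalizedBasis (π : Irr C) : FusionAlgebra C := (dim π.rep : ℂ)⁻¹ • basis π

theorem dim_smul_normalizedBasis (π : Irr C) :
    (dim π.rep : ℂ) • normalizedBasis π = basis π :=
  smul_inv_smul₀ (by exact_mod_cast dim_ne_zero π.irreducible_rep) _

theorem dimHom_normalizedBasis (π : Irr C) : dimHom C (normalizedBasis π) = 1 := by
  rw [normalizedBasis, map_smul, dimHom_basis, smul_eq_mul,
    inv_mul_cancel₀ (by exact_mod_cast dim_ne_zero π.irreducible_rep)]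

theorem normalizedBasis_unit : normalizedBasis (Irr.unit C) = 1 := by
  rw [normalizedBasis, dim_rep_unit, Complex.ofReal_one, inv_one, one_smul]
  rfl

theorem normalizedBasis_mul_mem_convexHull (β π : Irr C) :
    normalizedBasis β * normalizedBasis π ∈ convexHull ℝ (Set.range normalizedBasis) := by
  obtain ⟨n, Y, a, hY, h⟩ := exists_irreducible_orthSum (β.rep ⊗ π.rep)
  let w (i : Fin n) : ℝ := (dim β.rep)⁻¹ * (dim π.rep)⁻¹ * dim (Y i)
  have hβ : dim β.rep ≠ 0 := dim_ne_zero β.irreducible_rep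
  have hπ : dim π.rep ≠ 0 := dim_ne_zero π.irreducible_rep
  have sum_weights : ∑ i, w i = 1 := by
    rw [← Finset.mul_sum, ← dim_orthSum h, dim_tensor]
    field_simp
  have product_eq : normalizedBasis β * normalizedBasis π =
      ∑ i, w i • normalizedBasis (Irr.mk (Y i) (hY i)) := by
    rw [normalizedBasis, normalizedBasis, smul_mul_smul_comm, basis_mul_basis, of_isDirectSum h,
      Finset.smul_sum]
    refine Finset.sum_congr rfl fun i _ => ?_
    rw [of_irreducible (hY i), ← dim_smul_normalizedBasis, dim_rep_mk, smul_smul,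
      RCLike.real_smul_eq_coe_smul (K := ℂ)]
    simp only [w, Complex.coe_algebraMap, Complex.ofReal_mul, Complex.ofReal_inv]
  rw [product_eq]
  exact (convex_convexHull ℝ _).sum_mem
    (fun i _ => mul_nonneg (mul_nonneg (inv_nonneg.2 (dim_nonneg _)) (inv_nonneg.2 (dim_nonneg _)))
      (dim_nonneg _)) sum_weights fun i _ => subset_convexHull ℝ _ (Set.mem_range_self _)

end FusionAlgebra

open FusionAlgebra

namespace AdmissibleRep

variable (Θ : AdmissibleRep C)

theorem norm_normalizedBasis_le_one (π : Irr C) : ‖Θ.Θ (normalizedBasis π)‖ ≤ 1 := by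
  have hd : 0 < dim π.rep := dim_pos π.irreducible_rep
  rw [normalizedBasis, ← of_rep, map_smul, norm_smul, norm_inv, Complex.norm_real,
    Real.norm_of_nonneg hd.le, inv_mul_le_iff₀ hd, mul_one]
  exact Θ.norm_of_le π.rep

/-- The diagonal coefficient `π ↦ d(π)⁻¹ ⟨Θ(π) ξ, ξ⟩` of an admissible representation. -/
noncomputable def coefficient (ξ : Θ.K) (π : Irr C) : ℂ :=
  inner ℂ ξ (Θ.Θ (normalizedBasis π) ξ)

theorem isCPMultiplier_coefficient (ξ : Θ.K) : IsCPMultiplier (Θ.coefficient ξ) := by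
  convert Θ.admissible ξ with π
  rw [coefficient, normalizedBasis, map_smul, smul_apply, inner_smul_right]

theorem norm_coefficient_le (ξ : Θ.K) (π : Irr C) : ‖Θ.coefficient ξ π‖ ≤ ‖ξ‖ ^ 2 :=
  calc ‖Θ.coefficient ξ π‖ ≤ ‖ξ‖ * ‖Θ.Θ (normalizedBasis π) ξ‖ := norm_inner_le_norm _ _
    _ ≤ ‖ξ‖ * (1 * ‖ξ‖) := by
        gcongr
        exact ContinuousLinearMap.le_of_opNorm_le _ (Θ.norm_normalizedBasis_le_one π) ξ
    _ = ‖ξ‖ ^ 2 := by rw [one_mul, sq]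

theorem abs_re_coefficient_le (ξ : Θ.K) (π : Irr C) : |(Θ.coefficient ξ π).re| ≤ ‖ξ‖ ^ 2 :=
  (Complex.abs_re_le_norm _).trans (Θ.norm_coefficient_le ξ π)

end AdmissibleRep

end NormalizedBasis

section Invariants

open FusionAlgebra

namespace AdmissibleRep

variable (Θ : AdmissibleRep C)

/-- The invariant vectors of an admissible representation: those on which every `π / d(π)` acts
trivially. -/
noncomputable def invariants : Submodule ℂ Θ.K where
  carrier := {η | ∀ π, Θ.Θ (normalizedBasis π) η = η}
  add_mem' hx hy π := by rw [map_add, hx π, hy π]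
  zero_mem' _ := map_zero _
  smul_mem' c x hx π := by rw [map_smul, hx π]

instance : CompleteSpace Θ.invariants := by
  have : IsClosed {η | ∀ π, Θ.Θ (normalizedBasis π) η = η} := by
    rw [Set.ofPred_forall]
    exact isClosed_iInter fun π => isClosed_eq (Θ.Θ (normalizedBasis π)).continuous continuous_id
  exact this.completeSpace_coe

variable {Θ}

theorem apply_of_mem_invariants {η : Θ.K} (hη : η ∈ Θ.invariants) (x : FusionAlgebra C) :
    Θ.Θ x η = dimHom C x • η := by
  induction x using FusionAlgebra.induction_on with
  | h0 => rw [map_zero, map_zero, zero_apply, zero_smul]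
  | hadd x y hx hy => rw [map_add, map_add, add_apply, hx, hy, add_smul]
  | hb c π =>
    rw [← dim_smul_normalizedBasis, map_smul, map_smul, map_smul, map_smul, smul_apply, smul_apply,
      hη π, dimHom_normalizedBasis, smul_eq_mul, smul_eq_mul, mul_one, smul_smul]

variable (Θ)

theorem mapsTo_closedConvexHull_orbit (ξ : Θ.K) (β : Irr C) :
    Set.MapsTo (Θ.Θ (normalizedBasis β))
      (closedConvexHull ℝ (Set.range fun π => Θ.Θ (normalizedBasis π) ξ))
      (closedConvexHull ℝ (Set.range fun π => Θ.Θ (normalizedBasis π) ξ)) := by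
  let T : Θ.K →L[ℝ] Θ.K := (Θ.Θ (normalizedBasis β)).restrictScalars ℝ
  let orbitMap : FusionAlgebra C →ₗ[ℝ] Θ.K :=
    { toFun x := Θ.Θ x ξ
      map_add' x y := by rw [map_add, add_apply]
      map_smul' r x := by
        rw [RCLike.real_smul_eq_coe_smul (K := ℂ), map_smul, smul_apply,
          ← RCLike.real_smul_eq_coe_smul (K := ℂ), RingHom.id_apply] }
  refine closedConvexHull_min (t := T ⁻¹' _) ?_
    (convex_closedConvexHull.linear_preimage T.toLinearMap)
    (isClosed_closedConvexHull.preimage T.continuous)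
  rintro _ ⟨π, rfl⟩
  have image_eq : orbitMap '' convexHull ℝ (Set.range normalizedBasis) =
      convexHull ℝ (Set.range fun π => Θ.Θ (normalizedBasis π) ξ) := by
    rw [LinearMap.image_convexHull, ← Set.range_comp]
    rfl
  refine convexHull_subset_closedConvexHull (image_eq ▸
    ⟨_, normalizedBasis_mul_mem_convexHull β π, ?_⟩)
  exact congrArg (· ξ) (map_mul Θ.Θ _ _)

-- The element of smallest norm in the closed convex hull of the orbit is invariant.
theorem exists_mem_invariants_of_le_re_coefficient {ξ : Θ.K} {c : ℝ}
    (hc : ∀ π, c ≤ (Θ.coefficient ξ π).re) : ∃ η ∈ Θ.invariants, c ≤ (inner ℂ ξ η).re := by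
  let := InnerProductSpace.complexToReal (G := Θ.K)
  let Q : Set Θ.K := closedConvexHull ℝ (Set.range fun π => Θ.Θ (normalizedBasis π) ξ)
  have half_space : Q ⊆ {η | c ≤ (inner ℂ ξ η).re} := by
    refine closedConvexHull_min (Set.range_subset_iff.2 hc) ?_
      (isClosed_le continuous_const (by fun_prop))
    exact (convex_Ici c).linear_preimage
      (Complex.reLm ∘ₗ (innerSL ℂ ξ).toLinearMap.restrictScalars ℝ)
  obtain ⟨η, hη, invariant⟩ := exists_mem_forall_apply_eq_of_norm_le
    (Q := Q) (T := fun π => Θ.Θ (normalizedBasis π)) isClosed_closedConvexHull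
    convex_closedConvexHull
    ⟨_, subset_closedConvexHull ⟨Irr.unit C, rfl⟩⟩
    (fun π x => by
      simpa only [one_mul] using
        ContinuousLinearMap.le_of_opNorm_le _ (Θ.norm_normalizedBasis_le_one π) x)
    (Θ.mapsTo_closedConvexHull_orbit ξ)
  exact ⟨η, invariant, half_space hη⟩

end AdmissibleRep

end Invariants

/-! ### The Kazhdan projection -/

open FusionAlgebra

section KazhdanPair

omit [RigidCStarTensorCategory C] in
theorem HasPropertyT.exists_finset (h : HasPropertyT C) {r : ℝ} (hr : 0 < r) :
    ∃ (F : Finset (Irr C)) (δ : ℝ), 0 < δ ∧ δ ≤ 1 ∧ ∀ φ : Irr C → ℂ, IsCPMultiplier φ →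
      (∀ π ∈ F, ‖φ π - 1‖ < δ) → ∀ π, ‖φ π - 1‖ ≤ r := by
  suffices ∃ (F : Finset (Irr C)) (n : ℕ), ∀ φ : Irr C → ℂ, IsCPMultiplier φ →
      (∀ π ∈ F, ‖φ π - 1‖ < 1 / ((n : ℝ) + 1)) → ∀ π, ‖φ π - 1‖ ≤ r by
    obtain ⟨F, n, hF⟩ := this
    exact ⟨F, _, Nat.one_div_pos_of_nat, div_le_one_of_le₀ (by simp) (by positivity), hF⟩
  classical
  by_contra! hcon
  choose φ hφ hF π hπ using hcon
  have tendsto_one (ρ : Irr C) :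
      Filter.Tendsto (fun i : Finset (Irr C) × ℕ => φ i.1 i.2 ρ) Filter.atTop (nhds 1) := by
    refine Metric.tendsto_atTop.2 fun s hs => ?_
    obtain ⟨N, hN⟩ := exists_nat_one_div_lt hs
    refine ⟨({ρ}, N), fun i hi => ?_⟩
    rw [dist_eq_norm]
    exact (hF i.1 i.2 ρ (hi.1 (Finset.mem_singleton_self ρ))).trans
      ((Nat.one_div_le_one_div hi.2).trans_lt hN)
  have tendstoUniformly_one :=
    h (Finset (Irr C) × ℕ) (fun i => φ i.1 i.2) (fun i => hφ i.1 i.2) tendsto_one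
  obtain ⟨i, hi⟩ := (Metric.tendstoUniformly_iff.1 tendstoUniformly_one r hr).exists
  have norm_lt := hi (π i.1 i.2)
  rw [dist_comm, dist_eq_norm] at norm_lt
  exact (hπ i.1 i.2).not_gt norm_lt

theorem AdmissibleRep.exists_half_lt_norm_coefficient_sub_one (Θ : AdmissibleRep C) {ξ : Θ.K}
    (hξ : ξ ∈ Θ.invariantsᗮ) : ∃ π, 1 / 2 < ‖Θ.coefficient ξ π - 1‖ := by
  by_contra! hcon
  have half_le_re (π : Irr C) : 1 / 2 ≤ (Θ.coefficient ξ π).re := by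
    have := (abs_le.1 ((Complex.abs_re_le_norm _).trans (hcon π))).1
    rw [Complex.sub_re, Complex.one_re] at this
    linarith
  obtain ⟨η, hη, half_le⟩ := Θ.exists_mem_invariants_of_le_re_coefficient half_le_re
  rw [Submodule.inner_left_of_mem_orthogonal hη hξ, Complex.zero_re] at half_le
  norm_num at half_le

theorem AdmissibleRep.coefficient_smul (Θ : AdmissibleRep C) (c : ℂ) (ξ : Θ.K) (π : Irr C) :
    Θ.coefficient (c • ξ) π = (‖c‖ ^ 2 : ℝ) * Θ.coefficient ξ π := by
  rw [coefficient, map_smul, inner_smul_left, inner_smul_right, ← mul_assoc, Complex.conj_mul',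
    Complex.ofReal_pow, coefficient]

theorem re_le_of_le_norm_sub_one {z : ℂ} (hz : ‖z‖ ≤ 1) {δ : ℝ} (hδ : 0 ≤ δ) (h : δ ≤ ‖z - 1‖) :
    z.re ≤ 1 - δ ^ 2 / 2 := by
  have norm_sub_one_sq : ‖z - 1‖ ^ 2 = ‖z‖ ^ 2 - 2 * z.re + 1 := by
    simp only [Complex.sq_norm, Complex.normSq_apply, Complex.sub_re, Complex.sub_im,
      Complex.one_re, Complex.one_im]
    ring
  have sq_le : δ ^ 2 ≤ ‖z - 1‖ ^ 2 := by gcongr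
  have norm_sq_le : ‖z‖ ^ 2 ≤ 1 := pow_le_one₀ (norm_nonneg z) hz
  linarith

theorem HasPropertyT.exists_kazhdan_pair (h : HasPropertyT C) :
    ∃ (F : Finset (Irr C)) (κ : ℝ), 0 < κ ∧ κ ≤ 1 ∧ ∀ (Θ : AdmissibleRep C), ∀ ξ ∈ Θ.invariantsᗮ,
      ξ ≠ 0 → ∃ ρ ∈ F, (Θ.coefficient ξ ρ).re ≤ (1 - κ) * ‖ξ‖ ^ 2 := by
  obtain ⟨F, δ, δ_pos, δ_le_one, hF⟩ := h.exists_finset one_half_pos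
  refine ⟨F, δ ^ 2 / 2, by positivity, by nlinarith, fun Θ ξ hξ hne => ?_⟩
  have norm_pos : 0 < ‖ξ‖ := norm_pos_iff.2 hne
  let ζ : Θ.K := ((‖ξ‖⁻¹ : ℝ) : ℂ) • ξ
  have norm_ζ : ‖ζ‖ = 1 := by
    rw [norm_smul, Complex.norm_real, norm_inv, norm_norm, inv_mul_cancel₀ norm_pos.ne']
  obtain ⟨ρ, hρ, δ_le⟩ : ∃ ρ ∈ F, δ ≤ ‖Θ.coefficient ζ ρ - 1‖ := by
    by_contra! hcon
    obtain ⟨π, hπ⟩ :=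
      Θ.exists_half_lt_norm_coefficient_sub_one (ξ := ζ) (Submodule.smul_mem _ _ hξ)
    exact hπ.not_ge (hF _ (Θ.isCPMultiplier_coefficient ζ) hcon π)
  have norm_le_one : ‖Θ.coefficient ζ ρ‖ ≤ 1 := by
    simpa only [norm_ζ, one_pow] using Θ.norm_coefficient_le ζ ρ
  have re_le := re_le_of_le_norm_sub_one norm_le_one δ_pos.le δ_le
  rw [Θ.coefficient_smul, Complex.re_ofReal_mul, Complex.norm_real, norm_inv, norm_norm, inv_pow,
    inv_mul_le_iff₀ (by positivity)] at re_le
  exact ⟨ρ, hρ, re_le.trans_eq (mul_comm _ _)⟩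

end KazhdanPair

section MarkovElement

/-- The self-adjoint element of the fusion algebra that averages the `π / d(π)` and their adjoints
over `π ∈ F` together with sufficiently many copies of `1` to be positive. -/
noncomputable def markov (F : Finset (Irr C)) : FusionAlgebra C :=
  (2 * F.card + 1 : ℂ)⁻¹ • ((F.card + 1 : ℂ) • 1 +
    ∑ π ∈ F, (2⁻¹ : ℂ) • (normalizedBasis π + star (normalizedBasis π)))

theorem star_markov (F : Finset (Irr C)) : star (markov F) = markov F := by
  simp only [markov, star_smul, star_add, star_sum, star_one, star_star, star_inv₀, star_mul,
    star_natCast, star_ofNat, add_comm (star (normalizedBasis _)), mul_comm (2 : ℂ)]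

theorem dimHom_markov (F : Finset (Irr C)) : dimHom C (markov F) = 1 := by
  have card_ne_zero : (2 * F.card + 1 : ℂ) ≠ 0 := by
    exact_mod_cast (by positivity : (2 * F.card + 1 : ℝ) ≠ 0)
  simp only [markov, map_smul, map_add, map_sum, map_one, map_star, dimHom_normalizedBasis,
    star_one, Finset.sum_const, nsmul_eq_mul, smul_eq_mul]
  field_simp
  ring

namespace AdmissibleRep

variable (Θ : AdmissibleRep C) (F : Finset (Irr C))

theorem re_inner_markov (ξ : Θ.K) : (2 * F.card + 1) * (inner ℂ ξ (Θ.Θ (markov F) ξ)).re =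
    (F.card + 1) * ‖ξ‖ ^ 2 + ∑ π ∈ F, (Θ.coefficient ξ π).re := by
  have re_inner_star (π : Irr C) :
      (inner ℂ ξ (star (Θ.Θ (normalizedBasis π)) ξ)).re = (Θ.coefficient ξ π).re := by
    rw [ContinuousLinearMap.star_eq_adjoint, ContinuousLinearMap.adjoint_inner_right]
    exact inner_re_symm (𝕜 := ℂ) _ _
  have re_inner_self : (inner ℂ ξ ξ).re = ‖ξ‖ ^ 2 := inner_self_eq_norm_sq (𝕜 := ℂ) ξ
  have markov_eq : markov F = (((2 * F.card + 1)⁻¹ : ℝ) : ℂ) • (((F.card + 1 : ℝ) : ℂ) • 1 +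
      ∑ π ∈ F, ((2⁻¹ : ℝ) : ℂ) • (normalizedBasis π + star (normalizedBasis π))) := by
    push_cast
    rfl
  simp only [markov_eq, map_smul, map_add, map_sum, map_one, map_star, smul_apply, add_apply,
    sum_apply, one_apply_eq_self, inner_smul_right, inner_add_right, inner_sum,
    Complex.re_ofReal_mul, Complex.add_re, Complex.re_sum, re_inner_star, re_inner_self]
  rw [mul_inv_cancel_left₀ (by positivity)]
  refine congrArg _ (Finset.sum_congr rfl fun π _ => ?_)
  rw [coefficient]
  ring

theorem re_inner_markov_nonneg (ξ : Θ.K) : 0 ≤ (inner ℂ ξ (Θ.Θ (markov F) ξ)).re := by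
  have sum_ge : F.card * -‖ξ‖ ^ 2 ≤ ∑ π ∈ F, (Θ.coefficient ξ π).re := by
    rw [← nsmul_eq_mul]
    exact F.card_nsmul_le_sum _ _ fun π _ => (abs_le.1 (Θ.abs_re_coefficient_le ξ π)).1
  refine nonneg_of_mul_nonneg_right (a := (2 * F.card + 1 : ℝ)) ?_ (by positivity)
  rw [re_inner_markov]
  linarith [sq_nonneg ‖ξ‖]

theorem re_inner_markov_le {ξ : Θ.K} {κ : ℝ} {ρ : Irr C} (hρ : ρ ∈ F)
    (h : (Θ.coefficient ξ ρ).re ≤ (1 - κ) * ‖ξ‖ ^ 2) :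
    (inner ℂ ξ (Θ.Θ (markov F) ξ)).re ≤ (1 - κ / (2 * F.card + 1)) * ‖ξ‖ ^ 2 := by
  classical
  have sum_erase_le : ∑ π ∈ F.erase ρ, (Θ.coefficient ξ π).re ≤ (F.card - 1) * ‖ξ‖ ^ 2 := by
    rw [← Nat.cast_pred (Finset.card_pos.2 ⟨ρ, hρ⟩), ← Finset.card_erase_of_mem hρ, ← nsmul_eq_mul]
    exact Finset.sum_le_card_nsmul _ _ _ fun π _ =>
      (le_abs_self _).trans (Θ.abs_re_coefficient_le ξ π)
  have pos : (0 : ℝ) < 2 * F.card + 1 := by positivity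
  rw [← mul_le_mul_iff_right₀ pos, re_inner_markov, ← Finset.add_sum_erase F _ hρ, ← mul_assoc,
    mul_sub, mul_div_cancel₀ _ pos.ne']
  linarith

end AdmissibleRep

theorem HasPropertyT.exists_spectral_gap (h : HasPropertyT C) :
    ∃ (F : Finset (Irr C)) (r : ℝ), 0 ≤ r ∧ r < 1 ∧ ∀ (Θ : AdmissibleRep C), ∀ ξ ∈ Θ.invariantsᗮ,
      (inner ℂ ξ (Θ.Θ (markov F) ξ)).re ≤ r * ‖ξ‖ ^ 2 := by
  obtain ⟨F, κ, κ_pos, κ_le_one, hF⟩ := h.exists_kazhdan_pair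
  have κ_le : κ ≤ 2 * F.card + 1 := κ_le_one.trans (by simp)
  refine ⟨F, 1 - κ / (2 * F.card + 1), sub_nonneg.2 (div_le_one_of_le₀ κ_le (by positivity)),
    sub_lt_self _ (by positivity), fun Θ ξ hξ => ?_⟩
  rcases eq_or_ne ξ 0 with rfl | hne
  · simp
  obtain ⟨ρ, hρ, re_coefficient_le⟩ := hF Θ ξ hξ hne
  exact Θ.re_inner_markov_le F hρ re_coefficient_le

end MarkovElement

section KazhdanProjection

theorem AdmissibleRep.norm_markov_pow_sub_le (Θ : AdmissibleRep C) {F : Finset (Irr C)} {r : ℝ}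
    (hr : 0 ≤ r) (h : ∀ ξ ∈ Θ.invariantsᗮ, (inner ℂ ξ (Θ.Θ (markov F) ξ)).re ≤ r * ‖ξ‖ ^ 2)
    (n : ℕ) : ‖Θ.extend (toUniversal C (markov F) ^ (n + 1)) - Θ.invariants.starProjection‖ ≤
      r ^ (n + 1) := by
  rw [map_pow, extend_toUniversal]
  refine norm_pow_sub_starProjection_le ?_ (fun ξ hξ => ?_) hr (fun ξ hξ => ?_) n
  · rw [IsSelfAdjoint, ← map_star, star_markov]
  · rw [apply_of_mem_invariants hξ, dimHom_markov, one_smul]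
  · rw [← inner_conj_symm, Complex.conj_re, abs_of_nonneg (Θ.re_inner_markov_nonneg F ξ)]
    exact h ξ hξ

theorem UniversalCStarAlgebra.exists_forall_extend_eq {x : ℕ → UniversalCStarAlgebra C}
    {T : ∀ Θ : AdmissibleRep C, Θ.K →L[ℂ] Θ.K} {a : ℕ → ℝ}
    (ha : Filter.Tendsto a Filter.atTop (nhds 0))
    (h : ∀ (Θ : AdmissibleRep C) n, ‖Θ.extend (x n) - T Θ‖ ≤ a n) :
    ∃ p, ∀ Θ : AdmissibleRep C, Θ.extend p = T Θ := by
  have a_nonneg (n : ℕ) : 0 ≤ a n := (norm_nonneg _).trans (h (trivialRep C) n)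
  have dist_le (m n : ℕ) : dist (x m) (x n) ≤ a m + a n := by
    rw [dist_eq_norm]
    refine norm_le (add_nonneg (a_nonneg m) (a_nonneg n)) fun Θ => ?_
    rw [map_sub, ← sub_sub_sub_cancel_right _ _ (T Θ)]
    exact (norm_sub_le _ _).trans (add_le_add (h Θ m) (h Θ n))
  have cauchySeq_x : CauchySeq x := by
    refine Metric.cauchySeq_iff.2 fun s hs => ?_
    obtain ⟨N, hN⟩ := Filter.eventually_atTop.1 (ha.eventually_lt_const (half_pos hs))
    exact ⟨N, fun m hm n hn => (dist_le m n).trans_lt (by linarith [hN m hm, hN n hn])⟩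
  obtain ⟨p, hp⟩ := cauchySeq_tendsto_of_complete cauchySeq_x
  exact ⟨p, fun Θ => tendsto_nhds_unique (((map_continuous Θ.extend).tendsto p).comp hp)
    (tendsto_iff_norm_sub_tendsto_zero.2 (squeeze_zero (fun _ => norm_nonneg _) (h Θ) ha))⟩

theorem mem_invariants_trivialRep (ξ : (trivialRep C).K) : ξ ∈ (trivialRep C).invariants :=
  fun π => by
    change dimHom C (normalizedBasis π) • ξ = ξ
    rw [dimHom_normalizedBasis, one_smul]

theorem isTrivialProjection_of_extend_eq_starProjection {p : UniversalCStarAlgebra C}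
    (h : ∀ Θ : AdmissibleRep C, Θ.extend p = Θ.invariants.starProjection) :
    IsTrivialProjection p := by
  refine ⟨?_, ⟨?_, ?_⟩, fun X => ?_⟩
  · rintro rfl
    obtain ⟨ξ, hξ⟩ := exists_ne (0 : (trivialRep C).K)
    have projection_eq := Submodule.starProjection_eq_self_iff.2 (mem_invariants_trivialRep ξ)
    rw [← h, map_zero] at projection_eq
    exact hξ projection_eq.symm
  · refine UniversalCStarAlgebra.ext_extend fun Θ => ?_
    rw [map_mul, h, (Submodule.isIdempotentElem_starProjection _).eq]
  · refine UniversalCStarAlgebra.ext_extend fun Θ => ?_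
    rw [map_star, h, (isSelfAdjoint_starProjection _).star_eq]
  · refine UniversalCStarAlgebra.ext_extend fun Θ => ?_
    rw [map_mul, map_smul, h, objElement, AdmissibleRep.extend_toUniversal]
    ext ξ
    change Θ.Θ (FusionAlgebra.of X) (Θ.invariants.starProjection ξ) = _
    rw [AdmissibleRep.apply_of_mem_invariants (Submodule.starProjection_apply_mem _ ξ), dimHom_of]
    rfl

theorem HasPropertyT.exists_isTrivialProjection (h : HasPropertyT C) :
    ∃ p : UniversalCStarAlgebra C, IsTrivialProjection p := by
  obtain ⟨F, r, r_nonneg, r_lt_one, gap⟩ := h.exists_spectral_gap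
  have pow_tendsto : Filter.Tendsto (fun n => r ^ (n + 1)) Filter.atTop (nhds 0) :=
    (tendsto_pow_atTop_nhds_zero_of_lt_one r_nonneg r_lt_one).comp (Filter.tendsto_add_atTop_nat 1)
  obtain ⟨p, hp⟩ := UniversalCStarAlgebra.exists_forall_extend_eq pow_tendsto
    fun Θ n => Θ.norm_markov_pow_sub_le r_nonneg (gap Θ) n
  exact ⟨p, isTrivialProjection_of_extend_eq_starProjection hp⟩

end KazhdanProjection

/-! ### States and cp-multipliers -/

section MultiplierStates

theorem AdmissibleRep.coefficient_unit (Θ : AdmissibleRep C) (ξ : Θ.K) :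
    Θ.coefficient ξ (Irr.unit C) = (‖ξ‖ : ℂ) ^ 2 := by
  rw [coefficient, normalizedBasis_unit, map_one]
  exact inner_self_eq_norm_sq_to_K ξ

theorem IsCPMultiplier.exists_coefficient_eq {φ : Irr C → ℂ} (hφ : IsCPMultiplier φ) :
    ∃ (Θ : AdmissibleRep C) (ξ : Θ.K), Θ.coefficient ξ = φ := by
  let ξ := hφ.positiveFunctional.toGNS 1
  have coefficient_eq (π : Irr C) : inner ℂ ξ (hφ.gnsRep (normalizedBasis π) ξ) = φ π := by
    rw [normalizedBasis, map_smul, smul_apply, inner_smul_right, hφ.inner_toGNS_one,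
      inv_mul_cancel_left₀ (by exact_mod_cast dim_ne_zero π.irreducible_rep)]
  obtain hξ | hξ := eq_or_ne ξ 0
  · refine ⟨trivialRep C, 0, funext fun π => ?_⟩
    rw [AdmissibleRep.coefficient, inner_zero_left, ← coefficient_eq, hξ, inner_zero_left]
  · have : Nontrivial hφ.positiveFunctional.GNS := nontrivial_of_ne _ _ hξ
    exact ⟨⟨_, hφ.gnsRep, hφ.isAdmissible_gnsRep⟩, ξ, funext coefficient_eq⟩

theorem IsCPMultiplier.exists_state {φ : Irr C → ℂ} (hφ : IsCPMultiplier φ) :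
    ∃ ω : UniversalCStarAlgebra C →L[ℂ] ℂ, IsState ω ∧
      ∀ π, φ π = φ (Irr.unit C) * ω (toUniversal C (normalizedBasis π)) := by
  obtain ⟨Θ, ξ, rfl⟩ := hφ.exists_coefficient_eq
  obtain rfl | hξ := eq_or_ne ξ 0
  · exact ⟨_, isState_characterFunctional (trivialCharacter C), fun π => by
      rw [AdmissibleRep.coefficient, AdmissibleRep.coefficient, inner_zero_left, inner_zero_left,
        zero_mul]⟩
  · refine ⟨_, isState_vectorState Θ.extend hξ, fun π => ?_⟩
    rw [vectorState_apply, Θ.extend_toUniversal, Θ.coefficient_unit,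
      mul_inv_cancel_left₀ (by simpa using hξ), AdmissibleRep.coefficient]

theorem tendsto_trivialCharacter {ι : Type*} {l : Filter ι}
    {ω : ι → UniversalCStarAlgebra C →L[ℂ] ℂ} (hω : ∀ n, IsState (ω n))
    (h : ∀ π, Filter.Tendsto (fun n => ω n (toUniversal C (normalizedBasis π))) l (nhds 1))
    (x : UniversalCStarAlgebra C) :
    Filter.Tendsto (fun n => ω n x) l (nhds (trivialCharacter C x)) := by
  refine IsState.tendsto_of_denseRange (denseRange_toUniversal C) hω
    (characterFunctional (trivialCharacter C)) (fun a => ?_) x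
  change Filter.Tendsto _ _ (nhds (trivialCharacter C _))
  rw [trivialCharacter_toUniversal]
  induction a using FusionAlgebra.induction_on with
  | h0 => simpa only [map_zero] using tendsto_const_nhds
  | hadd x y hx hy => simpa only [map_add] using hx.add hy
  | hb c π =>
    simp only [← dim_smul_normalizedBasis π, map_smul, dimHom_normalizedBasis]
    exact ((h π).const_smul _).const_smul c

theorem norm_toUniversal_normalizedBasis_le_one (π : Irr C) :
    ‖toUniversal C (normalizedBasis π)‖ ≤ 1 :=
  UniversalCStarAlgebra.norm_le zero_le_one fun Θ => Θ.norm_normalizedBasis_le_one π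

theorem norm_mul_apply_normalizedBasis_sub_one_le (ω : UniversalCStarAlgebra C →L[ℂ] ℂ) (c : ℂ)
    (π : Irr C) : ‖c * ω (toUniversal C (normalizedBasis π)) - 1‖ ≤
      ‖c‖ * ‖ω - characterFunctional (trivialCharacter C)‖ + ‖c - 1‖ := by
  set χ := characterFunctional (trivialCharacter C)
  set x := toUniversal C (normalizedBasis π)
  have χ_eq_one : χ x = 1 := (trivialCharacter_toUniversal _).trans (dimHom_normalizedBasis π)
  have norm_apply_le : ‖(ω - χ) x‖ ≤ ‖ω - χ‖ :=
    (ω - χ).unit_le_opNorm x (norm_toUniversal_normalizedBasis_le_one π)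
  calc ‖c * ω x - 1‖ = ‖c * (ω - χ) x + (c - 1)‖ := by
        rw [sub_apply, χ_eq_one]
        ring_nf
    _ ≤ ‖c‖ * ‖(ω - χ) x‖ + ‖c - 1‖ := by
        rw [← norm_mul]
        exact norm_add_le _ _
    _ ≤ ‖c‖ * ‖ω - χ‖ + ‖c - 1‖ := by gcongr

end MultiplierStates

section Equivalence

variable (C) in
/-- Condition 3 of the theorem for the trivial character: weak* convergence of states to it implies
norm convergence. -/
def StatesConverge : Prop :=
  ∀ (ι : Type (u + 1)) [Preorder ι] [IsDirectedOrder ι] [Nonempty ι]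
    (ω : ι → UniversalCStarAlgebra C →L[ℂ] ℂ), (∀ n, IsState (ω n)) →
    (∀ x, Filter.Tendsto (fun n => ω n x) Filter.atTop (nhds (trivialCharacter C x))) →
    Filter.Tendsto (fun n => ‖ω n - characterFunctional (trivialCharacter C)‖)
      Filter.atTop (nhds 0)

theorem IsTrivialProjection.statesConverge {p : UniversalCStarAlgebra C}
    (hp : IsTrivialProjection p) : StatesConverge C := by
  intro ι _ _ _ ω hω hlim
  have tendsto_norm : Filter.Tendsto (fun n => ‖ω n p - 1‖) Filter.atTop (nhds 0) :=
    tendsto_iff_norm_sub_tendsto_zero.1 (hp.trivialCharacter_eq ▸ hlim p)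
  refine squeeze_zero (fun n => norm_nonneg _)
    (fun n => (hω n).norm_sub_characterFunctional_le hp.2.1 hp.mul_eq) ?_
  simpa only [Real.sqrt_zero, add_zero] using tendsto_norm.sqrt.add tendsto_norm

namespace StatesConverge

theorem tendsto_norm_sub {ι : Type u} [Preorder ι] [IsDirectedOrder ι] [Nonempty ι]
    {ω : ι → UniversalCStarAlgebra C →L[ℂ] ℂ} (h : StatesConverge C) (hω : ∀ n, IsState (ω n))
    (hlim : ∀ x, Filter.Tendsto (fun n => ω n x) Filter.atTop (nhds (trivialCharacter C x))) :
    Filter.Tendsto (fun n => ‖ω n - characterFunctional (trivialCharacter C)‖)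
      Filter.atTop (nhds 0) := by
  have : IsDirectedOrder (ULift.{u + 1} ι) := ⟨fun a b => by
    obtain ⟨c, hac, hbc⟩ := exists_ge_ge a.down b.down
    exact ⟨⟨c⟩, hac, hbc⟩⟩
  have up_tendsto : Filter.Tendsto (ULift.up : ι → ULift.{u + 1} ι) Filter.atTop Filter.atTop :=
    Filter.tendsto_atTop_atTop.2 fun b => ⟨b.down, fun _ ha => ha⟩
  have down_tendsto : Filter.Tendsto (ULift.down : ULift.{u + 1} ι → ι) Filter.atTop Filter.atTop :=
    Filter.tendsto_atTop_atTop.2 fun b => ⟨⟨b⟩, fun _ ha => ha⟩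
  exact (h (ULift.{u + 1} ι) (fun n => ω n.down) (fun n => hω _)
    fun x => (hlim x).comp down_tendsto).comp up_tendsto

theorem hasPropertyT (h : StatesConverge C) : HasPropertyT C := by
  intro ι _ _ _ φ hφ hlim
  choose ω hω φ_eq using fun n => (hφ n).exists_state
  let χ := characterFunctional (trivialCharacter C)
  have unit_tendsto : Filter.Tendsto (fun n => φ n (Irr.unit C)) Filter.atTop (nhds 1) := hlim _
  have normalizedBasis_tendsto (π : Irr C) : Filter.Tendsto
      (fun n => ω n (toUniversal C (normalizedBasis π))) Filter.atTop (nhds 1) := by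
    have quotient_tendsto := (hlim π).div unit_tendsto one_ne_zero
    rw [div_one] at quotient_tendsto
    refine quotient_tendsto.congr' ?_
    filter_upwards [unit_tendsto.eventually_ne one_ne_zero] with n hn
    rw [Pi.div_apply, φ_eq n π, mul_div_cancel_left₀ _ hn]
  have norm_tendsto : Filter.Tendsto (fun n => ‖ω n - χ‖) Filter.atTop (nhds 0) :=
    h.tendsto_norm_sub hω (tendsto_trivialCharacter hω normalizedBasis_tendsto)
  have bound_tendsto : Filter.Tendsto (fun n => ‖φ n (Irr.unit C)‖ * ‖ω n - χ‖ +
      ‖φ n (Irr.unit C) - 1‖) Filter.atTop (nhds 0) := by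
    simpa only [mul_zero, add_zero] using
      (unit_tendsto.norm.mul norm_tendsto).add (tendsto_iff_norm_sub_tendsto_zero.1 unit_tendsto)
  refine Metric.tendstoUniformly_iff.2 fun r hr => ?_
  filter_upwards [bound_tendsto.eventually_lt_const hr] with n hn π
  rw [dist_comm, dist_eq_norm, φ_eq n π]
  exact (norm_mul_apply_normalizedBasis_sub_one_le _ _ π).trans_lt hn

end StatesConverge

end Equivalence

end RigidCStarTensorCategory

theorem proposition5p5
    {C : Type u} [Category.{v} C] [Preadditive C] [Linear ℂ C] [MonoidalCategory C]
    [MonoidalPreadditive C] [MonoidalLinear ℂ C] [RightRigidCategory C]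
    [CStarTensorCategory C] [RigidCStarTensorCategory C] :
    ∃ ε : UniversalCStarAlgebra C →⋆ₐ[ℂ] ℂ,
      IsTrivialRep ε ∧ (∀ ε', IsTrivialRep ε' → ε' = ε) ∧
      List.TFAE [
        HasPropertyT C,
        ∃ p : UniversalCStarAlgebra C, IsTrivialProjection p,
        ∀ (ι : Type (u + 1)) [Preorder ι] [IsDirectedOrder ι] [Nonempty ι]
          (ω : ι → UniversalCStarAlgebra C →L[ℂ] ℂ), (∀ n, IsState (ω n)) →
          (∀ x, Filter.Tendsto (fun n => ω n x) Filter.atTop (nhds (ε x))) →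
          Filter.Tendsto (fun n => ‖ω n - characterFunctional ε‖)
            Filter.atTop (nhds 0)] ∧
      ∀ p : UniversalCStarAlgebra C, IsTrivialProjection p →
        ε p = 1 ∧ ∀ q, IsTrivialProjection q → q = p := by
  refine ⟨trivialCharacter C, isTrivialRep_trivialCharacter, fun _ he => he.eq_trivialCharacter, ?_,
    fun _ hp => ⟨hp.trivialCharacter_eq, fun _ hq => hp.unique hq⟩⟩
  tfae_have 1 → 2 := fun h => h.exists_isTrivialProjection
  tfae_have 2 → 3 := fun ⟨_, hp⟩ => hp.statesConverge
  tfae_have 3 → 1 := fun h => StatesConverge.hasPropertyT h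
  tfae_finish
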